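/- \textbf{Conventions.} $\mathcal F f(u)=\int e^{iux}f(x)\,dx$ on finite measures and $L^1(\mathbb R)$, extended to $L^2(\mathbb R)$ by Plancherel; $\mathcal F^{-1}$ is its inverse; $\phi^{-1}=1/\phi$; $A\lesssim B$ means $A\le CB$ with a constant $C$, and $A\sim B$ means $A\lesssim B\lesssim A$. \textbf{Setting.} Let $(L_t)_{t\ge0}$ be a real Lévy process of finite variation with drift $\gamma\in\mathbb R$ and Lévy measure $\nu$ ($\nu(\{0\})=0$, $\int(|x|\wedge1)\,\nu(dx)<\infty$), i.e. $E[e^{iuL_t}]=e^{t\psi(u)}$ with $\psi(u)=i\gamma u+\int(e^{iux}-1)\,\nu(dx)$. Fix $\Delta>0$ and let $X_k=L_{k\Delta}-L_{(k-1)\Delta}$, $k\ge 1$, with law $P$ and characteristic function $\phi=e^{\Delta\psi}$. Let $P_n=\frac1n\sum_{k=1}^n\delta_{X_k}$ and $\phi_n=\mathcal FP_n$. \textbf{Assumption 1.} For some $\varepsilon>0$: (a) $\int\max(|x|,|x|^{2+\varepsilon})\,\nu(dx)<\infty$; (b) $x\nu(dx)$ has a bounded Lebesgue density and $|\mathcal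 F[x\nu](u)|\lesssim(1+|u|)^{-1}$; (c) $(1+|u|)^{-1+\varepsilon}\phi^{-1}(u)\in L^2(\mathbb R)$. \textbf{Kernel.} $K:\mathbb R\to\mathbb R$ is differentiable, $\int K=1$, $\operatorname{supp}\mathcal FK\subset[-1,1]$, and $|K(x)|+|K'(x)|\lesssim(1+|x|)^{-\beta}$ for some $\beta>2$; $K_h(x)=h^{-1}K(x/h)$. \textbf{Admissibility.} A real function $g\in L^\infty(\mathbb R)\cap L^2(\mathbb R)$ is admissible if it is Lipschitz continuous in a neighbourhood of $0$ and $g=g^c+g^s$ with $g^c\in H^1(\mathbb R)$, $g^s\in L^1(\mathbb R)$ and $\max(|\mathcal F[g^s](u)|,|\mathcal F[xg^s](u)|)\lesssim(1+|u|)^{-1}$, where $xg^s$ is in $L^1(\mathbb R)$ or $L^2(\mathbb R)$. \textbf{Theorem.} Suppose Assumption 1 holds, $g$ is admissible and $h_n\sim n^{-1/2}(\log n)^{-\rho}$ for some $\rho>1$. Set $$\hat N_n(g)=\frac1{i\Delta}\int_{\mathbb R}g(x)\,\mathcal F^{-1}\Big[\frac{\phi_n'}{\phi_n}\,\mathcal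 FK_{h_n}\Big](x)\,dx,\qquad N(g)=\int g(x)\,x\,\nu(dx).$$ With probability tending to one $\phi_n$ has no zero in $[-h_n^{-1},h_n^{-1}]$, so that the estimator $\hat N_n(g)$ is well defined; it is real-valued (outside this event the inner or outer integral may fail to exist and is then read as $0$). As $n\to\infty$, $$\sqrt n\,\big(\hat N_n(g)-N(g)-\gamma g(0)\big)\to^{\mathcal L}N(0,\sigma_g^2),$$ and in particular $\sqrt n(\hat N_n(g)-N(g))\to^{\mathcal L}N(0,\sigma_g^2)$ whenever $\gamma g(0)=0$. The variance is finite and given by $$\sigma_g^2=(i\Delta)^{-2}\int_{\mathbb R}\Big(\mathcal F^{-1}[\mathcal Fg(u)\phi^{-1}(-u)](x)\,ix+\mathcal F^{-1}[\mathcal Fg(u)(\phi^{-1})'(-u)](x)\Big)^2P(dx).$$ Here $\mathcal Fg(u)\phi^{-1}(-u)$ and $\mathcal Fg(u)(\phi^{-1})'(-u)$ are in $L^2(\mathbb R)$, and the function in the large brackets, which the Plancherel transform determines only up to Lebesgue-null sets, is understood as the limit of its mean values over $[x-r,x+r]$ as $r\downarrow0$; this limit exists for $P$-almost every $x$ and defines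 a function in $L^2(P)$. -/

import Mathlib

open MeasureTheory ProbabilityTheory Filter
open scoped Topology NNReal ENNReal FourierTransform

namespace LevyCLT

noncomputable section

/-! ### Fourier transforms, with the convention `F f (u) = ∫ e^{iux} f(x) dx` -/

/-- Fourier transform of an integrable function, `F f (u) = ∫ e^{iux} f(x) dx`. -/
def ft (f : ℝ → ℂ) (u : ℝ) : ℂ :=
  ∫ x : ℝ, Complex.exp (Complex.I * u * x) * f x

/-- Inverse Fourier transform of an integrable function,
`F⁻¹ G (x) = (2π)⁻¹ ∫ e^{-iux} G(u) du`. -/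
def invFt (G : ℝ → ℂ) (x : ℝ) : ℂ :=
  (2 * (Real.pi : ℂ))⁻¹ * ∫ u : ℝ, Complex.exp (-(Complex.I * u * x)) * G u

open Classical in
/-- Fourier-Plancherel transform of a square-integrable function, in the same convention as `ft`
(Mathlib's `𝓕⁻` has the kernel `e^{2πiux}`). It is determined up to Lebesgue-null sets; the value
is `0` if `f` is not in `L²`. -/
def ftL2 (f : ℝ → ℂ) (u : ℝ) : ℂ :=
  if hf : MemLp f 2 (volume : Measure ℝ) then
    (𝓕⁻ (hf.toLp f) : Lp ℂ 2 (volume : Measure ℝ)) (u / (2 * Real.pi))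
  else 0

open Classical in
/-- Inverse Fourier-Plancherel transform of a square-integrable function, in the same convention as
`invFt` (Mathlib's `𝓕` has the kernel `e^{-2πiux}`). It is determined up to Lebesgue-null sets; the
value is `0` if `G` is not in `L²`. -/
def invFtL2 (G : ℝ → ℂ) (x : ℝ) : ℂ :=
  if hG : MemLp G 2 (volume : Measure ℝ) then
    (2 * (Real.pi : ℂ))⁻¹ * (𝓕 (hG.toLp G) : Lp ℂ 2 (volume : Measure ℝ)) (x / (2 * Real.pi))
  else 0

/-! ### Lévy processes of finite variation -/

/-- Real-valued Lévy process (no regularity of the paths beyond continuity in probability is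
required). -/
structure IsLevyProcess {Ω : Type*} [MeasurableSpace Ω] (L : ℝ≥0 → Ω → ℝ) (μ : Measure Ω) :
    Prop where
  measurable : ∀ t, Measurable (L t)
  zero : ∀ᵐ ω ∂μ, L 0 ω = 0
  indep : HasIndepIncrements L μ
  stationary : ∀ s t, μ.map (fun ω ↦ L (s + t) ω - L s ω) = μ.map (L t)
  continuousInProb : ∀ t, TendstoInMeasure μ L (𝓝 t) (L t)

/-- A Lévy measure of finite variation type: `ν({0}) = 0` and `∫ (|x| ∧ 1) ν(dx) < ∞`. -/
structure IsFVLevyMeasure (ν : Measure ℝ) : Prop where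
  zero : ν {0} = 0
  finite : ∫⁻ x, ENNReal.ofReal (min |x| 1) ∂ν < ∞

/-- The characteristic exponent `ψ(u) = iγu + ∫ (e^{iux} - 1) ν(dx)`. -/
def psi (γ : ℝ) (ν : Measure ℝ) (u : ℝ) : ℂ :=
  Complex.I * γ * u + ∫ x : ℝ, (Complex.exp (Complex.I * u * x) - 1) ∂ν

/-- `L` is a Lévy process of finite variation with drift `γ` and Lévy measure `ν`. -/
structure IsFVLevyProcess {Ω : Type*} [MeasurableSpace Ω] (L : ℝ≥0 → Ω → ℝ) (μ : Measure Ω)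
    (γ : ℝ) (ν : Measure ℝ) : Prop where
  levy : IsLevyProcess L μ
  levyMeasure : IsFVLevyMeasure ν
  charFun_eq : ∀ (t : ℝ≥0) (u : ℝ),
    charFun (μ.map (L t)) u = Complex.exp (((t : ℝ) : ℂ) * psi γ ν u)

/-- The increments `X_{k+1} = L_{(k+1)Δ} - L_{kΔ}`, `k = 0, 1, …`. -/
def increment {Ω : Type*} (L : ℝ≥0 → Ω → ℝ) (Δ : ℝ≥0) (k : ℕ) (ω : Ω) : ℝ :=
  L ((k + 1 : ℕ) * Δ) ω - L ((k : ℕ) * Δ) ω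

/-- Conditions on the jump measure `ν` and the characteristic function `φ` of the increments, with
one common `ε > 0`. -/
def LevyAssumption (ν : Measure ℝ) (φ : ℝ → ℂ) : Prop :=
  ∃ ε : ℝ, 0 < ε ∧
    -- (a) `∫ max(|x|, |x|^{2+ε}) ν(dx) < ∞`
    (∫⁻ x, ENNReal.ofReal (max |x| (|x| ^ (2 + ε))) ∂ν < ∞) ∧
    -- (b) the finite signed measure `x ν(dx)` has a bounded Lebesgue density `k`, and
    -- `|F[xν](u)| ≲ (1 + |u|)⁻¹`
    (∃ k : ℝ → ℝ, Integrable k ∧ (∃ C : ℝ, ∀ x, |k x| ≤ C) ∧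
      ν.withDensityᵥ (fun x : ℝ ↦ x) = (volume : Measure ℝ).withDensityᵥ k) ∧
    (∃ C : ℝ, ∀ u : ℝ, ‖∫ x : ℝ, Complex.exp (Complex.I * u * x) * x ∂ν‖ ≤ C * (1 + |u|)⁻¹) ∧
    -- (c) `(1 + |u|)^{-1+ε} φ⁻¹(u) ∈ L²`
    MemLp (fun u : ℝ ↦ (((1 + |u|) ^ (-1 + ε) : ℝ) : ℂ) * (φ u)⁻¹) 2 volume

/-! ### Kernel, bandwidth, admissible functions -/

/-- Band-limited kernel: `∫ K = 1`, `supp F K ⊆ [-1, 1]` and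
`|K(x)| + |K'(x)| ≲ (1 + |x|)^{-β}` for some `β > 2`. -/
structure IsKernel (K : ℝ → ℝ) : Prop where
  differentiable : Differentiable ℝ K
  integral_eq_one : ∫ x, K x = 1
  bandLimited : ∀ u : ℝ, 1 < |u| → ft (fun x ↦ (K x : ℂ)) u = 0
  decay : ∃ β : ℝ, 2 < β ∧ ∃ C : ℝ, ∀ x, |K x| + |deriv K x| ≤ C * (1 + |x|) ^ (-β)

/-- The scaled kernel `K_h(x) = h⁻¹ K(x / h)`. -/
def scaledKernel (K : ℝ → ℝ) (h : ℝ) (x : ℝ) : ℝ := h⁻¹ * K (x / h)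

/-- `h_n ∼ n^{-1/2} (log n)^{-ρ}`: two-sided bounds up to constants, for all large `n`. -/
def BandwidthRate (h : ℕ → ℝ) (ρ : ℝ) : Prop :=
  ∃ c C : ℝ, 0 < c ∧ ∀ᶠ n : ℕ in atTop,
    c * ((n : ℝ) ^ (-(1 / 2) : ℝ) * Real.log n ^ (-ρ)) ≤ h n ∧
    h n ≤ C * ((n : ℝ) ^ (-(1 / 2) : ℝ) * Real.log n ^ (-ρ))

/-- `f ∈ H¹(ℝ)`: `f ∈ L²` and `(1 + |u|) F f (u) ∈ L²`. -/
def MemH1 (f : ℝ → ℂ) : Prop :=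
  MemLp f 2 volume ∧ MemLp (fun u : ℝ ↦ ((1 + |u| : ℝ) : ℂ) * ftL2 f u) 2 volume

/-- `|F f (u)| ≲ (1 + |u|)⁻¹` for a function in `L¹` or in `L²`. -/
def FourierDecay (f : ℝ → ℂ) : Prop :=
  ∃ C : ℝ,
    (Integrable f ∧ ∀ u : ℝ, ‖ft f u‖ ≤ C * (1 + |u|)⁻¹) ∨
    (MemLp f 2 volume ∧ ∀ᵐ u : ℝ, ‖ftL2 f u‖ ≤ C * (1 + |u|)⁻¹)

/-- Admissible functions. -/
structure IsAdmissible (g : ℝ → ℝ) : Prop where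
  bounded : MemLp g ∞ volume
  square_integrable : MemLp g 2 volume
  lipschitz_near_zero : ∃ C : ℝ≥0, ∃ U ∈ 𝓝 (0 : ℝ), LipschitzOnWith C g U
  split : ∃ gc gs : ℝ → ℝ, (∀ᵐ x : ℝ, g x = gc x + gs x) ∧
    MemH1 (fun x ↦ (gc x : ℂ)) ∧ Integrable gs ∧
    FourierDecay (fun x ↦ (gs x : ℂ)) ∧ FourierDecay (fun x ↦ ((x * gs x : ℝ) : ℂ))

/-! ### The estimator -/

/-- Empirical measure `P_n = n⁻¹ ∑_{k=1}^n δ_{X_k}` of the first `n` terms of `X`. -/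
def empMeasure (X : ℕ → ℝ) (n : ℕ) : Measure ℝ :=
  (n : ℝ≥0∞)⁻¹ • ∑ k ∈ Finset.range n, Measure.dirac (X k)

/-- Empirical characteristic function `φ_n`. -/
def empCharFun (X : ℕ → ℝ) (n : ℕ) (u : ℝ) : ℂ := charFun (empMeasure X n) u

/-- The estimator `(iΔ)⁻¹ ∫ g(x) F⁻¹[(φ_n' / φ_n) F K_h](x) dx` based on the first `n` terms
of `X`. -/
def estimator (K : ℝ → ℝ) (Δ : ℝ) (g : ℝ → ℝ) (X : ℕ → ℝ) (n : ℕ) (h : ℝ) : ℂ :=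
  (Complex.I * Δ)⁻¹ * ∫ x : ℝ, (g x : ℂ) *
    invFt (fun u ↦ deriv (empCharFun X n) u / empCharFun X n u *
      ft (fun y ↦ (scaledKernel K h y : ℂ)) u) x

/-! ### The asymptotic variance -/

/-- `u ↦ F g(u) φ⁻¹(-u)`. -/
def symbolOne (g : ℝ → ℝ) (φ : ℝ → ℂ) (u : ℝ) : ℂ :=
  ftL2 (fun x ↦ (g x : ℂ)) u * (φ (-u))⁻¹

/-- `u ↦ F g(u) (φ⁻¹)'(-u)`. -/
def symbolTwo (g : ℝ → ℝ) (φ : ℝ → ℂ) (u : ℝ) : ℂ :=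
  ftL2 (fun x ↦ (g x : ℂ)) u * deriv (fun v ↦ (φ v)⁻¹) (-u)

/-- `F⁻¹[F g(u) φ⁻¹(-u)](x) ix + F⁻¹[F g(u) (φ⁻¹)'(-u)](x)`, determined up to Lebesgue-null
sets. -/
def influence (g : ℝ → ℝ) (φ : ℝ → ℂ) (x : ℝ) : ℂ :=
  invFtL2 (symbolOne g φ) x * (Complex.I * x) + invFtL2 (symbolTwo g φ) x

/-- Mean value of `f` over `[x - r, x + r]`. -/
def localMean (f : ℝ → ℂ) (x r : ℝ) : ℂ := ⨍ y in Set.Icc (x - r) (x + r), f y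

/-- The precise representative of a locally integrable function: the limit of its local means.
It depends only on the Lebesgue class of `f`, equals `f` almost everywhere, and has the value of `f`
at each continuity point. It is needed because the law of the increments can have an atom (at the
drift, for a compound Poisson process with drift), so that a function given up to Lebesgue-null
sets has no value there otherwise. -/
def preciseRep (f : ℝ → ℂ) (x : ℝ) : ℂ := limUnder (𝓝[>] (0 : ℝ)) (localMean f x)

end

end LevyCLT

namespace LevyCLT

noncomputable section

/-! ### Square integrability -/

section SquareIntegrable

variable {α E : Type*} [MeasurableSpace α] [NormedAddCommGroup E] {μ : Measure α}

/-! Write κ for F[xν] and x₀ = Δγ. Differentiating φ = exp(Δψ) gives φ' = i(x₀ + Δκ)φ, so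
(iΔ)⁻¹F⁻¹[φ'/φ] is γδ₀ + xν; the estimator replaces φ by φ_n behind the cut-off FK(hu). With f =
φ_n/φ − 1 one has exactly φ_n'/φ_n = i(x₀ + Δκ) + f' − ff'/(1 + f). The error is thus a
deterministic bias, a term linear in the empirical measure and a quadratic remainder
(`enorm_estimator_sub_le`).

Bias (`exists_abs_centre_sub_le`): by Parseval it consists of γ(∫ g K_h − g(0)), which is O(h) since
g is Lipschitz at 0, and an integral of Fg(u) κ(−u) (FK(−hu) − 1), which is O(h log n) since, apart
from the H¹ part, Fg and κ both decay like 1/|u|. As ρ > 1, √n times this vanishes.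

Linear term: it is the sample mean of `smoothInfluence`, centred because of the differential
equation for φ. The core of the proof is its L²(P) convergence as h → 0 although φ⁻¹ grows
(`exists_lintegral_sq_smoothInfluence_sub_le`). Since (x − x₀)P = P ∗ (Δ xν), the measure |x −
x₀|P(dx) has a bounded density (`withDensity_abs_sub_le`). Of the two factors x − x₀ in the squared
influence function, one pays for passing from P to Lebesgue measure; the other is handled by
Plancherel, multiplication by x being differentiation of the symbol
(`lintegral_sq_id_mul_invFtL2_le`). By condition (c), the symbol built from g^s and its difference
quotients are dominated by an L² weight, while the symbol built from g^c is integrable, so that its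
inverse transform is bounded. The vanishing factor x − x₀ also makes a possible atom of P at x₀
harmless. The classical central limit theorem then applies to the limiting scores.

Remainder: a Sobolev inequality gives |f| ≤ 1/2 on [−1/h, 1/h] with probability tending to one,
because n⁻¹∫|φ|⁻² over this band is O(n⁻¹h^{−2(1−ε)}), which tends to 0. On that event the remainder
is at most a multiple of ∫|Fg||φ|⁻²(|φ_n − φ|² + |φ_n' − φ'|²), whose mean is O(n⁻¹h^{−(1−ε)}) =
o(n^{−1/2}). Slutsky's theorem concludes. -/

lemma eLpNorm_two_sq (f : α → E) : eLpNorm f 2 μ ^ 2 = ∫⁻ x, ‖f x‖ₑ ^ 2 ∂μ := by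
  have := eLpNorm_nnreal_pow_eq_lintegral (μ := μ) (f := f) (p := 2) (by norm_num)
  simpa using this

lemma memLp_two_iff {f : α → E} :
    MemLp f 2 μ ↔ AEStronglyMeasurable f μ ∧ ∫⁻ x, ‖f x‖ₑ ^ 2 ∂μ < ∞ := by
  rw [MemLp, ← eLpNorm_two_sq]
  simp [ENNReal.pow_lt_top_iff]

lemma ae_eq_zero_of_lintegral_sq_eq_zero {f : α → E} (hf : AEStronglyMeasurable f μ)
    (h : ∫⁻ x, ‖f x‖ₑ ^ 2 ∂μ = 0) : ∀ᵐ x ∂μ, f x = 0 := by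
  rw [lintegral_eq_zero_iff' (hf.enorm.pow_const 2)] at h
  filter_upwards [h] with x hx
  simpa using hx

lemma lintegral_sq_add_le (f g : α → E) (hf : AEStronglyMeasurable f μ) :
    ∫⁻ x, ‖f x + g x‖ₑ ^ 2 ∂μ ≤ 2 * ∫⁻ x, ‖f x‖ₑ ^ 2 ∂μ + 2 * ∫⁻ x, ‖g x‖ₑ ^ 2 ∂μ := by
  have : ∀ x, ‖f x + g x‖ₑ ^ 2 ≤ 2 * ‖f x‖ₑ ^ 2 + 2 * ‖g x‖ₑ ^ 2 := fun x ↦ by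
    have h1 : ‖f x + g x‖ ^ 2 ≤ 2 * ‖f x‖ ^ 2 + 2 * ‖g x‖ ^ 2 := by
      have := norm_add_le (f x) (g x)
      nlinarith [sq_nonneg (‖f x‖ - ‖g x‖), norm_nonneg (f x + g x), norm_nonneg (f x),
        norm_nonneg (g x)]
    have h2 := ENNReal.ofReal_le_ofReal h1
    rw [ENNReal.ofReal_add (by positivity) (by positivity), ENNReal.ofReal_mul (by norm_num),
      ENNReal.ofReal_mul (by norm_num)] at h2
    simpa [ENNReal.ofReal_pow] using h2
  calc _ ≤ ∫⁻ x, 2 * ‖f x‖ₑ ^ 2 + 2 * ‖g x‖ₑ ^ 2 ∂μ := lintegral_mono this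
    _ = _ := by
      rw [lintegral_add_left' ((hf.enorm.pow_const 2).const_mul 2),
        lintegral_const_mul' _ _ (by simp), lintegral_const_mul' _ _ (by simp)]

lemma integrable_mul_of_memLp_two {f g : α → ℂ} (hf : MemLp f 2 μ) (hg : MemLp g 2 μ) :
    Integrable (fun x ↦ f x * g x) μ :=
  MemLp.integrable_mul hf hg

lemma norm_integral_mul_le {f g : α → ℂ} (hf : MemLp f 2 μ) (hg : MemLp g 2 μ) :
    ‖∫ x, f x * g x ∂μ‖ₑ ≤ eLpNorm f 2 μ * eLpNorm g 2 μ := by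
  calc _ ≤ ∫⁻ x, ‖f x * g x‖ₑ ∂μ := enorm_integral_le_lintegral_enorm _
    _ = eLpNorm (f • g) 1 μ := by rw [eLpNorm_one_eq_lintegral_enorm]; rfl
    _ ≤ _ := eLpNorm_smul_le_mul_eLpNorm hg.1 hf.1

end SquareIntegrable

/-! ### Translations and dilations of Lebesgue measure. -/

lemma measurePreserving_shift (t : ℝ) : MeasurePreserving (fun x : ℝ ↦ x + t) :=
  measurePreserving_add_right volume t

lemma quasiMeasurePreserving_div {c : ℝ} (hc : c ≠ 0) :
    Measure.QuasiMeasurePreserving (fun x : ℝ ↦ x / c) := by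
  refine ⟨by fun_prop, ?_⟩
  have : (fun x : ℝ ↦ x / c) = fun x ↦ x * c⁻¹ := by ext; rw [div_eq_mul_inv]
  rw [this]
  change Measure.map (· * c⁻¹) volume ≪ volume
  rw [Real.map_volume_mul_right (inv_ne_zero hc)]
  exact Measure.AbsolutelyContinuous.smul_left Measure.AbsolutelyContinuous.rfl _

lemma lintegral_comp_div {f : ℝ → ℝ≥0∞} (hf : AEMeasurable f) {c : ℝ} (hc : 0 < c) :
    ∫⁻ x, f (x / c) = ENNReal.ofReal c * ∫⁻ x, f x := by
  have h1 : Measure.map (fun x : ℝ ↦ x / c) volume = ENNReal.ofReal c • volume := by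
    have : (fun x : ℝ ↦ x / c) = fun x ↦ x * c⁻¹ := by ext; rw [div_eq_mul_inv]
    rw [this]
    change Measure.map (· * c⁻¹) volume = _
    rw [Real.map_volume_mul_right (inv_ne_zero hc.ne'), inv_inv, abs_of_pos hc]
  have h2 := lintegral_map' (f := f) (g := fun x : ℝ ↦ x / c) (μ := volume)
    (by rw [h1]; exact hf.mono_ac (Measure.AbsolutelyContinuous.smul_left
      Measure.AbsolutelyContinuous.rfl _)) (by fun_prop)
  rw [← h2, h1, lintegral_smul_measure, smul_eq_mul]

/-! ### Fourier transforms on `L¹` and `L²` -/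

lemma ft_eq_fourierInv (f : ℝ → ℂ) (u : ℝ) : ft f u = 𝓕⁻ f (u / (2 * Real.pi)) := by
  rw [Real.fourierInv_eq', ft]
  refine integral_congr_ae (ae_of_all _ fun x ↦ ?_)
  simp only [smul_eq_mul]
  congr 2
  have : (Real.pi : ℂ) ≠ 0 := by exact_mod_cast Real.pi_ne_zero
  simp
  field_simp

lemma invFt_eq_fourier (f : ℝ → ℂ) (x : ℝ) :
    invFt f x = (2 * (Real.pi : ℂ))⁻¹ * 𝓕 f (x / (2 * Real.pi)) := by
  rw [Real.fourier_real_eq_integral_exp_smul, invFt]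
  congr 1
  refine integral_congr_ae (ae_of_all _ fun u ↦ ?_)
  simp only [smul_eq_mul]
  congr 2
  have : (Real.pi : ℂ) ≠ 0 := by exact_mod_cast Real.pi_ne_zero
  push_cast
  field_simp

lemma norm_exp_I_mul (u x : ℝ) : ‖Complex.exp (Complex.I * u * x)‖ = 1 := by
  have : Complex.I * u * x = ((u * x : ℝ) : ℂ) * Complex.I := by push_cast; ring
  rw [this, Complex.norm_exp_ofReal_mul_I]

lemma norm_exp_neg_I_mul (u x : ℝ) : ‖Complex.exp (-(Complex.I * u * x))‖ = 1 := by
  have : -(Complex.I * u * x) = ((-(u * x) : ℝ) : ℂ) * Complex.I := by push_cast; ring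
  rw [this, Complex.norm_exp_ofReal_mul_I]

lemma norm_ft_le (f : ℝ → ℂ) (u : ℝ) : ‖ft f u‖ ≤ ∫ x, ‖f x‖ := by
  refine (norm_integral_le_integral_norm _).trans (le_of_eq ?_)
  simp [norm_exp_I_mul]

lemma continuous_ft {f : ℝ → ℂ} (hf : Integrable f) : Continuous (ft f) := by
  refine continuous_of_dominated (bound := fun x ↦ ‖f x‖) (fun u ↦ ?_) (fun u ↦ ae_of_all _ fun x ↦ ?_)
    hf.norm (ae_of_all _ fun x ↦ by fun_prop)
  · exact (by fun_prop : Continuous _).aestronglyMeasurable.mul hf.1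
  · simp [norm_exp_I_mul]

lemma continuous_invFt {f : ℝ → ℂ} (hf : Integrable f) : Continuous (invFt f) := by
  refine continuous_const.mul (continuous_of_dominated (bound := fun x ↦ ‖f x‖) (fun u ↦ ?_)
    (fun u ↦ ae_of_all _ fun x ↦ ?_) hf.norm (ae_of_all _ fun x ↦ by fun_prop))
  · exact (by fun_prop : Continuous _).aestronglyMeasurable.mul hf.1
  · simp [norm_exp_neg_I_mul]

lemma two_pi_pos' : 0 < 2 * Real.pi := by positivity

lemma norm_inv_two_pi : ‖(2 * (Real.pi : ℂ))⁻¹‖ = (2 * Real.pi)⁻¹ := by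
  rw [norm_inv]; simp [abs_of_pos Real.pi_pos]

lemma inv_two_pi_le_one : (2 * Real.pi)⁻¹ ≤ 1 := by
  apply inv_le_one_of_one_le₀
  nlinarith [Real.pi_gt_three]

lemma norm_invFt_le (f : ℝ → ℂ) (u : ℝ) : ‖invFt f u‖ ≤ ∫ x, ‖f x‖ := by
  rw [invFt, norm_mul, norm_inv_two_pi]
  have h1 : ‖∫ x : ℝ, Complex.exp (-(Complex.I * x * u)) * f x‖ ≤ ∫ x, ‖f x‖ := by
    refine (norm_integral_le_integral_norm _).trans (le_of_eq ?_)
    simp [norm_exp_neg_I_mul]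
  calc _ ≤ 1 * ∫ x, ‖f x‖ := by
        gcongr
        exact inv_two_pi_le_one
    _ = _ := one_mul _

lemma integrable_exp_mul {f : ℝ → ℂ} (hf : Integrable f) (u : ℝ) :
    Integrable (fun x : ℝ ↦ Complex.exp (Complex.I * u * x) * f x) := by
  refine hf.norm.mono' ((by fun_prop : Continuous _).aestronglyMeasurable.mul hf.1)
    (ae_of_all _ fun x ↦ ?_)
  simp [norm_exp_I_mul]

lemma integrable_exp_neg_mul {f : ℝ → ℂ} (hf : Integrable f) (x : ℝ) :
    Integrable (fun u : ℝ ↦ Complex.exp (-(Complex.I * u * x)) * f u) := by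
  refine hf.norm.mono' ((by fun_prop : Continuous _).aestronglyMeasurable.mul hf.1)
    (ae_of_all _ fun u ↦ ?_)
  simp [norm_exp_neg_I_mul]

lemma invFt_sub {f g : ℝ → ℂ} (hf : Integrable f) (hg : Integrable g) (x : ℝ) :
    invFt (fun u ↦ f u - g u) x = invFt f x - invFt g x := by
  simp only [invFt, mul_sub]
  rw [integral_sub (integrable_exp_neg_mul hf x) (integrable_exp_neg_mul hg x), mul_sub]

lemma invFt_congr {f g : ℝ → ℂ} (h : f =ᵐ[volume] g) (x : ℝ) : invFt f x = invFt g x := by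
  rw [invFt, invFt]
  congr 1
  refine integral_congr_ae ?_
  filter_upwards [h] with u hu
  rw [hu]

lemma ftL2_of_memLp {f : ℝ → ℂ} (hf : MemLp f 2) (u : ℝ) :
    ftL2 f u = (𝓕⁻ (hf.toLp f) : Lp ℂ 2 (volume : Measure ℝ)) (u / (2 * Real.pi)) := by
  rw [ftL2, dif_pos hf]

lemma invFtL2_of_memLp {f : ℝ → ℂ} (hf : MemLp f 2) (x : ℝ) :
    invFtL2 f x = (2 * (Real.pi : ℂ))⁻¹ *
      (𝓕 (hf.toLp f) : Lp ℂ 2 (volume : Measure ℝ)) (x / (2 * Real.pi)) := by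
  rw [invFtL2, dif_pos hf]

lemma lintegral_sq_toLp (F : Lp ℂ 2 (volume : Measure ℝ)) : ∫⁻ x, ‖F x‖ₑ ^ 2 = ‖F‖ₑ ^ 2 := by
  rw [← eLpNorm_two_sq, ← Lp.enorm_def]

lemma aestronglyMeasurable_ftL2 (f : ℝ → ℂ) : AEStronglyMeasurable (ftL2 f) := by
  by_cases hf : MemLp f 2
  · have : ftL2 f = fun u ↦ (𝓕⁻ (hf.toLp f) : Lp ℂ 2 (volume : Measure ℝ)) (u / (2 * Real.pi)) :=
      funext fun u ↦ ftL2_of_memLp hf u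
    rw [this]
    exact (Lp.aestronglyMeasurable _).comp_quasiMeasurePreserving
      (quasiMeasurePreserving_div two_pi_pos'.ne')
  · have : ftL2 f = fun u ↦ 0 := funext fun u ↦ by rw [ftL2, dif_neg hf]
    rw [this]; exact aestronglyMeasurable_const

lemma aestronglyMeasurable_invFtL2 (f : ℝ → ℂ) : AEStronglyMeasurable (invFtL2 f) := by
  by_cases hf : MemLp f 2
  · have : invFtL2 f = fun x ↦ (2 * (Real.pi : ℂ))⁻¹ *
      (𝓕 (hf.toLp f) : Lp ℂ 2 (volume : Measure ℝ)) (x / (2 * Real.pi)) :=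
      funext fun u ↦ invFtL2_of_memLp hf u
    rw [this]
    exact ((Lp.aestronglyMeasurable _).comp_quasiMeasurePreserving
      (quasiMeasurePreserving_div two_pi_pos'.ne')).const_mul _
  · have : invFtL2 f = fun u ↦ 0 := funext fun u ↦ by rw [invFtL2, dif_neg hf]
    rw [this]; exact aestronglyMeasurable_const

/-- Plancherel. -/
lemma lintegral_sq_ftL2 {f : ℝ → ℂ} (hf : MemLp f 2) :
    ∫⁻ u, ‖ftL2 f u‖ₑ ^ 2 = ENNReal.ofReal (2 * Real.pi) * ∫⁻ x, ‖f x‖ₑ ^ 2 := by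
  simp_rw [ftL2_of_memLp hf]
  rw [lintegral_comp_div (f := fun x ↦ ‖(𝓕⁻ (hf.toLp f) : Lp ℂ 2 (volume : Measure ℝ)) x‖ₑ ^ 2)
    ((Lp.aestronglyMeasurable _).enorm.pow_const 2) two_pi_pos', lintegral_sq_toLp]
  congr 1
  have : ‖(𝓕⁻ (hf.toLp f) : Lp ℂ 2 (volume : Measure ℝ))‖ₑ = ‖hf.toLp f‖ₑ := by
    rw [← ofReal_norm, ← ofReal_norm]
    congr 1
    exact (Lp.fourierTransformₗᵢ ℝ ℂ).symm.norm_map _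
  rw [this, ← lintegral_sq_toLp]
  refine lintegral_congr_ae ?_
  filter_upwards [hf.coeFn_toLp] with x hx
  rw [hx]

/-- Plancherel holds with the factor (2π)⁻¹. As (2π)⁻¹ ≤ 1 it is dropped, since only upper bounds
are needed. -/
lemma lintegral_sq_invFtL2_le {f : ℝ → ℂ} (hf : MemLp f 2) :
    ∫⁻ u, ‖invFtL2 f u‖ₑ ^ 2 ≤ ∫⁻ x, ‖f x‖ₑ ^ 2 := by
  have h0 : ∫⁻ x, ‖f x‖ₑ ^ 2 = ‖hf.toLp f‖ₑ ^ 2 := by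
    rw [← lintegral_sq_toLp]
    refine lintegral_congr_ae ?_
    filter_upwards [hf.coeFn_toLp] with x hx
    rw [hx]
  have h1 : ‖(𝓕 (hf.toLp f) : Lp ℂ 2 (volume : Measure ℝ))‖ₑ = ‖hf.toLp f‖ₑ := by
    rw [← ofReal_norm, ← ofReal_norm, Lp.norm_fourier_eq]
  have hc : ‖(2 * (Real.pi : ℂ))⁻¹‖ₑ = ENNReal.ofReal (2 * Real.pi)⁻¹ := by
    rw [← ofReal_norm, norm_inv_two_pi]
  have h2 : ∫⁻ u, ‖invFtL2 f u‖ₑ ^ 2 =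
      ENNReal.ofReal (2 * Real.pi)⁻¹ ^ 2 * (ENNReal.ofReal (2 * Real.pi) * ‖hf.toLp f‖ₑ ^ 2) := by
    simp_rw [invFtL2_of_memLp hf, enorm_mul, mul_pow, hc]
    rw [lintegral_const_mul' _ _ (by simp),
      lintegral_comp_div (f := fun x ↦ ‖(𝓕 (hf.toLp f) : Lp ℂ 2 (volume : Measure ℝ)) x‖ₑ ^ 2)
      ((Lp.aestronglyMeasurable _).enorm.pow_const 2) two_pi_pos', lintegral_sq_toLp, h1]
  rw [h2, h0, ← mul_assoc, ← ENNReal.ofReal_pow (by positivity), ← ENNReal.ofReal_mul (by positivity)]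
  calc _ ≤ 1 * ‖hf.toLp f‖ₑ ^ 2 := by
        gcongr
        rw [ENNReal.ofReal_le_one]
        have : (2 * Real.pi)⁻¹ ^ 2 * (2 * Real.pi) = (2 * Real.pi)⁻¹ := by
          have := two_pi_pos'.ne'
          field_simp
        rw [this]
        exact inv_two_pi_le_one
    _ = _ := one_mul _

lemma memLp_ftL2 {f : ℝ → ℂ} (hf : MemLp f 2) : MemLp (ftL2 f) 2 := by
  rw [memLp_two_iff]
  refine ⟨aestronglyMeasurable_ftL2 f, ?_⟩
  rw [lintegral_sq_ftL2 hf]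
  exact ENNReal.mul_lt_top ENNReal.ofReal_lt_top (memLp_two_iff.1 hf).2

lemma memLp_invFtL2 {f : ℝ → ℂ} (hf : MemLp f 2) : MemLp (invFtL2 f) 2 := by
  rw [memLp_two_iff]
  exact ⟨aestronglyMeasurable_invFtL2 f, (lintegral_sq_invFtL2_le hf).trans_lt (memLp_two_iff.1 hf).2⟩

/-- Equality holds at every point, because the chosen representative depends only on the class in
`Lp`. -/
lemma invFtL2_congr {f g : ℝ → ℂ} (h : f =ᵐ[volume] g) : invFtL2 f = invFtL2 g := by
  ext x
  by_cases hf : MemLp f 2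
  · have hg := (memLp_congr_ae h).1 hf
    rw [invFtL2_of_memLp hf, invFtL2_of_memLp hg]
    have : hf.toLp f = hg.toLp g := (MemLp.toLp_eq_toLp_iff hf hg).2 h
    rw [this]
  · have hg : ¬ MemLp g 2 := fun hg ↦ hf ((memLp_congr_ae h).2 hg)
    rw [invFtL2, invFtL2, dif_neg hf, dif_neg hg]

lemma ftL2_congr {f g : ℝ → ℂ} (h : f =ᵐ[volume] g) : ftL2 f = ftL2 g := by
  ext x
  by_cases hf : MemLp f 2
  · have hg := (memLp_congr_ae h).1 hf
    rw [ftL2_of_memLp hf, ftL2_of_memLp hg]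
    have : hf.toLp f = hg.toLp g := (MemLp.toLp_eq_toLp_iff hf hg).2 h
    rw [this]
  · have hg : ¬ MemLp g 2 := fun hg ↦ hf ((memLp_congr_ae h).2 hg)
    rw [ftL2, ftL2, dif_neg hf, dif_neg hg]

lemma ae_comp_div {p : ℝ → Prop} (h : ∀ᵐ x, p x) {c : ℝ} (hc : c ≠ 0) : ∀ᵐ x : ℝ, p (x / c) :=
  (quasiMeasurePreserving_div hc).ae h

lemma ftL2_add {f g : ℝ → ℂ} (hf : MemLp f 2) (hg : MemLp g 2) :
    ftL2 (fun x ↦ f x + g x) =ᵐ[volume] fun u ↦ ftL2 f u + ftL2 g u := by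
  have hfg : MemLp (fun x ↦ f x + g x) 2 := hf.add hg
  have h1 : hfg.toLp (fun x ↦ f x + g x) = hf.toLp f + hg.toLp g := rfl
  have h2 : 𝓕⁻ (hfg.toLp _) = 𝓕⁻ (hf.toLp f) + 𝓕⁻ (hg.toLp g) := by
    rw [h1]; exact FourierInvAdd.fourierInv_add _ _
  filter_upwards [ae_comp_div (Lp.coeFn_add (𝓕⁻ (hf.toLp f)) (𝓕⁻ (hg.toLp g))) two_pi_pos'.ne']
    with u hu
  rw [ftL2_of_memLp hf, ftL2_of_memLp hg, ftL2_of_memLp hfg, h2, hu]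
  rfl

lemma ftL2_sub {f g : ℝ → ℂ} (hf : MemLp f 2) (hg : MemLp g 2) :
    ftL2 (fun x ↦ f x - g x) =ᵐ[volume] fun u ↦ ftL2 f u - ftL2 g u := by
  have h := ftL2_add (hf.sub hg) hg
  filter_upwards [h] with u hu
  simp only [Pi.sub_apply, sub_add_cancel] at hu
  rw [eq_sub_iff_add_eq]
  exact hu.symm

lemma invFtL2_add {f g : ℝ → ℂ} (hf : MemLp f 2) (hg : MemLp g 2) :
    invFtL2 (fun x ↦ f x + g x) =ᵐ[volume] fun u ↦ invFtL2 f u + invFtL2 g u := by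
  have hfg : MemLp (fun x ↦ f x + g x) 2 := hf.add hg
  have h1 : hfg.toLp (fun x ↦ f x + g x) = hf.toLp f + hg.toLp g := rfl
  have h2 : 𝓕 (hfg.toLp _) = 𝓕 (hf.toLp f) + 𝓕 (hg.toLp g) := by
    rw [h1, FourierTransform.fourier_add]
  filter_upwards [ae_comp_div (Lp.coeFn_add (𝓕 (hf.toLp f)) (𝓕 (hg.toLp g))) two_pi_pos'.ne']
    with u hu
  rw [invFtL2_of_memLp hf, invFtL2_of_memLp hg, invFtL2_of_memLp hfg, h2, hu, ← mul_add]
  rfl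

lemma invFtL2_sub {f g : ℝ → ℂ} (hf : MemLp f 2) (hg : MemLp g 2) :
    invFtL2 (fun x ↦ f x - g x) =ᵐ[volume] fun u ↦ invFtL2 f u - invFtL2 g u := by
  have h := invFtL2_add (hf.sub hg) hg
  filter_upwards [h] with u hu
  simp only [Pi.sub_apply, sub_add_cancel] at hu
  rw [eq_sub_iff_add_eq]
  exact hu.symm

lemma locallyIntegrable_of_memLp_two {f : ℝ → ℂ} (hf : MemLp f 2) : LocallyIntegrable f :=
  hf.locallyIntegrable (by norm_num)

/-- Both functions are locally integrable, so it suffices to test them against smooth compactly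
supported η. For the Plancherel transform the transform moves to η by compatibility with tempered
distributions, for the integral by Fubini. -/
lemma fourierInv_toLp_ae_eq {f : ℝ → ℂ} (h1 : Integrable f) (h2 : MemLp f 2) :
    (𝓕⁻ (h2.toLp f) : Lp ℂ 2 (volume : Measure ℝ)) =ᵐ[volume] 𝓕⁻ f := by
  have hc : Continuous (𝓕⁻ f) := VectorFourier.fourierIntegral_continuous
    Real.continuous_fourierChar (by fun_prop) h1
  refine ae_eq_of_integral_contDiff_smul_eq
    (locallyIntegrable_of_memLp_two (Lp.memLp _)) hc.locallyIntegrable fun η hη hηc ↦ ?_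
  have hη' : ContDiff ℝ (⊤ : ℕ∞) (fun x ↦ (η x : ℂ)) := Complex.ofRealCLM.contDiff.comp hη
  have hηc' : HasCompactSupport (fun x ↦ (η x : ℂ)) := hηc.comp_left (g := Complex.ofReal) rfl
  let s : SchwartzMap ℝ ℂ := hηc'.toSchwartzMap hη'
  have hs : ∀ x, s x = (η x : ℂ) := fun x ↦ rfl
  have key := congrArg (fun T ↦ T s) (Lp.fourierInv_toTemperedDistribution_eq (h2.toLp f))
  simp only [TemperedDistribution.fourierInv_apply, Lp.toTemperedDistribution_apply] at key
  have e1 : ∫ x, η x • (𝓕⁻ (h2.toLp f) : Lp ℂ 2 (volume : Measure ℝ)) x =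
      ∫ x, s x • (𝓕⁻ (h2.toLp f) : Lp ℂ 2 (volume : Measure ℝ)) x := by
    simp [hs]
  rw [e1, ← key]
  have e2 : ∫ x, (𝓕⁻ s) x • (h2.toLp f) x = ∫ x, (𝓕⁻ s) x • f x := by
    refine integral_congr_ae ?_
    filter_upwards [h2.coeFn_toLp] with x hx
    rw [hx]
  rw [e2]
  have e3 := VectorFourier.integral_fourierIntegral_smul_eq_flip (L := -innerₗ ℝ) (μ := volume)
    (ν := volume) (e := Real.fourierChar) (f := (s : ℝ → ℂ)) (g := f) Real.continuous_fourierChar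
    (by simp only [LinearMap.neg_apply, innerₗ_apply_apply]; fun_prop) s.integrable h1
  have hflip : (-innerₗ ℝ : ℝ →ₗ[ℝ] ℝ →ₗ[ℝ] ℝ).flip = -innerₗ ℝ := by
    ext; simp
  rw [hflip] at e3
  rw [SchwartzMap.fourierInv_coe]
  refine e3.trans ?_
  simp only [hs, Complex.real_smul, smul_eq_mul]
  rfl

end

end LevyCLT

namespace LevyCLT

noncomputable section

/-! ### Agreement of the integral and Plancherel transforms, Parseval's identity, translations. -/

lemma fourier_toLp_ae_eq {f : ℝ → ℂ} (h1 : Integrable f) (h2 : MemLp f 2) :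
    (𝓕 (h2.toLp f) : Lp ℂ 2 (volume : Measure ℝ)) =ᵐ[volume] 𝓕 f := by
  have hc : Continuous (𝓕 f) := VectorFourier.fourierIntegral_continuous
    Real.continuous_fourierChar (by fun_prop) h1
  refine ae_eq_of_integral_contDiff_smul_eq
    (locallyIntegrable_of_memLp_two (Lp.memLp _)) hc.locallyIntegrable fun η hη hηc ↦ ?_
  have hη' : ContDiff ℝ (⊤ : ℕ∞) (fun x ↦ (η x : ℂ)) := Complex.ofRealCLM.contDiff.comp hη
  have hηc' : HasCompactSupport (fun x ↦ (η x : ℂ)) := hηc.comp_left (g := Complex.ofReal) rfl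
  let s : SchwartzMap ℝ ℂ := hηc'.toSchwartzMap hη'
  have hs : ∀ x, s x = (η x : ℂ) := fun x ↦ rfl
  have key := congrArg (fun T ↦ T s) (Lp.fourier_toTemperedDistribution_eq (h2.toLp f))
  simp only [TemperedDistribution.fourier_apply, Lp.toTemperedDistribution_apply] at key
  have e1 : ∫ x, η x • (𝓕 (h2.toLp f) : Lp ℂ 2 (volume : Measure ℝ)) x =
      ∫ x, s x • (𝓕 (h2.toLp f) : Lp ℂ 2 (volume : Measure ℝ)) x := by
    simp [hs]
  rw [e1, ← key]
  have e2 : ∫ x, (𝓕 s) x • (h2.toLp f) x = ∫ x, (𝓕 s) x • f x := by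
    refine integral_congr_ae ?_
    filter_upwards [h2.coeFn_toLp] with x hx
    rw [hx]
  rw [e2]
  have e3 := VectorFourier.integral_fourierIntegral_smul_eq_flip (L := innerₗ ℝ) (μ := volume)
    (ν := volume) (e := Real.fourierChar) (f := (s : ℝ → ℂ)) (g := f) Real.continuous_fourierChar
    (by simp only [innerₗ_apply_apply]; fun_prop) s.integrable h1
  have hflip : (innerₗ ℝ : ℝ →ₗ[ℝ] ℝ →ₗ[ℝ] ℝ).flip = innerₗ ℝ := by
    ext; simp
  rw [hflip] at e3
  rw [SchwartzMap.fourier_coe]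
  refine e3.trans ?_
  simp only [hs, Complex.real_smul, smul_eq_mul]
  rfl

lemma ftL2_eq_ft {f : ℝ → ℂ} (h1 : Integrable f) (h2 : MemLp f 2) :
    ftL2 f =ᵐ[volume] ft f := by
  filter_upwards [ae_comp_div (fourierInv_toLp_ae_eq h1 h2) two_pi_pos'.ne'] with u hu
  rw [ftL2_of_memLp h2, ft_eq_fourierInv, hu]

lemma invFtL2_eq_invFt {f : ℝ → ℂ} (h1 : Integrable f) (h2 : MemLp f 2) :
    invFtL2 f =ᵐ[volume] invFt f := by
  filter_upwards [ae_comp_div (fourier_toLp_ae_eq h1 h2) two_pi_pos'.ne'] with u hu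
  rw [invFtL2_of_memLp h2, invFt_eq_fourier, hu]

/-- Continuous compactly supported approximants lie in L¹ and L² at once, so identities proved for
the integral transforms extend to L² by continuity. -/
lemma exists_approx_memLp_two {f : ℝ → ℂ} (hf : MemLp f 2) :
    ∃ F : ℕ → ℝ → ℂ, (∀ n, Integrable (F n)) ∧ (∀ n, MemLp (F n) 2) ∧
      Tendsto (fun n ↦ ∫⁻ x, ‖F n x - f x‖ₑ ^ 2) atTop (𝓝 0) := by
  have : ∀ n : ℕ, ∃ g : ℝ → ℂ, Integrable g ∧ MemLp g 2 ∧
      eLpNorm (f - g) 2 ≤ ENNReal.ofReal (1 / ((n : ℝ) + 1)) := fun n ↦ by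
    obtain ⟨g, hgc, hg, hcont, hmem⟩ := hf.exists_hasCompactSupport_eLpNorm_sub_le (by norm_num)
      (ε := ENNReal.ofReal (1 / ((n : ℝ) + 1))) (by simp; positivity)
    exact ⟨g, hcont.integrable_of_hasCompactSupport hgc, hmem, hg⟩
  choose F h1 h2 h3 using this
  refine ⟨F, h1, h2, ?_⟩
  have h4 : Tendsto (fun n : ℕ ↦ ENNReal.ofReal (1 / ((n : ℝ) + 1)) ^ 2) atTop (𝓝 0) := by
    have := (ENNReal.continuous_pow 2).tendsto 0 |>.comp
      (ENNReal.tendsto_ofReal tendsto_one_div_add_atTop_nhds_zero_nat |>.trans_eq (by simp))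
    simpa [Function.comp_def] using this
  refine tendsto_of_tendsto_of_tendsto_of_le_of_le tendsto_const_nhds h4 (fun n ↦ zero_le) fun n ↦ ?_
  have : ∫⁻ x, ‖F n x - f x‖ₑ ^ 2 = eLpNorm (f - F n) 2 ^ 2 := by
    rw [eLpNorm_two_sq]
    refine lintegral_congr fun x ↦ ?_
    rw [Pi.sub_apply, enorm_sub_rev]
  simp only [this]
  gcongr
  exact h3 n

lemma tendsto_integral_mul_of_memLp_two {α : Type*} [MeasurableSpace α] {μ : Measure α}
    {f g : α → ℂ} {G : ℕ → α → ℂ} (hf : MemLp f 2 μ)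
    (hg : MemLp g 2 μ) (hG : ∀ n, MemLp (G n) 2 μ)
    (h : Tendsto (fun n ↦ ∫⁻ x, ‖G n x - g x‖ₑ ^ 2 ∂μ) atTop (𝓝 0)) :
    Tendsto (fun n ↦ ∫ x, f x * G n x ∂μ) atTop (𝓝 (∫ x, f x * g x ∂μ)) := by
  rw [tendsto_iff_edist_tendsto_0]
  have h2 : Tendsto (fun n ↦ eLpNorm (fun x ↦ G n x - g x) 2 μ) atTop (𝓝 0) := by
    have : ∀ n, eLpNorm (fun x ↦ G n x - g x) 2 μ =
        (∫⁻ x, ‖G n x - g x‖ₑ ^ 2 ∂μ) ^ (1 / 2 : ℝ) := fun n ↦ by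
      rw [← eLpNorm_two_sq, ← ENNReal.rpow_natCast, ← ENNReal.rpow_mul]
      simp
    simp only [this]
    have := (ENNReal.continuous_rpow_const (y := (1 / 2 : ℝ))).tendsto 0 |>.comp h
    simpa [Function.comp_def] using this
  have h3 := ENNReal.Tendsto.const_mul h2 (Or.inr hf.2.ne)
  rw [mul_zero] at h3
  refine tendsto_of_tendsto_of_tendsto_of_le_of_le tendsto_const_nhds h3 (fun n ↦ zero_le) fun n ↦ ?_
  rw [edist_eq_enorm_sub, ← integral_sub (integrable_mul_of_memLp_two hf (hG n))
    (integrable_mul_of_memLp_two hf hg)]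
  simp_rw [← mul_sub]
  exact norm_integral_mul_le hf ((hG n).sub hg)

lemma tendsto_ftL2_of_tendsto {f : ℝ → ℂ} {F : ℕ → ℝ → ℂ} (hf : MemLp f 2)
    (hF : ∀ n, MemLp (F n) 2) (h : Tendsto (fun n ↦ ∫⁻ x, ‖F n x - f x‖ₑ ^ 2) atTop (𝓝 0)) :
    Tendsto (fun n ↦ ∫⁻ x, ‖ftL2 (F n) x - ftL2 f x‖ₑ ^ 2) atTop (𝓝 0) := by
  have h1 := ENNReal.Tendsto.const_mul h (Or.inr (ENNReal.ofReal_ne_top (r := 2 * Real.pi)))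
  rw [mul_zero] at h1
  refine h1.congr fun n ↦ ?_
  rw [← lintegral_sq_ftL2 (f := fun x ↦ F n x - f x) ((hF n).sub hf)]
  refine lintegral_congr_ae ?_
  filter_upwards [ftL2_sub (hF n) hf] with x hx
  rw [hx]

lemma tendsto_invFtL2_of_tendsto {f : ℝ → ℂ} {F : ℕ → ℝ → ℂ} (hf : MemLp f 2)
    (hF : ∀ n, MemLp (F n) 2) (h : Tendsto (fun n ↦ ∫⁻ x, ‖F n x - f x‖ₑ ^ 2) atTop (𝓝 0)) :
    Tendsto (fun n ↦ ∫⁻ x, ‖invFtL2 (F n) x - invFtL2 f x‖ₑ ^ 2) atTop (𝓝 0) := by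
  refine tendsto_of_tendsto_of_tendsto_of_le_of_le tendsto_const_nhds h (fun n ↦ zero_le) fun n ↦ ?_
  refine le_trans (le_of_eq ?_) (lintegral_sq_invFtL2_le (f := fun x ↦ F n x - f x) ((hF n).sub hf))
  refine lintegral_congr_ae ?_
  filter_upwards [invFtL2_sub (hF n) hf] with x hx
  rw [hx]

lemma measurePreserving_neg_real : MeasurePreserving (fun x : ℝ ↦ -x) :=
  Measure.measurePreserving_neg volume

lemma memLp_comp_neg {f : ℝ → ℂ} (hf : MemLp f 2) : MemLp (fun u ↦ f (-u)) 2 :=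
  hf.comp_measurePreserving measurePreserving_neg_real

lemma memLp_comp_add {f : ℝ → ℂ} (hf : MemLp f 2) (t : ℝ) : MemLp (fun u ↦ f (u + t)) 2 :=
  hf.comp_measurePreserving (measurePreserving_shift t)

/-- Fubini. The two transforms have kernels of opposite sign, which is why `G` is evaluated at −u.
-/
lemma integral_mul_invFt_of_integrable {f G : ℝ → ℂ} (hf : Integrable f) (hG : Integrable G) :
    ∫ x, f x * invFt G x = (2 * (Real.pi : ℂ))⁻¹ * ∫ u, ft f u * G (-u) := by
  have hint : Integrable (Function.uncurry fun (x u : ℝ) ↦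
      Complex.exp (-(Complex.I * u * x)) * (f x * G u)) (volume.prod volume) := by
    refine (hf.mul_prod hG).norm.mono' (((by fun_prop : Continuous fun p : ℝ × ℝ ↦
      Complex.exp (-(Complex.I * p.2 * p.1))).aestronglyMeasurable).mul
      (hf.mul_prod hG).1) (ae_of_all _ fun p ↦ ?_)
    simp [Function.uncurry, norm_exp_neg_I_mul]
  have h1 : ∀ x, f x * invFt G x = (2 * (Real.pi : ℂ))⁻¹ *
      ∫ u : ℝ, Complex.exp (-(Complex.I * u * x)) * (f x * G u) := fun x ↦ by
    rw [invFt, mul_left_comm, ← integral_const_mul]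
    congr 1
    refine integral_congr_ae (ae_of_all _ fun u ↦ ?_)
    ring
  have h2 : ∀ u, ft f u * G (-u) =
      ∫ x : ℝ, Complex.exp (-(Complex.I * (-u : ℝ) * x)) * (f x * G (-u)) := fun u ↦ by
    rw [ft, ← integral_mul_const]
    refine integral_congr_ae (ae_of_all _ fun x ↦ ?_)
    push_cast
    ring_nf
  simp_rw [h1, h2]
  rw [integral_const_mul, integral_integral_swap hint]
  congr 1
  exact (integral_neg_eq_self (fun u : ℝ ↦
    ∫ x : ℝ, Complex.exp (-(Complex.I * u * x)) * (f x * G u)) volume).symm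

lemma tendsto_comp_neg {f : ℝ → ℂ} {F : ℕ → ℝ → ℂ}
    (h : Tendsto (fun n ↦ ∫⁻ x, ‖F n x - f x‖ₑ ^ 2) atTop (𝓝 0)) :
    Tendsto (fun n ↦ ∫⁻ x, ‖F n (-x) - f (-x)‖ₑ ^ 2) atTop (𝓝 0) := by
  refine h.congr fun n ↦ ?_
  exact (measurePreserving_neg_real.lintegral_comp_emb (Homeomorph.neg ℝ).measurableEmbedding
    (fun x ↦ ‖F n x - f x‖ₑ ^ 2)).symm

/-- Parseval's identity in bilinear form. -/
lemma integral_mul_invFtL2 {f G : ℝ → ℂ} (hf : MemLp f 2) (hG : MemLp G 2) :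
    ∫ x, f x * invFtL2 G x = (2 * (Real.pi : ℂ))⁻¹ * ∫ u, ftL2 f u * G (-u) := by
  obtain ⟨F, hF1, hF2, hF⟩ := exists_approx_memLp_two hf
  obtain ⟨H, hH1, hH2, hH⟩ := exists_approx_memLp_two hG
  have step1 : ∀ n m, ∫ x, F n x * invFtL2 (H m) x =
      (2 * (Real.pi : ℂ))⁻¹ * ∫ u, ftL2 (F n) u * H m (-u) := fun n m ↦ by
    have e1 : ∫ x, F n x * invFtL2 (H m) x = ∫ x, F n x * invFt (H m) x := by
      refine integral_congr_ae ?_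
      filter_upwards [invFtL2_eq_invFt (hH1 m) (hH2 m)] with x hx
      rw [hx]
    have e2 : ∫ x, ftL2 (F n) x * H m (-x) = ∫ x, ft (F n) x * H m (-x) := by
      refine integral_congr_ae ?_
      filter_upwards [ftL2_eq_ft (hF1 n) (hF2 n)] with x hx
      rw [hx]
    rw [e1, e2, integral_mul_invFt_of_integrable (hF1 n) (hH1 m)]
  -- The limit is taken first in `G`, with `f` still replaced by an approximant, and only then in
  -- `f`.
  have step2 : ∀ n, ∫ x, F n x * invFtL2 G x =
      (2 * (Real.pi : ℂ))⁻¹ * ∫ u, ftL2 (F n) u * G (-u) := fun n ↦ by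
    have l1 := tendsto_integral_mul_of_memLp_two (hF2 n) (memLp_invFtL2 hG)
      (fun m ↦ memLp_invFtL2 (hH2 m)) (tendsto_invFtL2_of_tendsto hG hH2 hH)
    have l2 := tendsto_integral_mul_of_memLp_two (memLp_ftL2 (hF2 n)) (memLp_comp_neg hG)
      (fun m ↦ memLp_comp_neg (hH2 m)) (tendsto_comp_neg hH)
    refine tendsto_nhds_unique l1 ?_
    simp_rw [step1 n]
    exact l2.const_mul _
  have l1 := tendsto_integral_mul_of_memLp_two (memLp_invFtL2 hG) hf hF2 hF
  have l2 := tendsto_integral_mul_of_memLp_two (memLp_comp_neg hG) (memLp_ftL2 hf)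
      (fun n ↦ memLp_ftL2 (hF2 n)) (tendsto_ftL2_of_tendsto hf hF2 hF)
  simp_rw [fun n x ↦ mul_comm (invFtL2 G x) (F n x), step2] at l1
  simp_rw [fun n x ↦ mul_comm (G (-x)) (ftL2 (F n) x)] at l2
  have := tendsto_nhds_unique l1 (l2.const_mul _)
  simp_rw [mul_comm (f _), mul_comm (ftL2 f _)]
  exact this

lemma integral_mul_invFt {f G : ℝ → ℂ} (hf : MemLp f 2) (hG1 : Integrable G) (hG : MemLp G 2) :
    ∫ x, f x * invFt G x = (2 * (Real.pi : ℂ))⁻¹ * ∫ u, ftL2 f u * G (-u) := by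
  rw [← integral_mul_invFtL2 hf hG]
  refine integral_congr_ae ?_
  filter_upwards [invFtL2_eq_invFt hG1 hG] with x hx
  rw [hx]

lemma invFt_shift (G : ℝ → ℂ) (t x : ℝ) :
    invFt (fun u ↦ G (u + t)) x = Complex.exp (Complex.I * t * x) * invFt G x := by
  rw [invFt, invFt, mul_left_comm]
  congr 1
  rw [← integral_const_mul, ← integral_add_right_eq_self (μ := (volume : Measure ℝ)) _ t]
  conv_rhs => rw [← integral_add_right_eq_self (μ := (volume : Measure ℝ)) _ t]
  -- Both integrals have been translated; the translation is undone on the left, so that in effect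
  -- only the right one is substituted.
  rw [integral_add_right_eq_self (μ := (volume : Measure ℝ))
    (fun u : ℝ ↦ Complex.exp (-(Complex.I * u * x)) * G (u + t)) t]
  refine integral_congr_ae (ae_of_all _ fun u ↦ ?_)
  simp only
  rw [← mul_assoc, ← Complex.exp_add]
  congr 2
  push_cast
  ring

lemma memLp_exp_mul {f : ℝ → ℂ} (hf : MemLp f 2) (t : ℝ) :
    MemLp (fun x : ℝ ↦ Complex.exp (Complex.I * t * x) * f x) 2 := by
  refine hf.of_le ((by fun_prop : Continuous _).aestronglyMeasurable.mul hf.1)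
    (ae_of_all _ fun x ↦ ?_)
  simp [norm_exp_I_mul]

/-- Both sides depend continuously on `G` in L² and agree for integrable approximants by
`invFt_shift`; hence their L² distance is zero. -/
lemma invFtL2_shift {G : ℝ → ℂ} (hG : MemLp G 2) (t : ℝ) :
    invFtL2 (fun u ↦ G (u + t)) =ᵐ[volume] fun x ↦ Complex.exp (Complex.I * t * x) * invFtL2 G x := by
  obtain ⟨H, hH1, hH2, hH⟩ := exists_approx_memLp_two hG
  have hH' : Tendsto (fun n ↦ ∫⁻ x, ‖H n (x + t) - G (x + t)‖ₑ ^ 2) atTop (𝓝 0) := by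
    refine hH.congr fun n ↦ ?_
    exact (lintegral_add_right_eq_self (fun x ↦ ‖H n x - G x‖ₑ ^ 2) t).symm
  have l1 := tendsto_invFtL2_of_tendsto (memLp_comp_add hG t) (fun n ↦ memLp_comp_add (hH2 n) t) hH'
  have l2 := tendsto_invFtL2_of_tendsto hG hH2 hH
  have hz : ∫⁻ x, ‖invFtL2 (fun u ↦ G (u + t)) x -
      Complex.exp (Complex.I * t * x) * invFtL2 G x‖ₑ ^ 2 = 0 := by
    refine le_antisymm (ge_of_tendsto' (f := fun n ↦ 2 * (∫⁻ x, ‖invFtL2 (fun u ↦ H n (u + t)) x -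
      invFtL2 (fun u ↦ G (u + t)) x‖ₑ ^ 2) + 2 * (∫⁻ x, ‖invFtL2 (H n) x - invFtL2 G x‖ₑ ^ 2))
      (x := atTop) ?_ fun n ↦ ?_) zero_le
    · have := (ENNReal.Tendsto.const_mul l1 (Or.inr (by norm_num : (2 : ℝ≥0∞) ≠ ∞))).add
        (ENNReal.Tendsto.const_mul l2 (Or.inr (by norm_num : (2 : ℝ≥0∞) ≠ ∞)))
      simpa using this
    · have e : invFtL2 (fun u ↦ H n (u + t)) =ᵐ[volume]
          fun x ↦ Complex.exp (Complex.I * t * x) * invFtL2 (H n) x := by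
        have hi : Integrable (fun u ↦ H n (u + t)) := (hH1 n).comp_add_right t
        filter_upwards [invFtL2_eq_invFt (hH1 n) (hH2 n),
          invFtL2_eq_invFt hi (memLp_comp_add (hH2 n) t)] with x h1 h2
        rw [h1, h2, invFt_shift]
      have m1 : AEStronglyMeasurable (fun x ↦ invFtL2 (fun u ↦ G (u + t)) x -
          invFtL2 (fun u ↦ H n (u + t)) x) :=
        (aestronglyMeasurable_invFtL2 _).sub (aestronglyMeasurable_invFtL2 _)
      have := lintegral_sq_add_le (fun x ↦ invFtL2 (fun u ↦ G (u + t)) x -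
          invFtL2 (fun u ↦ H n (u + t)) x)
        (fun x ↦ Complex.exp (Complex.I * t * x) * (invFtL2 (H n) x - invFtL2 G x)) m1
      refine (le_of_eq ?_).trans (this.trans (le_of_eq ?_))
      · refine lintegral_congr_ae ?_
        filter_upwards [e] with x hx
        rw [hx]
        congr 2
        ring
      · congr 2
        · refine lintegral_congr fun x ↦ ?_
          rw [enorm_sub_rev]
        · refine lintegral_congr fun x ↦ ?_
          rw [enorm_mul, ← ofReal_norm, norm_exp_I_mul, ENNReal.ofReal_one, one_mul]
  have hm : AEStronglyMeasurable (fun x ↦ invFtL2 (fun u ↦ G (u + t)) x -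
      Complex.exp (Complex.I * t * x) * invFtL2 G x) :=
    (aestronglyMeasurable_invFtL2 _).sub (memLp_exp_mul (memLp_invFtL2 hG) t).1
  filter_upwards [ae_eq_zero_of_lintegral_sq_eq_zero hm hz] with x hx
  exact sub_eq_zero.1 hx

/-- Square integrability of `x F⁻¹ M(x)`, for `M` with square integrable difference quotients. -/
lemma lintegral_sq_id_mul_invFtL2_le {M : ℝ → ℂ} (hM : MemLp M 2) {b : ℝ → ℝ}

    (h : ∀ t : ℝ, 0 < t → t ≤ 1 → ∀ᵐ u, ‖M (u + t) - M u‖ ≤ t * b u) :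
    ∫⁻ x : ℝ, ‖(x : ℂ) * invFtL2 M x‖ₑ ^ 2 ≤ ∫⁻ u, ENNReal.ofReal (b u) ^ 2 := by
  let t : ℕ → ℝ := fun n ↦ 1 / ((n : ℝ) + 1)
  have ht0 : ∀ n, 0 < t n := fun n ↦ by positivity
  have ht1 : ∀ n, t n ≤ 1 := fun n ↦ by
    simp only [t]
    rw [div_le_one (by positivity)]
    linarith [Nat.cast_nonneg (α := ℝ) n]
  have htz : Tendsto t atTop (𝓝 0) := tendsto_one_div_add_atTop_nhds_zero_nat
  -- The difference quotient of s ↦ e^{isx} at 0. It tends to ix, and multiplying F⁻¹M by it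
  -- corresponds to taking a difference quotient of `M`.
  let D : ℕ → ℝ → ℂ := fun n x ↦ ((t n : ℂ))⁻¹ * (Complex.exp (Complex.I * t n * x) - 1)
  have hD : ∀ x, Tendsto (fun n ↦ D n x) atTop (𝓝 (Complex.I * x)) := fun x ↦ by
    have h1 : HasDerivAt (fun s : ℝ ↦ Complex.exp (Complex.I * s * x)) (Complex.I * x) 0 := by
      have h2 : HasDerivAt (fun s : ℝ ↦ Complex.I * s * x) (Complex.I * x) 0 := by
        have := ((Complex.ofRealCLM.hasDerivAt (x := (0 : ℝ))).const_mul Complex.I).mul_const (x : ℂ)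
        simpa using this
      have := h2.cexp
      simpa using this
    have h2 := h1.tendsto_slope_zero
    have h3 := h2.comp (tendsto_nhdsWithin_iff.2 ⟨htz, .of_forall fun n ↦ (ht0 n).ne'⟩)
    refine h3.congr fun n ↦ ?_
    simp [D, t]
  have key : ∀ n, ∫⁻ x, ‖D n x * invFtL2 M x‖ₑ ^ 2 ≤ ∫⁻ u, ENNReal.ofReal (b u) ^ 2 := fun n ↦ by
    have e1 : ∀ᵐ x, D n x * invFtL2 M x =
        (t n : ℂ)⁻¹ * invFtL2 (fun u ↦ M (u + t n) - M u) x := by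
      filter_upwards [invFtL2_shift hM (t n), invFtL2_sub (memLp_comp_add hM (t n)) hM] with x h1 h2
      rw [h2, h1]
      simp only [D]
      ring
    calc _ = ∫⁻ x, ‖(t n : ℂ)⁻¹‖ₑ ^ 2 * ‖invFtL2 (fun u ↦ M (u + t n) - M u) x‖ₑ ^ 2 := by
          refine lintegral_congr_ae ?_
          filter_upwards [e1] with x hx
          rw [hx, enorm_mul, mul_pow]
      _ = ‖(t n : ℂ)⁻¹‖ₑ ^ 2 * ∫⁻ x, ‖invFtL2 (fun u ↦ M (u + t n) - M u) x‖ₑ ^ 2 :=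
          lintegral_const_mul' _ _ (by simp)
      _ ≤ ‖(t n : ℂ)⁻¹‖ₑ ^ 2 * ∫⁻ x, ‖M (x + t n) - M x‖ₑ ^ 2 := by
          refine mul_le_mul_right ?_ _
          exact lintegral_sq_invFtL2_le ((memLp_comp_add hM (t n)).sub hM)
      _ = ∫⁻ x, ‖(t n : ℂ)⁻¹‖ₑ ^ 2 * ‖M (x + t n) - M x‖ₑ ^ 2 :=
          (lintegral_const_mul' _ _ (by simp)).symm
      _ ≤ _ := by
          refine lintegral_mono_ae ?_
          filter_upwards [h (t n) (ht0 n) (ht1 n)] with u hu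
          rw [← mul_pow, ← enorm_mul, ← ofReal_norm, norm_mul]
          gcongr
          rw [norm_inv, Complex.norm_real, Real.norm_of_nonneg (ht0 n).le,
            inv_mul_le_iff₀ (ht0 n)]
          exact hu
  -- Fatou's lemma passes the bound, uniform in n, to the limit ix F⁻¹M(x).
  calc ∫⁻ x : ℝ, ‖(x : ℂ) * invFtL2 M x‖ₑ ^ 2
      = ∫⁻ x : ℝ, liminf (fun n ↦ ‖D n x * invFtL2 M x‖ₑ ^ 2) atTop := by
        refine lintegral_congr fun x ↦ ?_
        have : Tendsto (fun n ↦ ‖D n x * invFtL2 M x‖ₑ ^ 2) atTop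
            (𝓝 (‖Complex.I * x * invFtL2 M x‖ₑ ^ 2)) :=
          ((ENNReal.continuous_pow 2).tendsto _).comp (((hD x).mul_const _).enorm)
        rw [this.liminf_eq, mul_assoc, enorm_mul Complex.I, ← ofReal_norm Complex.I]
        simp
    _ ≤ liminf (fun n ↦ ∫⁻ x, ‖D n x * invFtL2 M x‖ₑ ^ 2) atTop := by
        refine lintegral_liminf_le' fun n ↦ ?_
        refine AEMeasurable.pow_const ?_ 2
        refine AEStronglyMeasurable.enorm (AEStronglyMeasurable.mul ?_ (aestronglyMeasurable_invFtL2 M))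
        exact (by fun_prop : Continuous (D n)).aestronglyMeasurable
    _ ≤ _ := liminf_le_of_le (by isBoundedDefault) fun a ha ↦ by
        obtain ⟨n, hn⟩ := ha.exists
        exact hn.trans (key n)

end

end LevyCLT

namespace LevyCLT

noncomputable section

/-! ### Positive and negative parts of a density -/

section SignedDensity

variable {α β : Type*} [MeasurableSpace α] [MeasurableSpace β]

lemma isFiniteMeasure_withDensity_ofReal' {μ : Measure α} {f : α → ℝ} (hf : Integrable f μ) :
    IsFiniteMeasure (μ.withDensity fun x ↦ ENNReal.ofReal (f x)) :=
  isFiniteMeasure_withDensity_ofReal hf.2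

lemma integral_withDensity_ofReal {μ : Measure α} {f : α → ℝ} (hf : AEMeasurable f μ)
    (G : α → ℂ) :
    ∫ x, G x ∂(μ.withDensity fun x ↦ ENNReal.ofReal (f x)) = ∫ x, (max (f x) 0 : ℝ) * G x ∂μ := by
  have := integral_withDensity_eq_integral_smul₀ (μ := μ) (f := fun x ↦ (f x).toNNReal)
    hf.real_toNNReal G
  refine this.trans (integral_congr_ae (ae_of_all _ fun x ↦ ?_))
  simp only [NNReal.smul_def, Complex.real_smul, Real.coe_toNNReal']

lemma integral_withDensity_ofReal_sub {μ : Measure α} {f : α → ℝ} (hf : Integrable f μ)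
    {G : α → ℂ} (hG : AEStronglyMeasurable G μ) {C : ℝ} (hC : ∀ᵐ x ∂μ, ‖G x‖ ≤ C) :
    ∫ x, G x ∂(μ.withDensity fun x ↦ ENNReal.ofReal (f x)) -
      ∫ x, G x ∂(μ.withDensity fun x ↦ ENNReal.ofReal (-f x)) = ∫ x, f x * G x ∂μ := by
  rw [integral_withDensity_ofReal hf.1.aemeasurable, integral_withDensity_ofReal
    (f := fun x ↦ -f x) hf.neg.1.aemeasurable, ← integral_sub]
  · refine integral_congr_ae (ae_of_all _ fun x ↦ ?_)
    simp only
    rw [← sub_mul, ← Complex.ofReal_sub]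
    congr 2
    rcases le_total (f x) 0 with h | h <;> simp [h]
  · exact hf.pos_part.ofReal.mul_bdd (c := C) hG hC
  · exact hf.neg.pos_part.ofReal.mul_bdd (c := C) hG hC

lemma integrable_withDensity_ofReal {μ : Measure α} {f : α → ℝ} (hf : Integrable f μ)
    {G : α → ℂ} (hG : AEStronglyMeasurable G μ) {C : ℝ} (hC : ∀ᵐ x ∂μ, ‖G x‖ ≤ C) :
    Integrable G (μ.withDensity fun x ↦ ENNReal.ofReal (f x)) := by
  have := isFiniteMeasure_withDensity_ofReal' hf
  have hac := withDensity_absolutelyContinuous μ fun x ↦ ENNReal.ofReal (f x)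
  exact Integrable.of_bound (hG.mono_ac hac) C (hac.ae_le hC)

end SignedDensity

lemma charFun_eq_integral (μ : Measure ℝ) (u : ℝ) :
    charFun μ u = ∫ x : ℝ, Complex.exp (Complex.I * u * x) ∂μ := by
  rw [charFun_apply_real]
  refine integral_congr_ae (ae_of_all _ fun x ↦ ?_)
  simp only
  congr 1
  ring

/-- The equality of signed measures is rearranged so that each side is a sum of finite positive
measures and no subtraction occurs. -/
lemma withDensity_add_eq_of_withDensityᵥ_eq {μ ν : Measure ℝ} {f k : ℝ → ℝ}
    (hf : Integrable f μ) (hk : Integrable k ν) (h : μ.withDensityᵥ f = ν.withDensityᵥ k) :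
    μ.withDensity (fun x ↦ ENNReal.ofReal (f x)) + ν.withDensity (fun x ↦ ENNReal.ofReal (-k x)) =
    ν.withDensity (fun x ↦ ENNReal.ofReal (k x)) + μ.withDensity (fun x ↦ ENNReal.ofReal (-f x)) := by
  have h1 := isFiniteMeasure_withDensity_ofReal' hf
  have h2 := isFiniteMeasure_withDensity_ofReal' hk
  have h3 := isFiniteMeasure_withDensity_ofReal' hf.neg
  have h4 := isFiniteMeasure_withDensity_ofReal' hk.neg
  simp only [Pi.neg_apply] at h3 h4
  refine Measure.ext fun s hs ↦ ?_
  have e : ∫ x in s, f x ∂μ = ∫ x in s, k x ∂ν := by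
    rw [← withDensityᵥ_apply hf hs, ← withDensityᵥ_apply hk hs, h]
  rw [integral_eq_lintegral_pos_part_sub_lintegral_neg_part hf.integrableOn,
    integral_eq_lintegral_pos_part_sub_lintegral_neg_part hk.integrableOn,
    ← withDensity_apply _ hs, ← withDensity_apply _ hs, ← withDensity_apply _ hs,
    ← withDensity_apply _ hs] at e
  rw [Measure.add_apply, Measure.add_apply, ← ENNReal.toReal_eq_toReal_iff' (by finiteness)
    (by finiteness), ENNReal.toReal_add (by finiteness) (by finiteness),
    ENNReal.toReal_add (by finiteness) (by finiteness)]
  linarith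

/-- On a Lebesgue-null set x ν(dx) vanishes together with its restrictions. On x > 0 and on x < 0 it
has one sign, so ν itself vanishes there, and 0 carries no mass. This allows the essential bound of
g to be used under ν. -/
lemma absolutelyContinuous_of_withDensityᵥ_eq {ν : Measure ℝ} {k : ℝ → ℝ} (h0 : ν {0} = 0)
    (hf : Integrable (fun x : ℝ ↦ x) ν) (hk : Integrable k)
    (h : ν.withDensityᵥ (fun x : ℝ ↦ x) = (volume : Measure ℝ).withDensityᵥ k) :
    ν ≪ volume := by
  have key := withDensity_add_eq_of_withDensityᵥ_eq hf hk h
  refine Measure.AbsolutelyContinuous.mk fun s hs hs0 ↦ ?_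
  have aux : ∀ t ⊆ s, MeasurableSet t →
      ∫⁻ x in t, ENNReal.ofReal x ∂ν = ∫⁻ x in t, ENNReal.ofReal (-x) ∂ν := fun t ht htm ↦ by
    have := congrArg (fun m ↦ m t) key
    have ht0 : volume t = 0 := measure_mono_null ht hs0
    simp only [Measure.add_apply, withDensity_apply _ htm, Measure.restrict_eq_zero.2 ht0,
      lintegral_zero_measure, add_zero, zero_add] at this
    exact this
  have hpos : ν (s ∩ Set.Ioi 0) = 0 := by
    have e := aux (s ∩ Set.Ioi 0) Set.inter_subset_left (hs.inter measurableSet_Ioi)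
    have z : ∫⁻ x in s ∩ Set.Ioi 0, ENNReal.ofReal (-x) ∂ν = 0 := by
      refine (setLIntegral_congr_fun (g := fun _ ↦ 0) (hs.inter measurableSet_Ioi) fun x hx ↦ ?_).trans
        (by simp)
      have : 0 < x := hx.2
      simp [this.le]
    rw [z, setLIntegral_eq_zero_iff (hs.inter measurableSet_Ioi) (by fun_prop)] at e
    rw [measure_eq_zero_iff_ae_notMem]
    filter_upwards [e] with x hx hx2
    have := hx hx2
    simp only [ENNReal.ofReal_eq_zero] at this
    exact absurd hx2.2 (not_lt.2 this)
  have hneg : ν (s ∩ Set.Iio 0) = 0 := by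
    have e := aux (s ∩ Set.Iio 0) Set.inter_subset_left (hs.inter measurableSet_Iio)
    have z : ∫⁻ x in s ∩ Set.Iio 0, ENNReal.ofReal x ∂ν = 0 := by
      refine (setLIntegral_congr_fun (g := fun _ ↦ 0) (hs.inter measurableSet_Iio) fun x hx ↦ ?_).trans
        (by simp)
      have : x < 0 := hx.2
      simp [this.le]
    rw [z, eq_comm, setLIntegral_eq_zero_iff (hs.inter measurableSet_Iio) (by fun_prop)] at e
    rw [measure_eq_zero_iff_ae_notMem]
    filter_upwards [e] with x hx hx2
    have := hx hx2
    simp only [ENNReal.ofReal_eq_zero, Left.neg_nonpos_iff] at this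
    exact absurd hx2.2 (not_lt.2 this)
  refine measure_mono_null (t := (s ∩ Set.Ioi 0) ∪ (s ∩ Set.Iio 0) ∪ {0}) (fun x hx ↦ ?_)
    (measure_union_null (measure_union_null hpos hneg) h0)
  rcases lt_trichotomy x 0 with h | h | h
  · exact Or.inl (Or.inr ⟨hx, h⟩)
  · exact Or.inr h
  · exact Or.inl (Or.inl ⟨hx, h⟩)

/-- Integrals of bounded functions against `f dμ = k dν`. -/
lemma integral_mul_eq_of_withDensityᵥ_eq {μ ν : Measure ℝ} {f k : ℝ → ℝ}
    (hf : Integrable f μ) (hk : Integrable k ν) (h : μ.withDensityᵥ f = ν.withDensityᵥ k)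
    {G : ℝ → ℂ} (hGμ : AEStronglyMeasurable G μ) (hGν : AEStronglyMeasurable G ν) {C : ℝ}
    (hCμ : ∀ᵐ x ∂μ, ‖G x‖ ≤ C) (hCν : ∀ᵐ x ∂ν, ‖G x‖ ≤ C) :
    ∫ x, f x * G x ∂μ = ∫ x, k x * G x ∂ν := by
  rw [← integral_withDensity_ofReal_sub hf hGμ hCμ, ← integral_withDensity_ofReal_sub hk hGν hCν]
  have key := congrArg (fun m ↦ ∫ x, G x ∂m) (withDensity_add_eq_of_withDensityᵥ_eq hf hk h)
  beta_reduce at key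
  rw [integral_add_measure (integrable_withDensity_ofReal hf hGμ hCμ)
    (integrable_withDensity_ofReal (f := fun x ↦ -k x) hk.neg hGν hCν),
    integral_add_measure (integrable_withDensity_ofReal hk hGν hCν)
    (integrable_withDensity_ofReal (f := fun x ↦ -f x) hf.neg hGμ hCμ)] at key
  linear_combination key

/-! ### Differentiation of characteristic functions -/

lemma norm_exp_I_sub_one_le (u x : ℝ) : ‖Complex.exp (Complex.I * u * x) - 1‖ ≤ |u| * |x| := by
  have := Real.norm_exp_I_mul_ofReal_sub_one_le (x := u * x)
  rw [Complex.ofReal_mul, ← mul_assoc, Real.norm_eq_abs, abs_mul] at this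
  exact this

lemma hasDerivAt_exp_I (x u : ℝ) :
    HasDerivAt (fun s : ℝ ↦ Complex.exp (Complex.I * s * x))
      (Complex.I * x * Complex.exp (Complex.I * u * x)) u := by
  have h2 : HasDerivAt (fun s : ℝ ↦ Complex.I * s * x) (Complex.I * x) u := by
    have := ((Complex.ofRealCLM.hasDerivAt (x := u)).const_mul Complex.I).mul_const (x : ℂ)
    simpa using this
  have := h2.cexp
  rwa [mul_comm] at this

lemma integrable_exp_I_mul_id {μ : Measure ℝ} (hμ : Integrable (fun x : ℝ ↦ x) μ) (u : ℝ) :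
    Integrable (fun x : ℝ ↦ Complex.exp (Complex.I * u * x) * x) μ :=
  hμ.ofReal.bdd_mul (c := 1) (by fun_prop : Continuous _).aestronglyMeasurable
    (ae_of_all _ fun x ↦ (norm_exp_I_mul u x).le)

/-- The measure may be infinite, so e^{iux} need not be integrable, but e^{iux} − 1 is, being at
most |u||x|. The characteristic function of a finite measure follows by adding the total mass. -/
lemma hasDerivAt_integral_exp_sub_one {μ : Measure ℝ} (hμ : Integrable (fun x : ℝ ↦ x) μ) (u : ℝ) :
    HasDerivAt (fun s : ℝ ↦ ∫ x : ℝ, (Complex.exp (Complex.I * s * x) - 1) ∂μ)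
      (Complex.I * ∫ x : ℝ, Complex.exp (Complex.I * u * x) * x ∂μ) u := by
  have := (hasDerivAt_integral_of_dominated_loc_of_deriv_le (μ := μ) (𝕜 := ℝ) (x₀ := u)
    (s := Set.univ) (bound := fun x ↦ |x|)
    (F := fun s x ↦ Complex.exp (Complex.I * s * x) - 1)
    (F' := fun s x ↦ Complex.I * x * Complex.exp (Complex.I * s * x)) univ_mem
    (.of_forall fun s ↦ (by fun_prop : Continuous _).aestronglyMeasurable)
    ((hμ.norm.const_mul |u|).mono' (by fun_prop : Continuous _).aestronglyMeasurable
      (ae_of_all _ fun x ↦ norm_exp_I_sub_one_le u x))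
    (by fun_prop : Continuous _).aestronglyMeasurable
    (ae_of_all _ fun x s _ ↦ by simp [norm_exp_I_mul]) hμ.norm
    (ae_of_all _ fun x s _ ↦ (hasDerivAt_exp_I x s).sub_const 1)).2
  have e : Complex.I * ∫ x : ℝ, Complex.exp (Complex.I * u * x) * x ∂μ =
      ∫ x : ℝ, Complex.I * x * Complex.exp (Complex.I * u * x) ∂μ := by
    rw [← integral_const_mul]
    refine integral_congr_ae (ae_of_all _ fun x ↦ ?_)
    ring
  rw [e]
  exact this

lemma hasDerivAt_charFun {μ : Measure ℝ} [IsFiniteMeasure μ] (hμ : Integrable (fun x : ℝ ↦ x) μ)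
    (u : ℝ) : HasDerivAt (charFun μ)
      (Complex.I * ∫ x : ℝ, Complex.exp (Complex.I * u * x) * x ∂μ) u := by
  have h1 := (hasDerivAt_integral_exp_sub_one hμ u).add_const ((μ.real Set.univ : ℝ) : ℂ)
  have : charFun μ = fun s : ℝ ↦ ∫ x : ℝ, (Complex.exp (Complex.I * s * x) - 1) ∂μ +
      ((μ.real Set.univ : ℝ) : ℂ) := by
    ext s
    rw [charFun_eq_integral, integral_sub _ (integrable_const _)]
    · simp
    · exact (integrable_const (1 : ℝ)).mono' (by fun_prop : Continuous _).aestronglyMeasurable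
        (ae_of_all _ fun x ↦ (norm_exp_I_mul s x).le)
  rw [this]
  exact h1

/-! ### Second moments -/

/-- A probability measure with `|2 - φ(u) - φ(-u)| ≲ u²` has a second moment. -/
lemma memLp_id_of_charFun {P : Measure ℝ} [IsProbabilityMeasure P] {C : ℝ}
    (h : ∀ u : ℝ, ‖charFun P u + charFun P (-u) - 2‖ ≤ C * u ^ 2) :
    MemLp (fun x : ℝ ↦ x) 2 P := by
  rw [memLp_two_iff]
  refine ⟨aestronglyMeasurable_id, ?_⟩
  let t : ℕ → ℝ := fun n ↦ 1 / ((n : ℝ) + 1)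
  have ht0 : ∀ n, 0 < t n := fun n ↦ by positivity
  have htz : Tendsto t atTop (𝓝 0) := tendsto_one_div_add_atTop_nhds_zero_nat
  let D : ℕ → ℝ → ℂ := fun n x ↦ ((t n : ℂ))⁻¹ * (Complex.exp (Complex.I * t n * x) - 1)
  have hD : ∀ x : ℝ, Tendsto (fun n ↦ ‖D n x‖ₑ ^ 2) atTop (𝓝 (‖x‖ₑ ^ 2)) := fun x ↦ by
    have h2 := (hasDerivAt_exp_I x 0).tendsto_slope_zero
    have h3 := h2.comp (tendsto_nhdsWithin_iff.2 ⟨htz, .of_forall fun n ↦ (ht0 n).ne'⟩)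
    have h4 := ((ENNReal.continuous_pow 2).tendsto _).comp h3.enorm
    have e : ‖Complex.I * x * Complex.exp (Complex.I * (0 : ℝ) * x)‖ₑ = ‖x‖ₑ := by
      rw [← ofReal_norm, ← ofReal_norm]; simp
    rw [e] at h4
    refine h4.congr fun n ↦ ?_
    simp [D, t]
  have key : ∀ n, ∫⁻ x, ‖D n x‖ₑ ^ 2 ∂P ≤ ENNReal.ofReal C := fun n ↦ by
    have hi : ∀ s : ℝ, Integrable (fun x : ℝ ↦ Complex.exp (Complex.I * s * x)) P := fun s ↦
      (integrable_const (1 : ℝ)).mono' (by fun_prop : Continuous _).aestronglyMeasurable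
        (ae_of_all _ fun x ↦ (norm_exp_I_mul s x).le)
    -- Integrating |e^{itx} − 1|² = 2 − e^{itx} − e^{−itx} turns the hypothesis into a second moment
    -- bound for the difference quotients, uniform in t.
    have e1 : ∀ x : ℝ, ((‖Complex.exp (Complex.I * t n * x) - 1‖ ^ 2 : ℝ) : ℂ) =
        2 - Complex.exp (Complex.I * t n * x) - Complex.exp (Complex.I * (-t n : ℝ) * x) := fun x ↦ by
      rw [← Complex.normSq_eq_norm_sq, ← Complex.mul_conj]
      have : (starRingEnd ℂ) (Complex.exp (Complex.I * t n * x) - 1) =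
          Complex.exp (Complex.I * (-t n : ℝ) * x) - 1 := by
        rw [map_sub, ← Complex.exp_conj]
        simp
      rw [this]
      have e : Complex.exp (Complex.I * t n * x) * Complex.exp (Complex.I * (-t n : ℝ) * x) = 1 := by
        rw [← Complex.exp_add]
        have : Complex.I * t n * x + Complex.I * (-t n : ℝ) * x = 0 := by push_cast; ring
        rw [this, Complex.exp_zero]
      linear_combination e
    have e2 : ((∫ x, ‖Complex.exp (Complex.I * t n * x) - 1‖ ^ 2 ∂P : ℝ) : ℂ) =
        2 - charFun P (t n) - charFun P (-t n) := by
      rw [← integral_complex_ofReal]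
      simp_rw [e1]
      have hi2 : Integrable (fun x : ℝ ↦ 2 - Complex.exp (Complex.I * t n * x)) P :=
        (integrable_const _).sub (hi _)
      rw [integral_sub hi2 (hi _), integral_sub (integrable_const _) (hi _),
        charFun_eq_integral, charFun_eq_integral]
      simp
    have e3 : ∫ x, ‖Complex.exp (Complex.I * t n * x) - 1‖ ^ 2 ∂P ≤ C * t n ^ 2 := by
      refine (le_abs_self _).trans ?_
      rw [← Real.norm_eq_abs, ← Complex.norm_real, e2, norm_sub_rev]
      refine le_trans (le_of_eq ?_) (h (t n))
      congr 1
      ring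
    have hi2 : Integrable (fun x : ℝ ↦ ‖Complex.exp (Complex.I * t n * x) - 1‖ ^ 2) P := by
      refine (integrable_const (4 : ℝ)).mono' (by fun_prop : Continuous _).aestronglyMeasurable
        (ae_of_all _ fun x ↦ ?_)
      have : ‖Complex.exp (Complex.I * t n * x) - 1‖ ≤ 2 := by
        refine (norm_sub_le _ _).trans ?_
        rw [norm_exp_I_mul]; norm_num
      rw [Real.norm_of_nonneg (by positivity)]
      nlinarith [norm_nonneg (Complex.exp (Complex.I * t n * x) - 1)]
    have e4 : ∫⁻ x, ‖Complex.exp (Complex.I * t n * x) - 1‖ₑ ^ 2 ∂P ≤ ENNReal.ofReal (C * t n ^ 2) := by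
      refine le_trans (le_of_eq ?_) (ENNReal.ofReal_le_ofReal e3)
      rw [ofReal_integral_eq_lintegral_ofReal hi2 (ae_of_all _ fun x ↦ by positivity)]
      refine lintegral_congr fun x ↦ ?_
      rw [ENNReal.ofReal_pow (norm_nonneg _), ofReal_norm]
    calc _ = ‖((t n : ℂ))⁻¹‖ₑ ^ 2 * ∫⁻ x, ‖Complex.exp (Complex.I * t n * x) - 1‖ₑ ^ 2 ∂P := by
          rw [← lintegral_const_mul' _ _ (by simp)]
          refine lintegral_congr fun x ↦ ?_
          simp only [D]
          rw [enorm_mul, mul_pow]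
      _ ≤ ‖((t n : ℂ))⁻¹‖ₑ ^ 2 * ENNReal.ofReal (C * t n ^ 2) := by gcongr
      _ = ENNReal.ofReal C := by
          rw [← ofReal_norm, ← ENNReal.ofReal_pow (norm_nonneg _), ← ENNReal.ofReal_mul (by positivity),
            norm_inv, Complex.norm_real, Real.norm_of_nonneg (ht0 n).le]
          congr 1
          have := (ht0 n).ne'
          field_simp
  refine lt_of_le_of_lt ?_ (ENNReal.ofReal_lt_top (r := C))
  calc ∫⁻ x : ℝ, ‖x‖ₑ ^ 2 ∂P
    _ = ∫⁻ x : ℝ, liminf (fun n ↦ ‖D n x‖ₑ ^ 2) atTop ∂P := by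
        refine lintegral_congr fun x ↦ ?_
        rw [(hD x).liminf_eq]
    -- Fatou's lemma, so that no moment of `P` has to be known beforehand.
    _ ≤ liminf (fun n ↦ ∫⁻ x, ‖D n x‖ₑ ^ 2 ∂P) atTop := by
        refine lintegral_liminf_le' fun n ↦ ?_
        exact ((by fun_prop : Continuous (D n)).aestronglyMeasurable.enorm).pow_const 2
    _ ≤ ENNReal.ofReal C := liminf_le_of_le (by isBoundedDefault) fun a ha ↦ by
        obtain ⟨n, hn⟩ := ha.exists
        exact hn.trans (key n)

end

end LevyCLT

namespace LevyCLT

noncomputable section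

/-! ### The law of the increments -/

/-- Translates of a measure with density at most `C` still have density at most `C`, and averaging
over `P` preserves this. -/
lemma conv_withDensity_le {P : Measure ℝ} [IsProbabilityMeasure P] {k : ℝ → ℝ} {C : ℝ}
    (hk : Integrable k) (hC : ∀ x, |k x| ≤ C) :
    P ∗ (volume.withDensity fun x ↦ ENNReal.ofReal (k x)) ≤ ENNReal.ofReal C • volume := by
  have := isFiniteMeasure_withDensity_ofReal' hk
  refine Measure.le_iff.2 fun s hs ↦ ?_
  have h1 := Measure.lintegral_conv (μ := P)
    (ν := volume.withDensity fun x ↦ ENNReal.ofReal (k x)) (f := s.indicator 1)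
    (measurable_one.indicator hs)
  rw [lintegral_indicator_one hs] at h1
  rw [h1]
  have hle : (volume.withDensity fun x ↦ ENNReal.ofReal (k x)) ≤ ENNReal.ofReal C • volume := by
    rw [← withDensity_const]
    refine withDensity_mono (ae_of_all _ fun x ↦ ?_)
    exact ENNReal.ofReal_le_ofReal ((le_abs_self _).trans (hC x))
  calc _ ≤ ∫⁻ x, ENNReal.ofReal C * volume s ∂P := by
        refine lintegral_mono fun x ↦ ?_
        refine (lintegral_mono' hle le_rfl).trans (le_of_eq ?_)
        rw [lintegral_smul_measure, smul_eq_mul]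
        congr 1
        rw [lintegral_add_left_eq_self (fun y ↦ s.indicator (1 : ℝ → ℝ≥0∞) y) x,
          lintegral_indicator_one hs]
    _ = _ := by simp

/-- If `(x - x₀) P(dx)` has the Fourier transform of `P * k`, then it has a bounded density. -/
lemma withDensity_abs_sub_le {P : Measure ℝ} [IsProbabilityMeasure P] {x₀ C : ℝ} {k : ℝ → ℝ}
    (hP : Integrable (fun x : ℝ ↦ x) P) (hk : Integrable k) (hC : ∀ x, |k x| ≤ C)
    (h : ∀ u : ℝ, ∫ x : ℝ, ((x - x₀ : ℝ) : ℂ) * Complex.exp (Complex.I * u * x) ∂P =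
      ft (fun x ↦ (k x : ℂ)) u * charFun P u) :
    (P.withDensity fun x ↦ ENNReal.ofReal |x - x₀|) ≤ ENNReal.ofReal C • volume := by
  have hf : Integrable (fun x : ℝ ↦ x - x₀) P := hP.sub (integrable_const _)
  have i1 := isFiniteMeasure_withDensity_ofReal' hf
  have i2 := isFiniteMeasure_withDensity_ofReal' (f := fun x : ℝ ↦ -(x - x₀)) hf.neg
  have i3 := isFiniteMeasure_withDensity_ofReal' hk
  have i4 := isFiniteMeasure_withDensity_ofReal' (f := fun x : ℝ ↦ -k x) hk.neg
  -- The identity (x − x₀)P = P ∗ k is split into positive and negative parts, arranged so that both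
  -- sides are finite positive measures; these are determined by their characteristic functions.
  have key : (P.withDensity fun x ↦ ENNReal.ofReal (x - x₀)) +
      P ∗ (volume.withDensity fun x ↦ ENNReal.ofReal (-k x)) =
      (P.withDensity fun x ↦ ENNReal.ofReal (-(x - x₀))) +
      P ∗ (volume.withDensity fun x ↦ ENNReal.ofReal (k x)) := by
    refine Measure.ext_of_charFun (funext fun u ↦ ?_)
    have hexp : ∀ (m : Measure ℝ) [IsFiniteMeasure m],
        Integrable (fun x : ℝ ↦ Complex.exp (Complex.I * u * x)) m := fun m _ ↦
      (integrable_const (1 : ℝ)).mono' (by fun_prop : Continuous _).aestronglyMeasurable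
        (ae_of_all _ fun x ↦ (norm_exp_I_mul u x).le)
    rw [charFun_eq_integral, charFun_eq_integral, integral_add_measure (hexp _) (hexp _),
      integral_add_measure (hexp _) (hexp _), ← charFun_eq_integral (P ∗ _),
      ← charFun_eq_integral (P ∗ _), charFun_conv, charFun_conv]
    have e1 := integral_withDensity_ofReal_sub hf (G := fun x : ℝ ↦ Complex.exp (Complex.I * u * x))
      (by fun_prop : Continuous _).aestronglyMeasurable (C := 1)
      (ae_of_all _ fun x ↦ (norm_exp_I_mul u x).le)
    have e2 := integral_withDensity_ofReal_sub hk (G := fun x : ℝ ↦ Complex.exp (Complex.I * u * x))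
      (by fun_prop : Continuous _).aestronglyMeasurable (C := 1)
      (ae_of_all _ fun x ↦ (norm_exp_I_mul u x).le)
    have e3 : ft (fun x ↦ (k x : ℂ)) u = ∫ x : ℝ, k x * Complex.exp (Complex.I * u * x) := by
      rw [ft]
      refine integral_congr_ae (ae_of_all _ fun x ↦ ?_)
      ring
    rw [h u] at e1
    rw [← e3, ← charFun_eq_integral, ← charFun_eq_integral] at e2
    linear_combination e1 - charFun P u * e2
  have hk' : ∀ x, |(-k x)| ≤ C := fun x ↦ by rw [abs_neg]; exact hC x
  have c1 := conv_withDensity_le (P := P) hk hC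
  have c2 := conv_withDensity_le (P := P) (k := fun x ↦ -k x) hk.neg hk'
  refine Measure.le_iff.2 fun s hs ↦ ?_
  -- To the right of x₀ the negative part of (x − x₀)P vanishes, so the positive part is at most P ∗
  -- k⁺. To the left the roles are exchanged.
  have hpos : (P.withDensity fun x ↦ ENNReal.ofReal |x - x₀|) (s ∩ Set.Ici x₀) ≤
      (ENNReal.ofReal C • volume) (s ∩ Set.Ici x₀) := by
    have hm := hs.inter (measurableSet_Ici (a := x₀))
    have e1 : (P.withDensity fun x ↦ ENNReal.ofReal |x - x₀|) (s ∩ Set.Ici x₀) =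
        (P.withDensity fun x ↦ ENNReal.ofReal (x - x₀)) (s ∩ Set.Ici x₀) := by
      rw [withDensity_apply _ hm, withDensity_apply _ hm]
      refine setLIntegral_congr_fun hm fun x hx ↦ ?_
      have : x₀ ≤ x := hx.2
      rw [abs_of_nonneg (by linarith)]
    have e2 : (P.withDensity fun x ↦ ENNReal.ofReal (-(x - x₀))) (s ∩ Set.Ici x₀) = 0 := by
      rw [withDensity_apply _ hm]
      refine (setLIntegral_congr_fun (g := fun _ ↦ 0) hm fun x hx ↦ ?_).trans (by simp)
      have : x₀ ≤ x := hx.2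
      simp only
      rw [ENNReal.ofReal_eq_zero]
      linarith
    have e3 := congrArg (fun m ↦ m (s ∩ Set.Ici x₀)) key
    simp only [Measure.add_apply, e2, zero_add] at e3
    rw [e1]
    calc _ ≤ _ := le_self_add
      _ = _ := e3
      _ ≤ _ := c1 _
  have hneg : (P.withDensity fun x ↦ ENNReal.ofReal |x - x₀|) (s \ Set.Ici x₀) ≤
      (ENNReal.ofReal C • volume) (s \ Set.Ici x₀) := by
    have hm := hs.diff (measurableSet_Ici (a := x₀))
    have e1 : (P.withDensity fun x ↦ ENNReal.ofReal |x - x₀|) (s \ Set.Ici x₀) =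
        (P.withDensity fun x ↦ ENNReal.ofReal (-(x - x₀))) (s \ Set.Ici x₀) := by
      rw [withDensity_apply _ hm, withDensity_apply _ hm]
      refine setLIntegral_congr_fun hm fun x hx ↦ ?_
      have : x < x₀ := not_le.1 hx.2
      rw [abs_of_neg (by linarith)]
    have e2 : (P.withDensity fun x ↦ ENNReal.ofReal (x - x₀)) (s \ Set.Ici x₀) = 0 := by
      rw [withDensity_apply _ hm]
      refine (setLIntegral_congr_fun (g := fun _ ↦ 0) hm fun x hx ↦ ?_).trans (by simp)
      have : x < x₀ := not_le.1 hx.2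
      simp only
      rw [ENNReal.ofReal_eq_zero]
      linarith
    have e3 := congrArg (fun m ↦ m (s \ Set.Ici x₀)) key
    simp only [Measure.add_apply, e2, zero_add] at e3
    rw [e1]
    calc _ ≤ _ := le_self_add
      _ = _ := e3.symm
      _ ≤ _ := c2 _
  rw [← measure_inter_add_sdiff s (measurableSet_Ici (a := x₀)),
    ← measure_inter_add_sdiff (μ := ENNReal.ofReal C • volume) s (measurableSet_Ici (a := x₀))]
  exact add_le_add hpos hneg

/-- The properties of the law `P` of the increments, with characteristic function `φ`, and of the
density `k` of `x ν(dx)` that enter the proof; here `x₀ = Δ γ`. -/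
structure IncrementLaw (P : Measure ℝ) (φ : ℝ → ℂ) (x₀ Δ : ℝ) (k : ℝ → ℝ) (ε C : ℝ) : Prop where
  prob : IsProbabilityMeasure P
  charFun_eq : φ = charFun P
  Δ_pos : 0 < Δ
  memLp_id : MemLp (fun x : ℝ ↦ x) 2 P
  ne_zero : ∀ u, φ u ≠ 0
  hasDerivAt : ∀ u : ℝ,
    HasDerivAt φ (Complex.I * (x₀ + Δ * ft (fun x ↦ (k x : ℂ)) u) * φ u) u
  integrable : Integrable k
  bound : ∀ x, |k x| ≤ C
  decay : ∀ u : ℝ, ‖ft (fun x ↦ (k x : ℂ)) u‖ ≤ C * (1 + |u|)⁻¹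
  withDensity_le : (P.withDensity fun x ↦ ENNReal.ofReal |x - x₀|) ≤ ENNReal.ofReal C • volume
  ε_pos : 0 < ε
  ε_le : ε ≤ 1 / 4
  memLp_weight : MemLp (fun u : ℝ ↦ (1 + |u|) ^ (-1 + ε) * ‖(φ u)⁻¹‖) 2 volume

/-- The derivative D(s)φ(s) − D(−s)φ(−s) of s ↦ φ(s) + φ(−s) is O(|s|), since φ is Lipschitz and
D(s) − D(−s) = O(|s|); integrating gives O(u²). Only first derivatives of φ enter, and
`memLp_id_of_charFun` then yields the second moment of `P`. -/
lemma norm_add_neg_sub_le {φ D : ℝ → ℂ} {M M' : ℝ} (h0 : φ 0 = 1) (h1 : ∀ u, ‖φ u‖ ≤ 1)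
    (hd : ∀ u, HasDerivAt φ (D u * φ u) u) (hM : ∀ u, ‖D u‖ ≤ M)
    (hM' : ∀ s, ‖D s - D (-s)‖ ≤ M' * |s|) (u : ℝ) :
    ‖φ u + φ (-u) - 2‖ ≤ (M' + 2 * M ^ 2) * u ^ 2 := by
  have hM0 : 0 ≤ M := (norm_nonneg _).trans (hM 0)
  have hb : ∀ u, ‖D u * φ u‖ ≤ M := fun u ↦ by
    rw [norm_mul]
    calc _ ≤ M * 1 := mul_le_mul (hM u) (h1 u) (norm_nonneg _) hM0
      _ = M := mul_one M
  have hlip : ∀ s, ‖φ s - φ (-s)‖ ≤ 2 * M * |s| := fun s ↦ by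
    have := Convex.norm_image_sub_le_of_norm_hasDerivWithin_le (f := φ) (s := Set.univ)
      (fun x _ ↦ (hd x).hasDerivWithinAt) (fun x _ ↦ hb x) convex_univ (Set.mem_univ (-s))
      (Set.mem_univ s)
    refine this.trans (le_of_eq ?_)
    rw [sub_neg_eq_add, Real.norm_eq_abs, ← two_mul, abs_mul, abs_two]
    ring
  have hd2 : ∀ s, HasDerivAt (fun s ↦ φ s + φ (-s)) (D s * φ s - D (-s) * φ (-s)) s := fun s ↦ by
    have := (hd s).add ((hd (-s)).scomp s (hasDerivAt_neg s))
    rw [neg_smul, one_smul, ← sub_eq_add_neg] at this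
    exact this
  have hb2 : ∀ s ∈ Metric.closedBall (0 : ℝ) |u|, ‖D s * φ s - D (-s) * φ (-s)‖ ≤
      (M' + 2 * M ^ 2) * |u| := fun s hs ↦ by
    have hs' : |s| ≤ |u| := by simpa using hs
    have e : D s * φ s - D (-s) * φ (-s) = (D s - D (-s)) * φ s + D (-s) * (φ s - φ (-s)) := by ring
    have h3 := hM' s
    have h4 := hlip s
    have hM'0 : 0 ≤ M' * |s| := (norm_nonneg _).trans h3
    rw [e]
    calc _ ≤ ‖D s - D (-s)‖ * ‖φ s‖ + ‖D (-s)‖ * ‖φ s - φ (-s)‖ := by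
          refine (norm_add_le _ _).trans (le_of_eq ?_)
          rw [norm_mul, norm_mul]
      _ ≤ (M' * |s|) * 1 + M * (2 * M * |s|) := by
          gcongr
          · exact h1 s
          · exact hM _
      _ = (M' + 2 * M ^ 2) * |s| := by ring
      _ ≤ _ := by
          have : 0 ≤ M' := by
            have := hM' 1
            simp only [abs_one, mul_one] at this
            exact (norm_nonneg _).trans this
          gcongr
  have := Convex.norm_image_sub_le_of_norm_hasDerivWithin_le
    (f := fun s ↦ φ s + φ (-s)) (s := Metric.closedBall (0 : ℝ) |u|)
    (fun x _ ↦ (hd2 x).hasDerivWithinAt) hb2 (convex_closedBall _ _)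
    (Metric.mem_closedBall_self (abs_nonneg u)) (y := u) (by simp)
  simp only [h0, neg_zero, sub_zero, Real.norm_eq_abs] at this
  refine le_trans (le_of_eq ?_) (this.trans (le_of_eq ?_))
  · congr 1; norm_num
  · rw [mul_assoc, ← sq, sq_abs]

lemma integral_id_mul_exp_lipschitz {ν : Measure ℝ} (h1 : Integrable (fun x : ℝ ↦ x) ν)
    (h2 : Integrable (fun x : ℝ ↦ x ^ 2) ν) (s t : ℝ) :
    ‖(∫ x : ℝ, Complex.exp (Complex.I * s * x) * x ∂ν) -
      ∫ x : ℝ, Complex.exp (Complex.I * t * x) * x ∂ν‖ ≤ (∫ x, x ^ 2 ∂ν) * |s - t| := by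
  rw [← integral_sub (integrable_exp_I_mul_id h1 s) (integrable_exp_I_mul_id h1 t),
    ← integral_mul_const]
  refine norm_integral_le_of_norm_le (h2.mul_const _) (ae_of_all _ fun x ↦ ?_)
  rw [← sub_mul, norm_mul]
  have e : Complex.exp (Complex.I * s * x) - Complex.exp (Complex.I * t * x) =
      Complex.exp (Complex.I * t * x) * (Complex.exp (Complex.I * (s - t : ℝ) * x) - 1) := by
    rw [mul_sub, ← Complex.exp_add, mul_one]
    congr 2
    push_cast; ring
  rw [e, norm_mul, norm_exp_I_mul, one_mul, Complex.norm_real, Real.norm_eq_abs]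
  calc _ ≤ (|s - t| * |x|) * |x| := by
        gcongr
        exact norm_exp_I_sub_one_le _ _
    _ = |s - t| * |x| ^ 2 := by ring
    _ = _ := by rw [sq_abs, mul_comm]

/-- All properties come from φ' = i(x₀ + Δκ)φ. The second moment follows because κ is Lipschitz, ν
having a second moment; the density bound follows by comparing this formula with φ' as the transform
of ix P(dx). -/
lemma IsFVLevyProcess.exists_incrementLaw {Ω : Type*} [MeasurableSpace Ω] {μ : Measure Ω}
    [IsProbabilityMeasure μ] {L : ℝ≥0 → Ω → ℝ} {γ : ℝ} {ν : Measure ℝ}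
    (hL : IsFVLevyProcess L μ γ ν) {Δ : ℝ≥0} (hΔ : 0 < Δ) {P : Measure ℝ} (hP : P = μ.map (L Δ))
    {φ : ℝ → ℂ} (hφ : φ = charFun P) (hA : LevyAssumption ν φ) :
    ∃ (k : ℝ → ℝ) (ε C : ℝ), IncrementLaw P φ (Δ * γ) Δ k ε C ∧
      ∀ g : ℝ → ℝ, MemLp g ∞ volume → ∫ x, g x * x ∂ν = ∫ x, g x * k x := by
  obtain ⟨ε, hε, hmom, ⟨k, hk, ⟨C₁, hC₁⟩, hkν⟩, ⟨C₂, hC₂⟩, hW⟩ := hA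
  have hprob : IsProbabilityMeasure P := by
    rw [hP]; exact Measure.isProbabilityMeasure_map (hL.levy.measurable Δ).aemeasurable
  have hν1 : Integrable (fun x : ℝ ↦ x) ν := by
    refine ⟨aestronglyMeasurable_id, lt_of_le_of_lt (lintegral_mono fun x ↦ ?_) hmom⟩
    rw [← ofReal_norm]
    exact ENNReal.ofReal_le_ofReal (le_max_left _ _)
  have hν2 : Integrable (fun x : ℝ ↦ x ^ 2) ν := by
    refine ⟨(by fun_prop : Continuous _).aestronglyMeasurable,
      lt_of_le_of_lt (lintegral_mono fun x ↦ ?_) hmom⟩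
    rw [← ofReal_norm]
    refine ENNReal.ofReal_le_ofReal ?_
    rw [norm_pow, Real.norm_eq_abs]
    rcases le_total |x| 1 with h | h
    · refine le_max_of_le_left ?_
      nlinarith [abs_nonneg x]
    · refine le_max_of_le_right ?_
      rw [← Real.rpow_two]
      exact Real.rpow_le_rpow_of_exponent_le h (by linarith)
  have hac := absolutelyContinuous_of_withDensityᵥ_eq hL.levyMeasure.zero hν1 hk hkν
  have hint : ∀ g : ℝ → ℝ, MemLp g ∞ volume → ∫ x, g x * x ∂ν = ∫ x, g x * k x := fun g hg ↦ by
    obtain ⟨B, hB⟩ : ∃ B, ∀ᵐ x, ‖(g x : ℂ)‖ ≤ B :=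
      ⟨(eLpNorm g ∞ volume).toReal, by
        have h := ae_le_eLpNormEssSup (f := g) (μ := (volume : Measure ℝ))
        rw [← eLpNorm_exponent_top] at h
        filter_upwards [h] with x hx
        rw [Complex.norm_real, ← toReal_enorm]
        exact ENNReal.toReal_mono hg.2.ne hx⟩
    have hgm : AEStronglyMeasurable (fun x ↦ (g x : ℂ)) volume :=
      Complex.continuous_ofReal.comp_aestronglyMeasurable hg.1
    have := integral_mul_eq_of_withDensityᵥ_eq hν1 hk hkν (hgm.mono_ac hac) hgm (hac.ae_le hB) hB
    have e1 : ∀ (m : Measure ℝ) (f : ℝ → ℝ), ∫ x, (f x : ℂ) * (g x : ℂ) ∂m =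
        ((∫ x, g x * f x ∂m : ℝ) : ℂ) := fun m f ↦ by
      rw [← integral_complex_ofReal]
      refine integral_congr_ae (ae_of_all _ fun x ↦ ?_)
      push_cast; ring
    rw [e1, e1] at this
    exact_mod_cast this
  let κ : ℝ → ℂ := ft (fun x ↦ (k x : ℂ))
  have hκ : ∀ u : ℝ, ∫ x : ℝ, Complex.exp (Complex.I * u * x) * x ∂ν = κ u := fun u ↦ by
    have := integral_mul_eq_of_withDensityᵥ_eq hν1 hk hkν
      (G := fun x : ℝ ↦ Complex.exp (Complex.I * u * x)) (C := 1)
      (by fun_prop : Continuous _).aestronglyMeasurable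
      (by fun_prop : Continuous _).aestronglyMeasurable
      (ae_of_all _ fun x ↦ (norm_exp_I_mul u x).le) (ae_of_all _ fun x ↦ (norm_exp_I_mul u x).le)
    simp only [mul_comm (Complex.ofReal _)] at this
    exact this
  have hφe : ∀ u, φ u = Complex.exp ((Δ : ℝ) * psi γ ν u) := fun u ↦ by
    rw [hφ, hP, hL.charFun_eq]
  have hψ : ∀ u, HasDerivAt (psi γ ν) (Complex.I * γ + Complex.I * κ u) u := fun u ↦ by
    rw [← hκ u]
    refine HasDerivAt.add ?_ (hasDerivAt_integral_exp_sub_one hν1 u)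
    have := (Complex.ofRealCLM.hasDerivAt (x := u)).const_mul (Complex.I * γ)
    simpa using this
  have hφd : ∀ u : ℝ, HasDerivAt φ (Complex.I * ((Δ * γ : ℝ) + (Δ : ℝ) * κ u) * φ u) u := fun u ↦ by
    have h1 := ((hψ u).const_mul ((Δ : ℝ) : ℂ)).cexp
    have h2 : φ = fun u ↦ Complex.exp ((Δ : ℝ) * psi γ ν u) := funext hφe
    rw [h2]
    convert h1 using 1
    push_cast; ring
  have hΔ' : (0 : ℝ) < Δ := by exact_mod_cast hΔ
  have hφ0 : φ 0 = 1 := by rw [hφ, charFun_zero]; simp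
  have hφ1 : ∀ u, ‖φ u‖ ≤ 1 := fun u ↦ by rw [hφ]; exact norm_charFun_le_one u
  have hκb : ∀ u, ‖κ u‖ ≤ ∫ x, ‖(k x : ℂ)‖ := norm_ft_le _
  have hmom2 : MemLp (fun x : ℝ ↦ x) 2 P := by
    refine memLp_id_of_charFun (C := Δ * (∫ x, x ^ 2 ∂ν) * 2 +
      2 * (|Δ * γ| + Δ * ∫ x, ‖(k x : ℂ)‖) ^ 2) fun u ↦ ?_
    rw [← hφ]
    refine norm_add_neg_sub_le hφ0 hφ1 hφd (fun u ↦ ?_) (fun s ↦ ?_) u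
    · rw [norm_mul, Complex.norm_I, one_mul]
      refine (norm_add_le _ _).trans ?_
      rw [Complex.norm_real, Real.norm_eq_abs, norm_mul, Complex.norm_real,
        Real.norm_of_nonneg hΔ'.le]
      gcongr
      exact hκb u
    · have := integral_id_mul_exp_lipschitz hν1 hν2 s (-s)
      rw [hκ, hκ, sub_neg_eq_add, ← two_mul, abs_mul, abs_two] at this
      have e : Complex.I * ((Δ * γ : ℝ) + (Δ : ℝ) * κ s) -
          Complex.I * ((Δ * γ : ℝ) + (Δ : ℝ) * κ (-s)) =
          Complex.I * (Δ : ℝ) * (κ s - κ (-s)) := by ring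
      rw [e, norm_mul, norm_mul, Complex.norm_I, one_mul, Complex.norm_real,
        Real.norm_of_nonneg hΔ'.le]
      calc _ ≤ (Δ : ℝ) * ((∫ x, x ^ 2 ∂ν) * (2 * |s|)) := by gcongr
        _ = _ := by ring
  have hP1 : Integrable (fun x : ℝ ↦ x) P := hmom2.integrable (by norm_num)
  -- The hypothesis to check is that (x − Δγ)P has the transform Δκφ. It results from equating the
  -- two formulas for φ'.
  have hdens := withDensity_abs_sub_le (P := P) (x₀ := Δ * γ) (C := Δ * C₁) (k := fun x ↦ Δ * k x)
    hP1 (hk.const_mul _) (fun x ↦ by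
      rw [abs_mul, abs_of_pos hΔ']
      exact mul_le_mul_of_nonneg_left (hC₁ x) hΔ'.le) fun u ↦ by
      have h1 := (hasDerivAt_charFun hP1 u).unique (hφ ▸ hφd u)
      rw [← hφ] at h1
      have h2 : ∫ x : ℝ, ((x - Δ * γ : ℝ) : ℂ) * Complex.exp (Complex.I * u * x) ∂P =
          (∫ x : ℝ, Complex.exp (Complex.I * u * x) * x ∂P) - (Δ * γ : ℝ) * charFun P u := by
        rw [charFun_eq_integral, ← integral_const_mul, ← integral_sub (integrable_exp_I_mul_id hP1 u)]
        · refine integral_congr_ae (ae_of_all _ fun x ↦ ?_)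
          simp only
          push_cast; ring
        · exact ((integrable_const (1 : ℝ)).mono' (by fun_prop : Continuous _).aestronglyMeasurable
            (ae_of_all _ fun x ↦ (norm_exp_I_mul u x).le)).const_mul _
      have h3 : ft (fun x ↦ ((Δ * k x : ℝ) : ℂ)) u = (Δ : ℝ) * κ u := by
        simp only [κ, ft]
        rw [← integral_const_mul]
        refine integral_congr_ae (ae_of_all _ fun x ↦ ?_)
        simp only
        push_cast; ring
      rw [h2, h3, ← hφ]
      have h4 := mul_left_cancel₀ Complex.I_ne_zero (h1.trans (mul_assoc _ _ _))
      rw [h4]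
      ring
  have hφc : Continuous φ := continuous_iff_continuousAt.2 fun u ↦ (hφd u).continuousAt
  -- Lowering ε weakens condition (c), and ε ≤ 1/4 keeps the exponents 1 − ε and 1 − 2ε nonnegative.
  -- A single constant bounds k, the decay of κ and the density of |x − x₀|P.
  refine ⟨k, min ε (1 / 4), max (max C₁ C₂) (Δ * C₁), ⟨hprob, hφ, hΔ', hmom2, fun u ↦ ?_, hφd, hk,
    fun x ↦ ?_, fun u ↦ ?_, ?_, by positivity, min_le_right _ _, ?_⟩, hint⟩
  · rw [hφe]; exact Complex.exp_ne_zero _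
  · exact (hC₁ x).trans ((le_max_left _ _).trans (le_max_left _ _))
  · have := hC₂ u
    rw [hκ] at this
    refine this.trans ?_
    gcongr
    exact (le_max_right _ _).trans (le_max_left _ _)
  · refine hdens.trans ?_
    refine Measure.le_iff.2 fun s _ ↦ ?_
    simp only [Measure.smul_apply, smul_eq_mul]
    gcongr
    exact le_max_right _ _
  · refine MemLp.of_le hW ?_ (ae_of_all _ fun u ↦ ?_)
    · have : Continuous fun u : ℝ ↦ (1 + |u|) ^ (-1 + min ε (1 / 4)) * ‖(φ u)⁻¹‖ := by
        refine Continuous.mul (Continuous.rpow_const (by fun_prop) fun u ↦ Or.inl (by positivity))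
          (Continuous.norm (hφc.inv₀ fun u ↦ ?_))
        rw [hφe]; exact Complex.exp_ne_zero _
      exact this.aestronglyMeasurable
    · rw [norm_mul, norm_norm, norm_mul, Complex.norm_real, Real.norm_of_nonneg (by positivity),
        Real.norm_of_nonneg (by positivity)]
      refine mul_le_mul_of_nonneg_right ?_ (norm_nonneg _)
      exact Real.rpow_le_rpow_of_exponent_le (by linarith [abs_nonneg u])
        (by linarith [min_le_left ε (1 / 4)])

end

end LevyCLT

namespace LevyCLT

noncomputable section

/-! ### Growth of the inverse characteristic function -/

/-- Grönwall's inequality over an interval of length at most one. -/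
lemma norm_add_le_of_norm_deriv_le {f f' : ℝ → ℂ} {M : ℝ} (hf : ∀ u, HasDerivAt f (f' u) u)
    (hM : ∀ u, ‖f' u‖ ≤ M * ‖f u‖) {t : ℝ} (ht : 0 ≤ t) (ht1 : t ≤ 1) (u : ℝ) :
    ‖f (u + t)‖ ≤ ‖f u‖ * Real.exp M := by
  -- A negative `M` is compatible with the hypothesis only if f(u) = 0.
  have hM0 : 0 ≤ M ∨ f u = 0 := by
    by_cases h : f u = 0
    · exact Or.inr h
    · refine Or.inl ?_
      by_contra hneg
      have h1 : 0 < ‖f u‖ := norm_pos_iff.2 h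
      have := (norm_nonneg _).trans (hM u)
      nlinarith
  have hcont : Continuous f := continuous_iff_continuousAt.2 fun u ↦ (hf u).continuousAt
  have := norm_le_gronwallBound_of_norm_deriv_right_le (f := f) (f' := f') (δ := ‖f u‖) (K := M)
    (ε := 0) (a := u) (b := u + 1) hcont.continuousOn (fun x _ ↦ (hf x).hasDerivWithinAt) le_rfl
    (fun x _ ↦ by simpa using hM x) (u + t) ⟨by linarith, by linarith⟩
  rw [gronwallBound_ε0] at this
  refine this.trans ?_
  rcases hM0 with h | h
  · gcongr
    nlinarith
  · simp [h]

namespace IncrementLaw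

variable {P : Measure ℝ} {φ : ℝ → ℂ} {x₀ Δ : ℝ} {k : ℝ → ℝ} {ε C : ℝ}

lemma C_nonneg (h : IncrementLaw P φ x₀ Δ k ε C) : 0 ≤ C := (abs_nonneg _).trans (h.bound 0)

lemma continuous (h : IncrementLaw P φ x₀ Δ k ε C) : Continuous φ :=
  continuous_iff_continuousAt.2 fun u ↦ (h.hasDerivAt u).continuousAt

lemma continuous_inv (h : IncrementLaw P φ x₀ Δ k ε C) : Continuous fun u ↦ (φ u)⁻¹ :=
  h.continuous.inv₀ h.ne_zero

lemma continuous_ft (h : IncrementLaw P φ x₀ Δ k ε C) : Continuous (ft fun x ↦ (k x : ℂ)) :=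
  LevyCLT.continuous_ft h.integrable.ofReal

lemma norm_ft_le' (h : IncrementLaw P φ x₀ Δ k ε C) (u : ℝ) : ‖ft (fun x ↦ (k x : ℂ)) u‖ ≤ C := by
  refine (h.decay u).trans ?_
  calc _ ≤ C * 1 := by
        refine mul_le_mul_of_nonneg_left ?_ h.C_nonneg
        exact inv_le_one_of_one_le₀ (by linarith [abs_nonneg u])
    _ = C := mul_one C

lemma norm_logDeriv_le (h : IncrementLaw P φ x₀ Δ k ε C) (u : ℝ) :
    ‖Complex.I * (x₀ + Δ * ft (fun x ↦ (k x : ℂ)) u)‖ ≤ |x₀| + Δ * C := by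
  rw [norm_mul, Complex.norm_I, one_mul]
  refine (norm_add_le _ _).trans ?_
  rw [norm_mul, Complex.norm_real, Complex.norm_real, Real.norm_eq_abs,
    Real.norm_of_nonneg h.Δ_pos.le]
  have := h.norm_ft_le' u
  have := h.Δ_pos
  gcongr

lemma hasDerivAt_inv (h : IncrementLaw P φ x₀ Δ k ε C) (u : ℝ) :
    HasDerivAt (fun u ↦ (φ u)⁻¹)
      (-(Complex.I * (x₀ + Δ * ft (fun x ↦ (k x : ℂ)) u) * (φ u)⁻¹)) u := by
  have := (h.hasDerivAt u).fun_inv (h.ne_zero u)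
  have e : -(Complex.I * (x₀ + Δ * ft (fun x ↦ (k x : ℂ)) u) * (φ u)⁻¹) =
      -(Complex.I * (x₀ + Δ * ft (fun x ↦ (k x : ℂ)) u) * φ u) / φ u ^ 2 := by
    have := h.ne_zero u
    field_simp
  rw [e]
  exact this

lemma norm_inv_add_le (h : IncrementLaw P φ x₀ Δ k ε C) {t : ℝ} (ht : 0 ≤ t) (ht1 : t ≤ 1) (u : ℝ) :
    ‖(φ (u + t))⁻¹‖ ≤ ‖(φ u)⁻¹‖ * Real.exp (|x₀| + Δ * C) :=
  norm_add_le_of_norm_deriv_le h.hasDerivAt_inv (fun u ↦ by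
    rw [norm_neg, norm_mul]
    exact mul_le_mul_of_nonneg_right (h.norm_logDeriv_le u) (norm_nonneg _)) ht ht1 u

/-- Grönwall is applied to φ itself here, whereas the bound in the other direction uses φ⁻¹. -/
lemma norm_inv_le_add (h : IncrementLaw P φ x₀ Δ k ε C) {t : ℝ} (ht : 0 ≤ t) (ht1 : t ≤ 1) (u : ℝ) :
    ‖(φ u)⁻¹‖ ≤ Real.exp (|x₀| + Δ * C) * ‖(φ (u + t))⁻¹‖ := by
  have := norm_add_le_of_norm_deriv_le h.hasDerivAt (M := |x₀| + Δ * C) (fun u ↦ by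
    rw [norm_mul]
    exact mul_le_mul_of_nonneg_right (h.norm_logDeriv_le u) (norm_nonneg _)) ht ht1 u
  have h1 := norm_pos_iff.2 (h.ne_zero u)
  have h2 := norm_pos_iff.2 (h.ne_zero (u + t))
  rw [norm_inv, norm_inv, ← div_eq_mul_inv, le_div_iff₀ h2, inv_mul_le_iff₀ h1]
  exact this

/-- A multiplicative constant for the growth of `φ⁻¹` on unit intervals. -/
lemma exists_growth (h : IncrementLaw P φ x₀ Δ k ε C) : ∃ A : ℝ, 1 ≤ A ∧
    (∀ t u : ℝ, 0 ≤ t → t ≤ 1 → ‖(φ (u + t))⁻¹‖ ≤ A * ‖(φ u)⁻¹‖) ∧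
    (∀ t u : ℝ, 0 ≤ t → t ≤ 1 → ‖(φ u)⁻¹‖ ≤ A * ‖(φ (u + t))⁻¹‖) ∧
    (∀ t u : ℝ, 0 ≤ t → t ≤ 1 → ‖(φ (u + t))⁻¹ - (φ u)⁻¹‖ ≤ t * A * ‖(φ u)⁻¹‖) ∧
    (∀ t u : ℝ, 0 ≤ t → t ≤ 1 → ‖(φ (u + t))⁻¹ - (φ u)⁻¹‖ ≤ t * A * ‖(φ (u + t))⁻¹‖) := by
  let M := |x₀| + Δ * C
  have hM : 0 ≤ M := add_nonneg (abs_nonneg _) (mul_nonneg h.Δ_pos.le h.C_nonneg)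
  have hE : 1 ≤ Real.exp M := Real.one_le_exp hM
  have lip : ∀ t u : ℝ, 0 ≤ t → t ≤ 1 →
      ‖(φ (u + t))⁻¹ - (φ u)⁻¹‖ ≤ t * (M * (‖(φ u)⁻¹‖ * Real.exp M)) := fun t u ht ht1 ↦ by
    have := Convex.norm_image_sub_le_of_norm_hasDerivWithin_le (f := fun u ↦ (φ u)⁻¹)
      (s := Set.Icc u (u + t)) (C := M * (‖(φ u)⁻¹‖ * Real.exp M))
      (fun x _ ↦ (h.hasDerivAt_inv x).hasDerivWithinAt) (fun x hx ↦ ?_) (convex_Icc _ _)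
      (Set.left_mem_Icc.2 (by linarith)) (Set.right_mem_Icc.2 (by linarith))
    · refine this.trans (le_of_eq ?_)
      rw [add_sub_cancel_left, Real.norm_of_nonneg ht, mul_comm]
    · have h1 := h.norm_inv_add_le (t := x - u) (by linarith [hx.1]) (by linarith [hx.2]) u
      rw [add_sub_cancel] at h1
      rw [norm_neg, norm_mul]
      exact mul_le_mul (h.norm_logDeriv_le x) h1 (norm_nonneg _) hM
  -- This constant dominates e^M, Me^M and Me^{2M}, so one choice serves all four bounds.
  refine ⟨(1 + M) * Real.exp M ^ 2, by nlinarith, fun t u ht ht1 ↦ ?_, fun t u ht ht1 ↦ ?_,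
    fun t u ht ht1 ↦ ?_, fun t u ht ht1 ↦ ?_⟩
  · refine (h.norm_inv_add_le ht ht1 u).trans ?_
    rw [mul_comm]
    gcongr
    change Real.exp M ≤ _
    nlinarith
  · refine (h.norm_inv_le_add ht ht1 u).trans ?_
    gcongr
    change Real.exp M ≤ _
    nlinarith
  · refine (lip t u ht ht1).trans ?_
    rw [mul_assoc t]
    refine mul_le_mul_of_nonneg_left ?_ ht
    have := norm_nonneg (φ u)⁻¹
    have e : M * (‖(φ u)⁻¹‖ * Real.exp M) = (M * Real.exp M) * ‖(φ u)⁻¹‖ := by ring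
    rw [e]
    refine mul_le_mul_of_nonneg_right ?_ this
    have h1 : Real.exp M ≤ Real.exp M ^ 2 := by nlinarith
    nlinarith [mul_le_mul_of_nonneg_left h1 hM, sq_nonneg (Real.exp M)]
  · refine (lip t u ht ht1).trans ?_
    rw [mul_assoc t]
    refine mul_le_mul_of_nonneg_left ?_ ht
    have h1 := h.norm_inv_le_add ht ht1 u
    have := norm_nonneg (φ (u + t))⁻¹
    calc M * (‖(φ u)⁻¹‖ * Real.exp M)
        ≤ M * ((Real.exp M * ‖(φ (u + t))⁻¹‖) * Real.exp M) := by gcongr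
      _ = (M * Real.exp M ^ 2) * ‖(φ (u + t))⁻¹‖ := by ring
      _ ≤ _ := by
        refine mul_le_mul_of_nonneg_right ?_ this
        nlinarith

/-- The weight `(1 + |u|)^{-1+ε} |φ(u)|⁻¹`. -/
def weight (φ : ℝ → ℂ) (ε : ℝ) (u : ℝ) : ℝ := (1 + |u|) ^ (-1 + ε) * ‖(φ u)⁻¹‖

lemma weight_nonneg (φ : ℝ → ℂ) (ε u : ℝ) : 0 ≤ weight φ ε u := by
  unfold weight; positivity

lemma integrable_weight_sq (h : IncrementLaw P φ x₀ Δ k ε C) :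
    Integrable fun u ↦ weight φ ε u ^ 2 := h.memLp_weight.integrable_sq

/-- `φ(u)⁻¹ ≲ (1 + |u|)^{1-ε}`. -/
lemma exists_weight_le (h : IncrementLaw P φ x₀ Δ k ε C) : ∃ B : ℝ, ∀ u, weight φ ε u ≤ B := by
  obtain ⟨A, hA, -, hA2, -⟩ := h.exists_growth
  -- Over a unit interval the weight changes at most by the factor 2A. Its square at u is therefore
  -- at most (2A)² times its integral over [u, u + 1], and square integrability yields boundedness.
  have key : ∀ u s : ℝ, 0 ≤ s → s ≤ 1 → weight φ ε u ≤ 2 * A * weight φ ε (u + s) :=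
    fun u s hs hs1 ↦ by
    have h1 : (1 + |u|) ^ (-1 + ε) ≤ 2 * (1 + |u + s|) ^ (-1 + ε) := by
      have h2 : 1 + |u + s| ≤ 2 * (1 + |u|) := by
        have := abs_add_le u s
        rw [abs_of_nonneg hs] at this
        linarith [abs_nonneg u]
      have h3 : (2 * (1 + |u|)) ^ (-1 + ε) ≤ (1 + |u + s|) ^ (-1 + ε) :=
        Real.rpow_le_rpow_of_nonpos (by positivity) h2 (by linarith [h.ε_le])
      rw [Real.mul_rpow (by norm_num) (by positivity)] at h3
      have h4 : (1 / 2 : ℝ) ≤ 2 ^ (-1 + ε) := by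
        have : (2 : ℝ) ^ (-1 : ℝ) ≤ 2 ^ (-1 + ε) :=
          Real.rpow_le_rpow_of_exponent_le (by norm_num) (by linarith [h.ε_pos])
        rw [Real.rpow_neg_one] at this
        linarith
      have h5 : 0 ≤ (1 + |u|) ^ (-1 + ε) := by positivity
      nlinarith
    calc weight φ ε u ≤ (2 * (1 + |u + s|) ^ (-1 + ε)) * (A * ‖(φ (u + s))⁻¹‖) :=
          mul_le_mul h1 (hA2 s u hs hs1) (norm_nonneg _) (by positivity)
      _ = _ := by unfold weight; ring
  refine ⟨Real.sqrt ((2 * A) ^ 2 * ∫ s, weight φ ε s ^ 2), fun u ↦ ?_⟩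
  refine Real.le_sqrt_of_sq_le ?_
  have h1 : weight φ ε u ^ 2 = ∫ s in Set.Icc u (u + 1), weight φ ε u ^ 2 := by
    rw [setIntegral_const]
    simp
  rw [h1]
  have hi := h.integrable_weight_sq
  calc _ ≤ ∫ s in Set.Icc u (u + 1), (2 * A) ^ 2 * weight φ ε s ^ 2 := by
        refine setIntegral_mono_on (by simp) (hi.const_mul _).integrableOn measurableSet_Icc
          fun s hs ↦ ?_
        have := key u (s - u) (by linarith [hs.1]) (by linarith [hs.2])
        rw [add_sub_cancel] at this
        rw [← mul_pow]
        exact pow_le_pow_left₀ (weight_nonneg _ _ _) this 2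
    _ ≤ ∫ s, (2 * A) ^ 2 * weight φ ε s ^ 2 :=
        setIntegral_le_integral (hi.const_mul _) (ae_of_all _ fun s ↦ by positivity)
    _ = _ := integral_const_mul _ _

end IncrementLaw

/-! ### The Fourier transform of an admissible function -/

/-- Decomposition `a + b` of a Fourier transform into a part `a` with `(1 + |u|) a(u) ∈ L²` and a part
`b` which is `O((1 + |u|)⁻¹)` together with its difference quotients. -/
structure FourierSplit (G a b : ℝ → ℂ) (C : ℝ) : Prop where
  ae_eq : ∀ᵐ u, G u = a u + b u
  memLp_a : MemLp a 2
  memLp_weight_a : MemLp (fun u ↦ (1 + |u|) * ‖a u‖) 2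
  continuous_b : Continuous b
  norm_b_le : ∀ u, ‖b u‖ ≤ C * (1 + |u|)⁻¹
  norm_b_sub_le : ∀ t u : ℝ, 0 < t → t ≤ 1 → ‖b (u + t) - b u‖ ≤ t * (C * (1 + |u|)⁻¹)

lemma one_add_abs_inv_le {u v : ℝ} (h : |v - u| ≤ 1) : (1 + |v|)⁻¹ ≤ 2 * (1 + |u|)⁻¹ := by
  have h1 : |u| ≤ |v| + 1 := by
    have := abs_sub_abs_le_abs_sub u v
    rw [abs_sub_comm] at this
    linarith
  have h2 : 0 < 1 + |v| := by positivity
  have h3 : 0 < 1 + |u| := by positivity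
  rw [← div_eq_mul_inv, le_div_iff₀ h3, inv_mul_le_iff₀ h2]
  linarith [abs_nonneg v]

/-- Both sides are continuous in u, so the inequality defines a closed set, which is dense as it has
full measure. -/
lemma norm_ft_le_of_ae {f : ℝ → ℂ} (hf : Integrable f) {C : ℝ}
    (h : ∀ᵐ u : ℝ, ‖ft f u‖ ≤ C * (1 + |u|)⁻¹) (u : ℝ) : ‖ft f u‖ ≤ C * (1 + |u|)⁻¹ := by
  have hd : Dense {u : ℝ | ‖ft f u‖ ≤ C * (1 + |u|)⁻¹} := Measure.dense_of_ae h
  have hc : IsClosed {u : ℝ | ‖ft f u‖ ≤ C * (1 + |u|)⁻¹} := by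
    refine isClosed_le (continuous_ft hf).norm (continuous_const.mul (Continuous.inv₀ (by fun_prop) ?_))
    intro x; positivity
  have := hc.closure_eq ▸ hd.closure_eq
  exact (this ▸ Set.mem_univ u : u ∈ {u : ℝ | ‖ft f u‖ ≤ C * (1 + |u|)⁻¹})

lemma hasDerivAt_ft {f : ℝ → ℂ} (hf : Integrable f) (hxf : Integrable fun x : ℝ ↦ (x : ℂ) * f x)
    (u : ℝ) : HasDerivAt (ft f) (Complex.I * ft (fun x : ℝ ↦ (x : ℂ) * f x) u) u := by
  have := (hasDerivAt_integral_of_dominated_loc_of_deriv_le (μ := volume) (𝕜 := ℝ) (x₀ := u)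
    (s := Set.univ) (bound := fun x : ℝ ↦ ‖(x : ℂ) * f x‖)
    (F := fun (s x : ℝ) ↦ Complex.exp (Complex.I * s * x) * f x)
    (F' := fun (s x : ℝ) ↦ Complex.I * x * Complex.exp (Complex.I * s * x) * f x) univ_mem
    (.of_forall fun s ↦ (integrable_exp_mul hf s).1) (integrable_exp_mul hf u)
    ((by fun_prop : Continuous fun x : ℝ ↦ Complex.I * x *
      Complex.exp (Complex.I * u * x)).aestronglyMeasurable.mul hf.1)
    (ae_of_all _ fun x s _ ↦ by simp [norm_exp_I_mul]) hxf.norm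
    (ae_of_all _ fun x s _ ↦ (hasDerivAt_exp_I x s).mul_const (f x))).2
  have e : Complex.I * ft (fun x : ℝ ↦ (x : ℂ) * f x) u =
      ∫ x : ℝ, Complex.I * x * Complex.exp (Complex.I * u * x) * f x := by
    rw [ft, ← integral_const_mul]
    refine integral_congr_ae (ae_of_all _ fun x ↦ ?_)
    ring
  rw [e]
  exact this

lemma norm_ft_sub_le_of_integrable {f : ℝ → ℂ} (hf : Integrable f)
    (hxf : Integrable fun x : ℝ ↦ (x : ℂ) * f x) {C : ℝ} (hC : 0 ≤ C)
    (h : ∀ u : ℝ, ‖ft (fun x : ℝ ↦ (x : ℂ) * f x) u‖ ≤ C * (1 + |u|)⁻¹) {t : ℝ} (u : ℝ) (ht : 0 < t)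
    (ht1 : t ≤ 1) : ‖ft f (u + t) - ft f u‖ ≤ t * (2 * C * (1 + |u|)⁻¹) := by
  have := Convex.norm_image_sub_le_of_norm_hasDerivWithin_le (f := ft f)
    (s := Set.Icc u (u + t)) (C := 2 * C * (1 + |u|)⁻¹)
    (fun x _ ↦ (hasDerivAt_ft hf hxf x).hasDerivWithinAt) (fun x hx ↦ ?_) (convex_Icc _ _)
    (Set.left_mem_Icc.2 (by linarith)) (Set.right_mem_Icc.2 (by linarith))
  · refine this.trans (le_of_eq ?_)
    rw [add_sub_cancel_left, Real.norm_of_nonneg ht.le, mul_comm]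
  · rw [norm_mul, Complex.norm_I, one_mul]
    refine (h x).trans ?_
    have := one_add_abs_inv_le (u := u) (v := x)
      (by rw [abs_of_nonneg (by linarith [hx.1])]; linarith [hx.2])
    calc _ ≤ C * (2 * (1 + |u|)⁻¹) := by gcongr
      _ = _ := by ring

/-- When x f(x) is only square integrable, differentiation under the integral is not available.
Instead e^{i(u+t)x} − e^{iux} is written as 2πi x times the inverse transform of an indicator, and
Parseval turns the increment into an integral of F[xf] over [u, u + t). -/
lemma norm_ft_sub_le_of_memLp {f : ℝ → ℂ} (hf : Integrable f)
    (hxf : MemLp (fun x : ℝ ↦ (x : ℂ) * f x) 2) {C : ℝ} (hC : 0 ≤ C)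
    (h : ∀ᵐ u : ℝ, ‖ftL2 (fun x : ℝ ↦ (x : ℂ) * f x) u‖ ≤ C * (1 + |u|)⁻¹) {t : ℝ} (u : ℝ)
    (ht : 0 < t) (ht1 : t ≤ 1) : ‖ft f (u + t) - ft f u‖ ≤ t * (2 * C * (1 + |u|)⁻¹) := by
  -- The interval is reflected because Parseval's identity evaluates `G` at −v.
  let G : ℝ → ℂ := (Set.Ioc (-(u + t)) (-u)).indicator 1
  have hG1 : Integrable G := (integrable_indicator_iff measurableSet_Ioc).2
    (integrableOn_const (by simp) (by simp))
  have hG2 : MemLp G 2 := memLp_indicator_const 2 measurableSet_Ioc 1 (Or.inr (by simp))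
  have hinv : ∀ x : ℝ, 2 * (Real.pi : ℂ) * Complex.I * x * invFt G x =
      Complex.exp (Complex.I * (u + t : ℝ) * x) - Complex.exp (Complex.I * u * x) := fun x ↦ by
    have e1 : invFt G x = (2 * (Real.pi : ℂ))⁻¹ * ∫ v in u..(u + t), Complex.exp (Complex.I * v * x) := by
      rw [invFt]
      congr 1
      have : ∀ v : ℝ, Complex.exp (-(Complex.I * v * x)) * G v =
          (Set.Ioc (-(u + t)) (-u)).indicator (fun v : ℝ ↦ Complex.exp (-(Complex.I * v * x))) v :=
        fun v ↦ by
          simp only [G, Set.indicator]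
          split_ifs <;> simp
      simp_rw [this]
      rw [integral_indicator measurableSet_Ioc, ← intervalIntegral.integral_of_le (by linarith),
        ← intervalIntegral.integral_comp_neg]
      refine intervalIntegral.integral_congr fun v _ ↦ ?_
      simp
    have e2 : ∫ v in u..(u + t), Complex.I * x * Complex.exp (Complex.I * v * x) =
        Complex.exp (Complex.I * (u + t : ℝ) * x) - Complex.exp (Complex.I * u * x) :=
      intervalIntegral.integral_eq_sub_of_hasDerivAt (fun v _ ↦ hasDerivAt_exp_I x v)
        ((by fun_prop : Continuous fun v : ℝ ↦
          Complex.I * x * Complex.exp (Complex.I * v * x)).intervalIntegrable _ _)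
    rw [← e2, e1, intervalIntegral.integral_const_mul]
    have : (Real.pi : ℂ) ≠ 0 := by exact_mod_cast Real.pi_ne_zero
    field_simp
  have key := integral_mul_invFt hxf hG1 hG2
  have e : ft f (u + t) - ft f u = Complex.I * ∫ v, ftL2 (fun x : ℝ ↦ (x : ℂ) * f x) v * G (-v) := by
    rw [ft, ft, ← integral_sub (integrable_exp_mul hf _) (integrable_exp_mul hf _)]
    have : Complex.I * ∫ v, ftL2 (fun x : ℝ ↦ (x : ℂ) * f x) v * G (-v) =
        (2 * (Real.pi : ℂ) * Complex.I) * ∫ x : ℝ, (x : ℂ) * f x * invFt G x := by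
      rw [key]
      have : (Real.pi : ℂ) ≠ 0 := by exact_mod_cast Real.pi_ne_zero
      field_simp
    rw [this, ← integral_const_mul]
    refine integral_congr_ae (ae_of_all _ fun x ↦ ?_)
    simp only
    rw [← sub_mul, ← hinv x]
    ring
  rw [e, norm_mul, Complex.norm_I, one_mul]
  have hGb : ∀ᵐ v, ‖ftL2 (fun x : ℝ ↦ (x : ℂ) * f x) v * G (-v)‖ ≤
      (Set.Ico u (u + t)).indicator (fun _ ↦ 2 * C * (1 + |u|)⁻¹) v := by
    filter_upwards [h] with v hv
    by_cases hvm : v ∈ Set.Ico u (u + t)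
    · rw [Set.indicator_of_mem hvm, norm_mul]
      have : G (-v) = 1 := by
        simp only [G]
        have hm : -v ∈ Set.Ioc (-(u + t)) (-u) := ⟨by linarith [hvm.2], by linarith [hvm.1]⟩
        rw [Set.indicator_of_mem hm]
        rfl
      rw [this, norm_one, mul_one]
      refine hv.trans ?_
      have := one_add_abs_inv_le (u := u) (v := v)
        (by rw [abs_of_nonneg (by linarith [hvm.1])]; linarith [hvm.2])
      calc _ ≤ C * (2 * (1 + |u|)⁻¹) := by gcongr
        _ = _ := by ring
    · rw [Set.indicator_of_notMem hvm]
      have : G (-v) = 0 := by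
        simp only [G]
        rw [Set.indicator_of_notMem]
        rintro ⟨h1, h2⟩
        exact hvm ⟨by linarith, by linarith⟩
      rw [this, mul_zero, norm_zero]
  refine (norm_integral_le_of_norm_le ?_ hGb).trans (le_of_eq ?_)
  · exact (integrable_indicator_iff measurableSet_Ico).2 (integrableOn_const (by simp) enorm_ne_top)
  · rw [integral_indicator measurableSet_Ico, setIntegral_const]
    simp [ht.le]

/-- Here a is the transform of g^c and b that of g^s, the latter as an absolutely convergent
integral and hence continuous. The decay of F[xg^s], which is formally the derivative of b up to the
factor i, controls the increments of b. Square integrability of g^s comes from g − g^c. -/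
lemma IsAdmissible.exists_fourierSplit {g : ℝ → ℝ} (hg : IsAdmissible g) :
    ∃ (a b : ℝ → ℂ) (C : ℝ), FourierSplit (ftL2 fun x ↦ (g x : ℂ)) a b C := by
  obtain ⟨gc, gs, hsum, hgc, hgs, ⟨C₁, hC₁⟩, ⟨C₂, hC₂⟩⟩ := hg.split
  have hgm : MemLp (fun x ↦ (g x : ℂ)) 2 := hg.square_integrable.ofReal
  have hgs2 : MemLp (fun x ↦ (gs x : ℂ)) 2 := by
    refine (memLp_congr_ae ?_).1 (hgm.sub hgc.1)
    filter_upwards [hsum] with x hx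
    simp [hx]
  have hgs1 : Integrable (fun x ↦ (gs x : ℂ)) := hgs.ofReal
  have hb : ∀ u, ‖ft (fun x ↦ (gs x : ℂ)) u‖ ≤ C₁ * (1 + |u|)⁻¹ := by
    rcases hC₁ with h | h
    · exact h.2
    · refine norm_ft_le_of_ae hgs1 ?_
      filter_upwards [h.2, ftL2_eq_ft hgs1 hgs2] with u hu1 hu2
      rwa [← hu2]
  have hC₂' : 0 ≤ C₂ := by
    have hp : ∀ (u : ℝ) (y : ℂ), ‖y‖ ≤ C₂ * (1 + |u|)⁻¹ → 0 ≤ C₂ := fun u y hy ↦ by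
      have h1 : 0 < (1 + |u|)⁻¹ := by positivity
      exact nonneg_of_mul_nonneg_left ((norm_nonneg _).trans hy) h1
    rcases hC₂ with h | h
    · exact hp 0 _ (h.2 0)
    · obtain ⟨u, hu⟩ := h.2.exists
      exact hp u _ hu
  simp only [Complex.ofReal_mul] at hC₂
  have hd : ∀ t u : ℝ, 0 < t → t ≤ 1 → ‖ft (fun x ↦ (gs x : ℂ)) (u + t) - ft (fun x ↦ (gs x : ℂ)) u‖ ≤
      t * (2 * C₂ * (1 + |u|)⁻¹) := fun t u ht ht1 ↦ by
    rcases hC₂ with h | h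
    · exact norm_ft_sub_le_of_integrable hgs1 h.1 hC₂' h.2 u ht ht1
    · exact norm_ft_sub_le_of_memLp hgs1 h.1 hC₂' h.2 u ht ht1
  refine ⟨ftL2 fun x ↦ (gc x : ℂ), ft fun x ↦ (gs x : ℂ), max C₁ (2 * C₂), ?_, memLp_ftL2 hgc.1, ?_,
    continuous_ft hgs1, fun u ↦ ?_, fun t u ht ht1 ↦ ?_⟩
  · have e : (fun x ↦ (g x : ℂ)) =ᵐ[volume] fun x ↦ (gc x : ℂ) + (gs x : ℂ) := by
      filter_upwards [hsum] with x hx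
      rw [hx]; push_cast; rfl
    rw [ftL2_congr e]
    filter_upwards [ftL2_add hgc.1 hgs2, ftL2_eq_ft hgs1 hgs2] with u h1 h2
    rw [h1, h2]
  · refine (memLp_congr_ae (ae_of_all _ fun u ↦ ?_)).1 hgc.2.norm
    rw [norm_mul, Complex.norm_real, Real.norm_of_nonneg (by positivity)]
  · refine (hb u).trans ?_
    gcongr
    exact le_max_left _ _
  · refine (hd t u ht ht1).trans ?_
    gcongr
    exact le_max_right _ _

/-! ### The kernel -/

/-- The properties of the Fourier transform `H` of a kernel that enter the proof. -/
structure KernelTransform (H : ℝ → ℂ) (C : ℝ) : Prop where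
  continuous : Continuous H
  eq_zero : ∀ u, 1 < |u| → H u = 0
  norm_le : ∀ u, ‖H u‖ ≤ C
  norm_sub_le : ∀ u v, ‖H u - H v‖ ≤ C * |u - v|
  zero : H 0 = 1

namespace KernelTransform

variable {H : ℝ → ℂ} {C : ℝ}

lemma one_le (hH : KernelTransform H C) : 1 ≤ C := by
  have := hH.norm_le 0
  rwa [hH.zero, norm_one] at this

lemma norm_sub_one_le (hH : KernelTransform H C) (u : ℝ) : ‖H u - 1‖ ≤ 2 * C * min 1 |u| := by
  have hC := hH.one_le
  rcases le_total 1 |u| with h | h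
  · rw [min_eq_left h, mul_one]
    have h1 := _root_.norm_sub_le (H u) 1
    rw [norm_one] at h1
    linarith [hH.norm_le u]
  · rw [min_eq_right h, ← hH.zero]
    have h1 := hH.norm_sub_le u 0
    rw [sub_zero] at h1
    nlinarith [abs_nonneg u]

/-- Interpolation: min(1, y) ≤ y^ε for y = h(1 + |u|). A power of u is traded for the same power of
h. -/
lemma norm_sub_one_le_rpow (hH : KernelTransform H C) {h ε : ℝ} (hh : 0 < h) (hε : 0 < ε)
    (hε1 : ε ≤ 1) (u : ℝ) : ‖H (h * u) - 1‖ ≤ 2 * C * (h ^ ε * (1 + |u|) ^ ε) := by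
  have hC := hH.one_le
  refine (hH.norm_sub_one_le _).trans ?_
  rw [← Real.mul_rpow hh.le (by positivity)]
  gcongr
  have hle : |h * u| ≤ h * (1 + |u|) := by
    rw [abs_mul, abs_of_pos hh]; gcongr; linarith
  rcases le_total 1 (h * (1 + |u|)) with h1 | h1
  · exact (min_le_left _ _).trans (Real.one_le_rpow h1 hε.le)
  · refine (min_le_right _ _).trans (hle.trans ?_)
    exact Real.self_le_rpow_of_le_one (by positivity) h1 hε1

end KernelTransform

lemma integrable_one_add_abs_rpow {r : ℝ} (hr : 1 < r) : Integrable fun x : ℝ ↦ (1 + |x|) ^ (-r) := by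
  have := integrable_one_add_norm (E := ℝ) (μ := volume) (r := r) (by simpa using hr)
  simpa [Real.norm_eq_abs] using this

namespace IsKernel

variable {K : ℝ → ℝ}

lemma exists_abs_le (hK : IsKernel K) : ∃ β : ℝ, 2 < β ∧ ∃ C : ℝ, 0 ≤ C ∧ ∀ x, |K x| ≤ C * (1 + |x|) ^ (-β) := by
  obtain ⟨β, hβ, C, hC⟩ := hK.decay
  refine ⟨β, hβ, C, ?_, fun x ↦ (le_add_of_nonneg_right (abs_nonneg _)).trans (hC x)⟩
  have := hC 0
  simp only [abs_zero, add_zero, Real.one_rpow, mul_one] at this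
  exact (add_nonneg (abs_nonneg _) (abs_nonneg _)).trans this

lemma integrable (hK : IsKernel K) : Integrable K := by
  obtain ⟨β, hβ, C, hC0, hC⟩ := hK.exists_abs_le
  exact ((integrable_one_add_abs_rpow (by linarith : 1 < β)).const_mul C).mono'
    hK.differentiable.continuous.aestronglyMeasurable (ae_of_all _ hC)

/-- This is where β > 2 enters. The first absolute moment makes FK Lipschitz and gives a smoothing
error of order h at 0. -/
lemma integrable_abs_mul (hK : IsKernel K) : Integrable fun x ↦ |x| * |K x| := by
  obtain ⟨β, hβ, C, hC0, hC⟩ := hK.exists_abs_le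
  refine ((integrable_one_add_abs_rpow (by linarith : 1 < β - 1)).const_mul C).mono'
    (by have := hK.differentiable.continuous; fun_prop : Continuous _).aestronglyMeasurable
    (ae_of_all _ fun x ↦ ?_)
  rw [Real.norm_of_nonneg (by positivity)]
  have hp : 0 < 1 + |x| := by positivity
  calc |x| * |K x| ≤ (1 + |x|) * (C * (1 + |x|) ^ (-β)) :=
        mul_le_mul (by linarith) (hC x) (abs_nonneg _) hp.le
    _ = C * ((1 + |x|) ^ (1 : ℝ) * (1 + |x|) ^ (-β)) := by rw [Real.rpow_one]; ring
    _ = C * (1 + |x|) ^ (-(β - 1)) := by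
        rw [← Real.rpow_add hp]; congr 2; ring

lemma abs_le (hK : IsKernel K) : ∃ C : ℝ, ∀ x, |K x| ≤ C := by
  obtain ⟨β, hβ, C, hC0, hC⟩ := hK.exists_abs_le
  refine ⟨C, fun x ↦ (hC x).trans ?_⟩
  calc _ ≤ C * 1 := by
        gcongr
        exact Real.rpow_le_one_of_one_le_of_nonpos (by linarith [abs_nonneg x]) (by linarith)
    _ = C := mul_one C

lemma exists_kernelTransform (hK : IsKernel K) :
    ∃ C : ℝ, KernelTransform (ft fun x ↦ (K x : ℂ)) C := by
  have hi := hK.integrable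
  have hiC : Integrable fun x ↦ (K x : ℂ) := hi.ofReal
  refine ⟨max (∫ x, ‖(K x : ℂ)‖) (∫ x, |x| * |K x|), continuous_ft hi.ofReal, hK.bandLimited,
    fun u ↦ (norm_ft_le _ u).trans (le_max_left _ _), fun u v ↦ ?_, ?_⟩
  · rw [ft, ft, ← integral_sub (integrable_exp_mul hiC _) (integrable_exp_mul hiC _)]
    refine le_trans ?_ (mul_le_mul_of_nonneg_right (le_max_right _ _) (abs_nonneg _))
    rw [← integral_mul_const]
    refine norm_integral_le_of_norm_le (hK.integrable_abs_mul.mul_const _) (ae_of_all _ fun x ↦ ?_)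
    rw [← sub_mul, norm_mul]
    have e : Complex.exp (Complex.I * u * x) - Complex.exp (Complex.I * v * x) =
        Complex.exp (Complex.I * v * x) * (Complex.exp (Complex.I * (u - v : ℝ) * x) - 1) := by
      rw [mul_sub, ← Complex.exp_add, mul_one]
      congr 2
      push_cast; ring
    rw [e, norm_mul, norm_exp_I_mul, one_mul, Complex.norm_real, Real.norm_eq_abs]
    calc _ ≤ (|u - v| * |x|) * |K x| := by
          gcongr
          exact norm_exp_I_sub_one_le _ _
      _ = _ := by ring
  · rw [ft]
    simp only [Complex.ofReal_zero, mul_zero, zero_mul, Complex.exp_zero, one_mul]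
    rw [integral_complex_ofReal, hK.integral_eq_one, Complex.ofReal_one]

end IsKernel

lemma ft_scaledKernel (K : ℝ → ℝ) {h : ℝ} (hh : 0 < h) (u : ℝ) :
    ft (fun x ↦ (scaledKernel K h x : ℂ)) u = ft (fun x ↦ (K x : ℂ)) (h * u) := by
  rw [ft, ft]
  have := Measure.integral_comp_div (fun y : ℝ ↦ Complex.exp (Complex.I * (h * u : ℝ) * y) * K y) h
  rw [abs_of_pos hh] at this
  have h2 : ∀ x : ℝ, Complex.exp (Complex.I * u * x) * (scaledKernel K h x : ℂ) = (h : ℂ)⁻¹ *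
      (Complex.exp (Complex.I * (h * u : ℝ) * (x / h : ℝ)) * K (x / h)) := fun x ↦ by
    have e : Complex.I * (h * u : ℝ) * (x / h : ℝ) = Complex.I * u * x := by
      have : (h : ℂ) ≠ 0 := by exact_mod_cast hh.ne'
      push_cast
      field_simp
    rw [e, scaledKernel]
    push_cast
    ring
  simp_rw [h2]
  rw [integral_const_mul, this, Complex.real_smul, ← mul_assoc, inv_mul_cancel₀, one_mul]
  exact_mod_cast hh.ne'

end

end LevyCLT

namespace LevyCLT

noncomputable section

/-! ### Integrability of the symbols -/

/-- `P` may charge a Lebesgue-null point, so measurability up to Lebesgue-null sets would not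
suffice. -/
lemma measurable_invFtL2 (f : ℝ → ℂ) : Measurable (invFtL2 f) := by
  by_cases hf : MemLp f 2
  · have : invFtL2 f = fun x ↦ (2 * (Real.pi : ℂ))⁻¹ *
      (𝓕 (hf.toLp f) : Lp ℂ 2 (volume : Measure ℝ)) (x / (2 * Real.pi)) :=
      funext fun u ↦ invFtL2_of_memLp hf u
    rw [this]
    exact ((Lp.stronglyMeasurable _).measurable.comp (by fun_prop)).const_mul _
  · have : invFtL2 f = fun u ↦ 0 := funext fun u ↦ by rw [invFtL2, dif_neg hf]
    rw [this]; exact measurable_const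

lemma invFtL2_const_mul (c : ℂ) {f : ℝ → ℂ} (hf : MemLp f 2) :
    invFtL2 (fun u ↦ c * f u) =ᵐ[volume] fun x ↦ c * invFtL2 f x := by
  have hcf : MemLp (fun u ↦ c * f u) 2 := hf.const_mul c
  have h1 : hcf.toLp (fun u ↦ c * f u) = c • hf.toLp f := rfl
  have h2 : 𝓕 (hcf.toLp _) = c • 𝓕 (hf.toLp f) := by
    rw [h1]; exact FourierSMul.fourier_smul c _
  filter_upwards [ae_comp_div (Lp.coeFn_smul c (𝓕 (hf.toLp f))) two_pi_pos'.ne'] with u hu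
  rw [invFtL2_of_memLp hf, invFtL2_of_memLp hcf, h2, hu, Pi.smul_apply, smul_eq_mul]
  ring

lemma memLp_one_add_abs_inv : MemLp (fun u : ℝ ↦ (1 + |u|)⁻¹) 2 := by
  have hc : Continuous fun u : ℝ ↦ (1 + |u|)⁻¹ :=
    Continuous.inv₀ (by fun_prop) fun u ↦ by positivity
  rw [memLp_two_iff_integrable_sq hc.aestronglyMeasurable]
  refine (integrable_one_add_abs_rpow (r := 2) (by norm_num)).congr (ae_of_all _ fun u ↦ ?_)
  simp only
  rw [Real.rpow_neg (by positivity), Real.rpow_two, inv_pow]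

/-- `u ↦ G(u) φ⁻¹(-u) κ(-u)`, with `κ` the Fourier transform of `k`. -/
def symbolKappa (G φ : ℝ → ℂ) (k : ℝ → ℝ) (u : ℝ) : ℂ :=
  G u * (φ (-u))⁻¹ * ft (fun x ↦ (k x : ℂ)) (-u)

section

variable {P : Measure ℝ} {φ : ℝ → ℂ} {x₀ Δ : ℝ} {k : ℝ → ℝ} {ε C C₁ C₂ : ℝ} {G a b H : ℝ → ℂ}

open IncrementLaw

lemma rpow_mul_weight_neg (φ : ℝ → ℂ) (ε u : ℝ) :
    (1 + |u|) ^ (1 - ε) * weight φ ε (-u) = ‖(φ (-u))⁻¹‖ := by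
  have hp : 0 < 1 + |u| := by positivity
  rw [weight, abs_neg, ← mul_assoc, ← Real.rpow_add hp]
  simp

lemma norm_inv_neg_le (h : IncrementLaw P φ x₀ Δ k ε C) (u : ℝ) :
    ‖(φ (-u))⁻¹‖ ≤ (1 + |u|) * weight φ ε (-u) := by
  rw [← rpow_mul_weight_neg φ ε u]
  refine mul_le_mul_of_nonneg_right ?_ (weight_nonneg _ _ _)
  calc _ ≤ (1 + |u|) ^ (1 : ℝ) :=
        Real.rpow_le_rpow_of_exponent_le (by linarith [abs_nonneg u]) (by linarith [h.ε_pos])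
    _ = _ := Real.rpow_one _

lemma rpow_mul_norm_inv_neg (φ : ℝ → ℂ) (ε u : ℝ) :
    (1 + |u|) ^ ε * ‖(φ (-u))⁻¹‖ = (1 + |u|) * weight φ ε (-u) := by
  have hp : 0 < 1 + |u| := by positivity
  rw [← rpow_mul_weight_neg φ ε u, ← mul_assoc, ← Real.rpow_add hp]
  simp

lemma memLp_weight_neg (h : IncrementLaw P φ x₀ Δ k ε C) : MemLp (fun u ↦ weight φ ε (-u)) 2 :=
  h.memLp_weight.comp_measurePreserving measurePreserving_neg_real

lemma aestronglyMeasurable_inv_neg (h : IncrementLaw P φ x₀ Δ k ε C) :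
    AEStronglyMeasurable (fun u ↦ (φ (-u))⁻¹) :=
  (h.continuous_inv.comp continuous_neg).aestronglyMeasurable

lemma continuous_ft_neg (h : IncrementLaw P φ x₀ Δ k ε C) :
    Continuous (fun u ↦ ft (fun x ↦ (k x : ℂ)) (-u)) :=
  h.continuous_ft.comp continuous_neg

/-- |φ⁻¹(−u)| is at most 1 + |u| times the bounded weight, and (1 + |u|)a(u) is square integrable.
-/
lemma memLp_a_mul (h : IncrementLaw P φ x₀ Δ k ε C) (hG : FourierSplit G a b C₁) :
    MemLp (fun u ↦ a u * (φ (-u))⁻¹) 2 := by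
  obtain ⟨B, hB⟩ := h.exists_weight_le
  refine MemLp.of_le_mul (c := B) hG.memLp_weight_a (hG.memLp_a.1.mul (aestronglyMeasurable_inv_neg h))
    (ae_of_all _ fun u ↦ ?_)
  rw [norm_mul, Real.norm_of_nonneg (by positivity)]
  calc _ ≤ ‖a u‖ * ((1 + |u|) * weight φ ε (-u)) := by gcongr; exact norm_inv_neg_le h u
    _ ≤ ‖a u‖ * ((1 + |u|) * B) := by gcongr; exact hB _
    _ = _ := by ring

/-- `(1 + |u|)^ε a(u) φ⁻¹(-u)` is integrable. -/
lemma integrable_rpow_mul_a (h : IncrementLaw P φ x₀ Δ k ε C) (hG : FourierSplit G a b C₁) :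
    Integrable (fun u ↦ (1 + |u|) ^ ε * (‖a u‖ * ‖(φ (-u))⁻¹‖)) := by
  have := MemLp.integrable_mul hG.memLp_weight_a (memLp_weight_neg h)
  refine this.congr (ae_of_all _ fun u ↦ ?_)
  have e := rpow_mul_norm_inv_neg φ ε u
  simp only [Pi.mul_apply]
  linear_combination -‖a u‖ * e

lemma one_le_rpow (h : IncrementLaw P φ x₀ Δ k ε C) (u : ℝ) : 1 ≤ (1 + |u|) ^ ε :=
  Real.one_le_rpow (by linarith [abs_nonneg u]) h.ε_pos.le

lemma FourierSplit.nonneg (hG : FourierSplit G a b C₁) : 0 ≤ C₁ := by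
  have := (norm_nonneg _).trans (hG.norm_b_le 0)
  simpa using this

/-- The decay of b turns (1 + |u|)^ε |φ⁻¹(−u)| into exactly the L² weight of condition (c); the
power (1 + |u|)^ε is reserved for the smoothing error. -/
lemma rpow_mul_norm_b_le (hG : FourierSplit G a b C₁) (u : ℝ) :
    (1 + |u|) ^ ε * (‖b u‖ * ‖(φ (-u))⁻¹‖) ≤ C₁ * weight φ ε (-u) := by
  have hp : 0 < 1 + |u| := by positivity
  have e := rpow_mul_norm_inv_neg φ ε u
  calc _ = ‖b u‖ * ((1 + |u|) ^ ε * ‖(φ (-u))⁻¹‖) := by ring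
    _ ≤ (C₁ * (1 + |u|)⁻¹) * ((1 + |u|) ^ ε * ‖(φ (-u))⁻¹‖) := by
        gcongr; exact hG.norm_b_le u
    _ = _ := by rw [e]; field_simp

lemma memLp_b_mul (h : IncrementLaw P φ x₀ Δ k ε C) (hG : FourierSplit G a b C₁) :
    MemLp (fun u ↦ b u * (φ (-u))⁻¹) 2 := by
  refine MemLp.of_le_mul (c := C₁) (memLp_weight_neg h)
    (hG.continuous_b.aestronglyMeasurable.mul (aestronglyMeasurable_inv_neg h))
    (ae_of_all _ fun u ↦ ?_)
  rw [norm_mul, Real.norm_of_nonneg (weight_nonneg _ _ _)]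
  refine le_trans ?_ (rpow_mul_norm_b_le hG u)
  exact le_mul_of_one_le_left (by positivity) (one_le_rpow h u)

lemma FourierSplit.ae_mul_eq (hG : FourierSplit G a b C₁) (φ : ℝ → ℂ) :
    (fun u ↦ G u * (φ (-u))⁻¹) =ᵐ[volume] fun u ↦ a u * (φ (-u))⁻¹ + b u * (φ (-u))⁻¹ := by
  filter_upwards [hG.ae_eq] with u hu
  rw [hu, add_mul]

lemma memLp_symbol (h : IncrementLaw P φ x₀ Δ k ε C) (hG : FourierSplit G a b C₁) :
    MemLp (fun u ↦ G u * (φ (-u))⁻¹) 2 :=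
  (memLp_congr_ae (hG.ae_mul_eq φ)).2 ((memLp_a_mul h hG).add (memLp_b_mul h hG))

lemma memLp_symbolKappa (h : IncrementLaw P φ x₀ Δ k ε C) (hG : FourierSplit G a b C₁) :
    MemLp (symbolKappa G φ k) 2 := by
  refine MemLp.of_le_mul (c := C) (memLp_symbol h hG)
    ((memLp_symbol h hG).1.mul (continuous_ft_neg h).aestronglyMeasurable) (ae_of_all _ fun u ↦ ?_)
  rw [symbolKappa, norm_mul, mul_comm]
  gcongr
  exact h.norm_ft_le' _

/-- The decay of κ supplies a further (1 + |u|)⁻¹, so the part from b is a product of two L²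
functions, and the part from a is integrable already. Hence the inverse transform is a continuous
function with a definite value at an atom of `P`. -/
lemma integrable_rpow_mul_symbolKappa (h : IncrementLaw P φ x₀ Δ k ε C) (hG : FourierSplit G a b C₁) :
    Integrable (fun u ↦ (1 + |u|) ^ ε * ‖symbolKappa G φ k u‖) := by
  have h1 := (integrable_rpow_mul_a h hG).const_mul C
  have h2 := (MemLp.integrable_mul memLp_one_add_abs_inv (memLp_weight_neg h)).const_mul (C * C₁)
  refine (h1.add h2).mono' ?_ ?_
  · refine AEStronglyMeasurable.mul ?_ (memLp_symbolKappa h hG).1.norm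
    exact (Continuous.rpow_const (by fun_prop) fun u ↦ Or.inl (by positivity)).aestronglyMeasurable
  · filter_upwards [hG.ae_eq] with u hu
    rw [Real.norm_of_nonneg (by positivity), symbolKappa, norm_mul, norm_mul, hu]
    have hκ := h.norm_ft_le' (-u)
    have hκ' := h.decay (-u)
    rw [abs_neg] at hκ'
    have hC := h.C_nonneg
    have hb := rpow_mul_norm_b_le (φ := φ) (ε := ε) hG u
    set κ := ‖ft (fun x ↦ (k x : ℂ)) (-u)‖
    set q := ‖(φ (-u))⁻¹‖
    have hκ0 : 0 ≤ κ := norm_nonneg _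
    have hq0 : 0 ≤ q := norm_nonneg _
    have hr : 0 ≤ (1 + |u|) ^ ε := by positivity
    calc (1 + |u|) ^ ε * (‖a u + b u‖ * q * κ)
        ≤ (1 + |u|) ^ ε * ((‖a u‖ + ‖b u‖) * q * κ) := by gcongr; exact norm_add_le _ _
      _ = κ * ((1 + |u|) ^ ε * (‖a u‖ * q)) + κ * ((1 + |u|) ^ ε * (‖b u‖ * q)) := by ring
      _ ≤ C * ((1 + |u|) ^ ε * (‖a u‖ * q)) + (C * (1 + |u|)⁻¹) * (C₁ * weight φ ε (-u)) := by
          gcongr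
      _ = _ := by simp only [Pi.add_apply, Pi.mul_apply]; ring

lemma integrable_symbolKappa (h : IncrementLaw P φ x₀ Δ k ε C) (hG : FourierSplit G a b C₁) :
    Integrable (symbolKappa G φ k) := by
  refine (integrable_rpow_mul_symbolKappa h hG).mono' (memLp_symbolKappa h hG).1
    (ae_of_all _ fun u ↦ ?_)
  exact le_mul_of_one_le_left (by positivity) (one_le_rpow h u)

/-! ### The smoothed influence function -/

/-- The cut-off is bounded with support in [−1/h, 1/h] and therefore in L². -/
lemma KernelTransform.integrable_mul (hH : KernelTransform H C₂) {h : ℝ} (hh : 0 < h) {f : ℝ → ℂ}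
    (hf : MemLp f 2) : Integrable (fun u ↦ f u * H (h * -u)) := by
  have hm : MemLp (fun u ↦ H (h * -u)) 2 := by
    refine MemLp.of_le_mul (c := C₂) (g := (Set.Icc (-h⁻¹) h⁻¹).indicator fun _ ↦ (1 : ℝ))
      (memLp_indicator_const 2 measurableSet_Icc 1 (Or.inr (by simp)))
      (hH.continuous.comp (by fun_prop)).aestronglyMeasurable (ae_of_all _ fun u ↦ ?_)
    by_cases hu : u ∈ Set.Icc (-h⁻¹) h⁻¹
    · rw [Set.indicator_of_mem hu, norm_one, mul_one]
      exact hH.norm_le _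
    · rw [Set.indicator_of_notMem hu, hH.eq_zero, norm_zero]
      · simp
      · rw [abs_mul, abs_neg, abs_of_pos hh, ← div_lt_iff₀' hh, one_div]
        by_contra hcon
        exact hu (abs_le.1 (not_lt.1 hcon))
  exact MemLp.integrable_mul hf hm

lemma KernelTransform.memLp_mul (hH : KernelTransform H C₂) (h : ℝ) {f : ℝ → ℂ}
    (hf : MemLp f 2) : MemLp (fun u ↦ f u * H (h * -u)) 2 := by
  refine MemLp.of_le_mul (c := C₂) hf
    (hf.1.mul (hH.continuous.comp (by fun_prop)).aestronglyMeasurable) (ae_of_all _ fun u ↦ ?_)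
  rw [norm_mul, mul_comm]
  gcongr
  exact hH.norm_le _

/-- The influence function of the estimator with bandwidth `h`. -/
def smoothInfluence (G φ H : ℝ → ℂ) (k : ℝ → ℝ) (x₀ Δ h x : ℝ) : ℂ :=
  Complex.I * (x - x₀) * invFt (fun u ↦ G u * (φ (-u))⁻¹ * H (h * -u)) x -
    Complex.I * Δ * invFt (fun u ↦ symbolKappa G φ k u * H (h * -u)) x

/-- The limiting influence function. -/
def limitInfluence (G φ : ℝ → ℂ) (k : ℝ → ℝ) (x₀ Δ x : ℝ) : ℂ :=
  Complex.I * (x - x₀) * invFtL2 (fun u ↦ G u * (φ (-u))⁻¹) x -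
    Complex.I * Δ * invFt (symbolKappa G φ k) x

lemma measurable_limitInfluence (h : IncrementLaw P φ x₀ Δ k ε C) (hG : FourierSplit G a b C₁) :
    Measurable (limitInfluence G φ k x₀ Δ) := by
  refine Measurable.sub (Measurable.mul (by fun_prop) (measurable_invFtL2 _)) ?_
  exact ((continuous_invFt (integrable_symbolKappa h hG)).const_mul _).measurable

lemma continuous_smoothInfluence (h : IncrementLaw P φ x₀ Δ k ε C) (hG : FourierSplit G a b C₁)
    (hH : KernelTransform H C₂) {η : ℝ} (hη : 0 < η) :
    Continuous (smoothInfluence G φ H k x₀ Δ η) := by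
  have h1 := continuous_invFt (hH.integrable_mul hη (memLp_symbol h hG))
  have h2 := continuous_invFt (hH.integrable_mul hη (memLp_symbolKappa h hG))
  unfold smoothInfluence
  fun_prop

/-- Since |x − x₀|P is dominated by Lebesgue measure, `P` can charge a Lebesgue-null set only
through the point x₀. -/
lemma ae_of_ae_volume (h : IncrementLaw P φ x₀ Δ k ε C) {p : ℝ → Prop} (hp : ∀ᵐ x, p x) :
    ∀ᵐ x ∂P, x ≠ x₀ → p x := by
  have hac : (P.withDensity fun x ↦ ENNReal.ofReal |x - x₀|) ≪ volume :=
    (Measure.absolutelyContinuous_of_le h.withDensity_le).trans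
      (Measure.AbsolutelyContinuous.smul_left Measure.AbsolutelyContinuous.rfl _)
  have h1 : ∀ᵐ x ∂(P.withDensity fun x ↦ ENNReal.ofReal |x - x₀|), p x := hac.ae_le hp
  rw [ae_withDensity_iff (by fun_prop)] at h1
  filter_upwards [h1] with x hx hne
  refine hx ?_
  simp [sub_eq_zero, hne]

lemma lintegral_abs_sub_mul_le (h : IncrementLaw P φ x₀ Δ k ε C) {f : ℝ → ℝ≥0∞} (hf : Measurable f) :
    ∫⁻ x, ENNReal.ofReal |x - x₀| * f x ∂P ≤ ENNReal.ofReal C * ∫⁻ x, f x := by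
  have h1 := lintegral_withDensity_eq_lintegral_mul P (f := fun x ↦ ENNReal.ofReal |x - x₀|)
    (by fun_prop) hf
  simp only [Pi.mul_apply] at h1
  rw [← h1, ← smul_eq_mul, ← lintegral_smul_measure]
  exact lintegral_mono' h.withDensity_le le_rfl

/-! ### Convergence of the smoothed influence functions -/

/-- The two parts need different control: the symbol from a is integrable, so its transform is
bounded pointwise, while the symbol from b is merely square integrable. -/
lemma ae_invFt_sub_eq (h : IncrementLaw P φ x₀ Δ k ε C) (hG : FourierSplit G a b C₁)
    (hH : KernelTransform H C₂) {η : ℝ} (hη : 0 < η)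
    (ha : Integrable fun u ↦ a u * (φ (-u))⁻¹ * (H (η * -u) - 1)) :
    ∀ᵐ x, invFt (fun u ↦ G u * (φ (-u))⁻¹ * H (η * -u)) x - invFtL2 (fun u ↦ G u * (φ (-u))⁻¹) x =
      invFt (fun u ↦ a u * (φ (-u))⁻¹ * (H (η * -u) - 1)) x +
      invFtL2 (fun u ↦ b u * (φ (-u))⁻¹ * (H (η * -u) - 1)) x := by
  have hm := memLp_symbol h hG
  have e0 : ∀ {f : ℝ → ℂ}, MemLp f 2 → MemLp (fun u ↦ f u * (H (η * -u) - 1)) 2 := fun {f} hf ↦ by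
    refine (memLp_congr_ae (ae_of_all _ fun u ↦ ?_)).1 ((hH.memLp_mul η hf).sub hf)
    simp only [Pi.sub_apply]; ring
  have ea := e0 (memLp_a_mul h hG)
  have eb := e0 (memLp_b_mul h hG)
  have e1 : (fun u ↦ G u * (φ (-u))⁻¹ * H (η * -u) - G u * (φ (-u))⁻¹) =ᵐ[volume] fun u ↦
      a u * (φ (-u))⁻¹ * (H (η * -u) - 1) + b u * (φ (-u))⁻¹ * (H (η * -u) - 1) := by
    filter_upwards [hG.ae_eq] with u hu
    rw [hu]; ring
  have e2 := invFtL2_congr e1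
  filter_upwards [invFtL2_eq_invFt (hH.integrable_mul hη hm) (hH.memLp_mul η hm),
    invFtL2_sub (hH.memLp_mul η hm) hm, invFtL2_add ea eb, invFtL2_eq_invFt ha ea] with x h1 h2 h3 h4
  rw [← h1, ← h2, e2, h3, h4]

lemma norm_invFt_mul_sub_one_le (hH : KernelTransform H C₂) {η : ℝ} (hη : 0 < η) (hε : 0 < ε)
    (hε1 : ε ≤ 1) {f : ℝ → ℂ} (hf : Integrable fun u ↦ (1 + |u|) ^ ε * ‖f u‖) (x : ℝ) :
    ‖invFt (fun u ↦ f u * (H (η * -u) - 1)) x‖ ≤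
      (2 * C₂ * ∫ u, (1 + |u|) ^ ε * ‖f u‖) * η ^ ε := by
  refine (norm_invFt_le _ _).trans ?_
  have e : (2 * C₂ * ∫ u, (1 + |u|) ^ ε * ‖f u‖) * η ^ ε =
      ∫ u, 2 * C₂ * η ^ ε * ((1 + |u|) ^ ε * ‖f u‖) := by
    rw [integral_const_mul]; ring
  rw [e]
  refine integral_mono_of_nonneg (ae_of_all _ fun u ↦ norm_nonneg _) (hf.const_mul _)
    (ae_of_all _ fun u ↦ ?_)
  simp only [norm_mul]
  have := hH.norm_sub_one_le_rpow hη hε hε1 (-u)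
  rw [abs_neg] at this
  calc _ ≤ ‖f u‖ * (2 * C₂ * (η ^ ε * (1 + |u|) ^ ε)) := by gcongr
    _ = _ := by ring

lemma integrable_mul_sub_one (hH : KernelTransform H C₂) (hε : 0 < ε) {η : ℝ} (hη : 0 < η)
    (hε1 : ε ≤ 1) {f : ℝ → ℂ} (hfm : AEStronglyMeasurable f)
    (hf : Integrable fun u ↦ (1 + |u|) ^ ε * ‖f u‖) :
    Integrable (fun u ↦ f u * (H (η * -u) - 1)) := by
  refine (hf.const_mul (2 * C₂ * η ^ ε)).mono' (hfm.mul
    ((hH.continuous.comp (by fun_prop)).sub continuous_const).aestronglyMeasurable)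
    (ae_of_all _ fun u ↦ ?_)
  rw [norm_mul]
  have := hH.norm_sub_one_le_rpow hη hε hε1 (-u)
  rw [abs_neg] at this
  calc _ ≤ ‖f u‖ * (2 * C₂ * (η ^ ε * (1 + |u|) ^ ε)) := by gcongr
    _ = _ := by ring

/-- Product rule for increments. Replacing b, φ⁻¹ or H − 1 by its increment costs t and preserves
the order of its bound, so the difference quotient retains both the L² weight and the small factor
η^ε, as `lintegral_sq_id_mul_invFtL2_le` requires. -/
lemma norm_b_mul_sub_le {A : ℝ} (hA : 0 ≤ A) (hε : 0 < ε) (hε1 : ε ≤ 1)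
    (hA1 : ∀ t u : ℝ, 0 ≤ t → t ≤ 1 → ‖(φ u)⁻¹‖ ≤ A * ‖(φ (u + t))⁻¹‖)
    (hA2 : ∀ t u : ℝ, 0 ≤ t → t ≤ 1 → ‖(φ (u + t))⁻¹ - (φ u)⁻¹‖ ≤ t * A * ‖(φ (u + t))⁻¹‖)
    (hG : FourierSplit G a b C₁) (hH : KernelTransform H C₂) {η : ℝ} (hη : 0 < η) (hη1 : η ≤ 1)
    {t : ℝ} (ht : 0 < t) (ht1 : t ≤ 1) (u : ℝ) :
    ‖b (u + t) * (φ (-(u + t)))⁻¹ * (H (η * -(u + t)) - 1) - b u * (φ (-u))⁻¹ * (H (η * -u) - 1)‖ ≤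
      t * (C₁ * C₂ * (8 * A + 1) * η ^ ε * weight φ ε (-u)) := by
  have hp : 0 < 1 + |u| := by positivity
  have hC₁ := hG.nonneg
  have hC₂ := hH.one_le
  have ht' : -(u + t) + t = -u := by ring
  have q1 : ‖(φ (-(u + t)))⁻¹‖ ≤ A * ‖(φ (-u))⁻¹‖ := by
    have := hA1 t (-(u + t)) ht.le ht1
    rwa [ht'] at this
  have q2 : ‖(φ (-u))⁻¹ - (φ (-(u + t)))⁻¹‖ ≤ t * A * ‖(φ (-u))⁻¹‖ := by
    have := hA2 t (-(u + t)) ht.le ht1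
    rwa [ht'] at this
  have r1 : ‖H (η * -(u + t)) - 1‖ ≤ 4 * C₂ * (η ^ ε * (1 + |u|) ^ ε) := by
    refine (hH.norm_sub_one_le_rpow hη hε hε1 _).trans ?_
    rw [abs_neg]
    have h1 : (1 + |u + t|) ^ ε ≤ 2 * (1 + |u|) ^ ε := by
      have h2 : 1 + |u + t| ≤ 2 * (1 + |u|) := by
        have := abs_add_le u t
        rw [abs_of_nonneg ht.le] at this
        linarith [abs_nonneg u]
      calc _ ≤ (2 * (1 + |u|)) ^ ε := Real.rpow_le_rpow (by positivity) h2 hε.le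
        _ = 2 ^ ε * (1 + |u|) ^ ε := Real.mul_rpow (by norm_num) hp.le
        _ ≤ 2 ^ (1 : ℝ) * (1 + |u|) ^ ε := by
            gcongr
            norm_num
        _ = _ := by rw [Real.rpow_one]
    calc _ ≤ 2 * C₂ * (η ^ ε * (2 * (1 + |u|) ^ ε)) := by gcongr
      _ = _ := by ring
  have r2 : ‖(H (η * -(u + t)) - 1) - (H (η * -u) - 1)‖ ≤ t * (C₂ * (η ^ ε * (1 + |u|) ^ ε)) := by
    have e : (H (η * -(u + t)) - 1) - (H (η * -u) - 1) = H (η * -(u + t)) - H (η * -u) := by ring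
    rw [e]
    refine (hH.norm_sub_le _ _).trans ?_
    have e2 : |η * -(u + t) - η * -u| = η * t := by
      have : η * -(u + t) - η * -u = -(η * t) := by ring
      rw [this, abs_neg, abs_of_pos (by positivity)]
    rw [e2]
    have h1 : η ≤ η ^ ε := Real.self_le_rpow_of_le_one hη.le hη1 hε1
    have h2 : 1 ≤ (1 + |u|) ^ ε := Real.one_le_rpow (by linarith [abs_nonneg u]) hε.le
    have h3 : η ≤ η ^ ε * (1 + |u|) ^ ε := by
      calc η ≤ η ^ ε * 1 := by linarith
        _ ≤ _ := by gcongr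
    calc C₂ * (η * t) ≤ C₂ * ((η ^ ε * (1 + |u|) ^ ε) * t) := by gcongr
      _ = _ := by ring
  have b1 := hG.norm_b_sub_le t u ht ht1
  have b2 := hG.norm_b_le u
  have e : b (u + t) * (φ (-(u + t)))⁻¹ * (H (η * -(u + t)) - 1) -
      b u * (φ (-u))⁻¹ * (H (η * -u) - 1) =
      (b (u + t) - b u) * (φ (-(u + t)))⁻¹ * (H (η * -(u + t)) - 1) +
      (-(b u * ((φ (-u))⁻¹ - (φ (-(u + t)))⁻¹) * (H (η * -(u + t)) - 1))) +
      b u * (φ (-u))⁻¹ * ((H (η * -(u + t)) - 1) - (H (η * -u) - 1)) := by ring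
  rw [e]
  refine (norm_add₃_le).trans ?_
  rw [norm_neg, norm_mul, norm_mul, norm_mul, norm_mul, norm_mul, norm_mul]
  have w : (1 + |u|)⁻¹ * ((1 + |u|) ^ ε * ‖(φ (-u))⁻¹‖) = weight φ ε (-u) := by
    rw [rpow_mul_norm_inv_neg]; field_simp
  set q := ‖(φ (-u))⁻¹‖
  have hq0 : 0 ≤ q := norm_nonneg _
  -- The three products contribute 4A, 4A and 1 to the constant 8A + 1.
  calc _ ≤ (t * (C₁ * (1 + |u|)⁻¹)) * (A * q) * (4 * C₂ * (η ^ ε * (1 + |u|) ^ ε)) +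
        (C₁ * (1 + |u|)⁻¹) * (t * A * q) * (4 * C₂ * (η ^ ε * (1 + |u|) ^ ε)) +
        (C₁ * (1 + |u|)⁻¹) * q * (t * (C₂ * (η ^ ε * (1 + |u|) ^ ε))) := by gcongr
    _ = t * (C₁ * C₂ * (8 * A + 1) * η ^ ε * ((1 + |u|)⁻¹ * ((1 + |u|) ^ ε * q))) := by ring
    _ = _ := by rw [w]

end

end

end LevyCLT

namespace LevyCLT

noncomputable section

section

variable {P : Measure ℝ} {φ : ℝ → ℂ} {x₀ Δ : ℝ} {k : ℝ → ℝ} {ε C C₁ C₂ : ℝ} {G a b H : ℝ → ℂ}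

open IncrementLaw

/-! ### Estimates in L²(P). -/

lemma enorm_ofReal_complex (x : ℝ) : ‖(x : ℂ)‖ₑ = ENNReal.ofReal |x| := by
  rw [← ofReal_norm, Complex.norm_real, Real.norm_eq_abs]

lemma enorm_le_ofReal {E : Type*} [NormedAddCommGroup E] {y : E} {c : ℝ} (h : ‖y‖ ≤ c) :
    ‖y‖ₑ ≤ ENNReal.ofReal c := by
  rw [← ofReal_norm]; exact ENNReal.ofReal_le_ofReal h

/-- One of the two factors |x − x₀| dominates `P` by Lebesgue measure; the other is at most (1 +
|x₀|)(1 + x²). The norms of f and of x f(x) that remain are accessible to Plancherel. -/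
lemma lintegral_sq_sub_mul_le (h : IncrementLaw P φ x₀ Δ k ε C) {f : ℝ → ℂ} (hf : Measurable f) :
    ∫⁻ x, ‖((x - x₀ : ℝ) : ℂ) * f x‖ₑ ^ 2 ∂P ≤ ENNReal.ofReal C * (ENNReal.ofReal (1 + |x₀|) *
      ((∫⁻ x, ‖f x‖ₑ ^ 2) + ∫⁻ x : ℝ, ‖(x : ℂ) * f x‖ₑ ^ 2)) := by
  calc ∫⁻ x, ‖((x - x₀ : ℝ) : ℂ) * f x‖ₑ ^ 2 ∂P
      = ∫⁻ x, ENNReal.ofReal |x - x₀| * (ENNReal.ofReal |x - x₀| * ‖f x‖ₑ ^ 2) ∂P := by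
        refine lintegral_congr fun x ↦ ?_
        rw [enorm_mul, enorm_ofReal_complex, mul_pow, sq, mul_assoc]
    _ ≤ ENNReal.ofReal C * ∫⁻ x, ENNReal.ofReal |x - x₀| * ‖f x‖ₑ ^ 2 :=
        lintegral_abs_sub_mul_le h ((by fun_prop : Measurable _).mul (hf.enorm.pow_const 2))
    _ ≤ ENNReal.ofReal C * ∫⁻ x : ℝ, ENNReal.ofReal (1 + |x₀|) * (‖f x‖ₑ ^ 2 + ‖(x : ℂ) * f x‖ₑ ^ 2) := by
        refine mul_le_mul' le_rfl (lintegral_mono fun x ↦ ?_)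
        simp only
        rw [enorm_mul, enorm_ofReal_complex, mul_pow]
        have e : ‖f x‖ₑ ^ 2 + ENNReal.ofReal |x| ^ 2 * ‖f x‖ₑ ^ 2 =
            ENNReal.ofReal (1 + |x| ^ 2) * ‖f x‖ₑ ^ 2 := by
          rw [ENNReal.ofReal_add (by norm_num) (by positivity), ENNReal.ofReal_pow (abs_nonneg _),
            ENNReal.ofReal_one, add_mul, one_mul]
        rw [e, ← mul_assoc, ← ENNReal.ofReal_mul (by positivity)]
        gcongr
        have h1 : |x - x₀| ≤ |x| + |x₀| := abs_sub _ _
        nlinarith [abs_nonneg x, abs_nonneg x₀, sq_nonneg (|x| - 1),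
          mul_nonneg (abs_nonneg x₀) (sq_nonneg |x|)]
    _ = _ := by
        rw [lintegral_const_mul' _ _ (by simp), lintegral_add_left (hf.enorm.pow_const 2)]

lemma memLp_mul_sub_one (hH : KernelTransform H C₂) (η : ℝ) {f : ℝ → ℂ} (hf : MemLp f 2) :
    MemLp (fun u ↦ f u * (H (η * -u) - 1)) 2 := by
  refine (memLp_congr_ae (ae_of_all _ fun u ↦ ?_)).1 ((hH.memLp_mul η hf).sub hf)
  simp only [Pi.sub_apply]; ring

/-- Both Lebesgue norms are estimated on the Fourier side, the one containing x through difference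
quotients of the symbol. Each is O(η^ε) times the L² norm of the weight. -/
lemma exists_lintegral_sq_b_le (h : IncrementLaw P φ x₀ Δ k ε C) (hG : FourierSplit G a b C₁)
    (hH : KernelTransform H C₂) : ∃ A : ℝ≥0∞, A ≠ ∞ ∧ ∀ η : ℝ, 0 < η → η ≤ 1 →
      ∫⁻ x, ‖((x - x₀ : ℝ) : ℂ) * invFtL2 (fun u ↦ b u * (φ (-u))⁻¹ * (H (η * -u) - 1)) x‖ₑ ^ 2 ∂P ≤
        A * ENNReal.ofReal (η ^ ε) ^ 2 := by
  obtain ⟨A, hA, -, hA1, -, hA2⟩ := h.exists_growth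
  let W : ℝ≥0∞ := ∫⁻ u, ENNReal.ofReal (weight φ ε (-u)) ^ 2
  have hW : W ≠ ∞ := by
    have := (memLp_two_iff.1 (memLp_weight_neg h)).2.ne
    have e : W = ∫⁻ u, ‖weight φ ε (-u)‖ₑ ^ 2 := lintegral_congr fun u ↦ by
      rw [← ofReal_norm, Real.norm_of_nonneg (weight_nonneg _ _ _)]
    rw [e]
    exact this
  have hC₁ := hG.nonneg
  have hC₂ := hH.one_le
  have hε1 : ε ≤ 1 := by linarith [h.ε_le]
  let c₁ : ℝ := 2 * C₂ * C₁
  let c₂ : ℝ := C₁ * C₂ * (8 * A + 1)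
  have scale : ∀ (c η : ℝ), 0 ≤ c → 0 < η →
      ∫⁻ u, ENNReal.ofReal (c * η ^ ε * weight φ ε (-u)) ^ 2 =
      ENNReal.ofReal c ^ 2 * W * ENNReal.ofReal (η ^ ε) ^ 2 := fun c η hc hη ↦ by
    have : ∀ u, ENNReal.ofReal (c * η ^ ε * weight φ ε (-u)) ^ 2 =
        (ENNReal.ofReal c ^ 2 * ENNReal.ofReal (η ^ ε) ^ 2) * ENNReal.ofReal (weight φ ε (-u)) ^ 2 :=
      fun u ↦ by
        rw [ENNReal.ofReal_mul (by positivity), ENNReal.ofReal_mul hc, mul_pow, mul_pow]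
    simp_rw [this]
    rw [lintegral_const_mul' _ _ (by finiteness)]
    simp only [W]
    ring
  refine ⟨ENNReal.ofReal C * (ENNReal.ofReal (1 + |x₀|) *
    (ENNReal.ofReal c₁ ^ 2 * W + ENNReal.ofReal c₂ ^ 2 * W)), by finiteness, fun η hη hη1 ↦ ?_⟩
  have hM := memLp_mul_sub_one hH η (memLp_b_mul h hG)
  refine (lintegral_sq_sub_mul_le h (measurable_invFtL2 _)).trans ?_
  have h1 : ∫⁻ x, ‖invFtL2 (fun u ↦ b u * (φ (-u))⁻¹ * (H (η * -u) - 1)) x‖ₑ ^ 2 ≤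
      ENNReal.ofReal c₁ ^ 2 * W * ENNReal.ofReal (η ^ ε) ^ 2 := by
    rw [← scale c₁ η (by positivity) hη]
    refine (lintegral_sq_invFtL2_le hM).trans (lintegral_mono fun u ↦ ?_)
    refine pow_le_pow_left' (enorm_le_ofReal ?_) 2
    rw [norm_mul, norm_mul]
    have e1 := hH.norm_sub_one_le_rpow hη h.ε_pos hε1 (-u)
    rw [abs_neg] at e1
    have e2 := rpow_mul_norm_b_le (φ := φ) (ε := ε) hG u
    calc _ ≤ ‖b u‖ * ‖(φ (-u))⁻¹‖ * (2 * C₂ * (η ^ ε * (1 + |u|) ^ ε)) := by gcongr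
      _ = 2 * C₂ * η ^ ε * ((1 + |u|) ^ ε * (‖b u‖ * ‖(φ (-u))⁻¹‖)) := by ring
      _ ≤ 2 * C₂ * η ^ ε * (C₁ * weight φ ε (-u)) := by gcongr
      _ = _ := by simp only [c₁]; ring
  have h2 : ∫⁻ x : ℝ, ‖(x : ℂ) * invFtL2 (fun u ↦ b u * (φ (-u))⁻¹ * (H (η * -u) - 1)) x‖ₑ ^ 2 ≤
      ENNReal.ofReal c₂ ^ 2 * W * ENNReal.ofReal (η ^ ε) ^ 2 := by
    rw [← scale c₂ η (by positivity) hη]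
    exact lintegral_sq_id_mul_invFtL2_le hM fun t ht ht1 ↦ ae_of_all _ fun u ↦
      norm_b_mul_sub_le (by linarith) h.ε_pos hε1 hA1 hA2 hG hH hη hη1 ht ht1 u
  calc _ ≤ ENNReal.ofReal C * (ENNReal.ofReal (1 + |x₀|) *
        (ENNReal.ofReal c₁ ^ 2 * W * ENNReal.ofReal (η ^ ε) ^ 2 +
        ENNReal.ofReal c₂ ^ 2 * W * ENNReal.ofReal (η ^ ε) ^ 2)) := by gcongr
    _ = _ := by ring

lemma lintegral_sq_sub_lt_top (h : IncrementLaw P φ x₀ Δ k ε C) :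
    ∫⁻ x, ‖((x - x₀ : ℝ) : ℂ)‖ₑ ^ 2 ∂P < ∞ := by
  have := h.prob
  have h1 : MemLp (fun x : ℝ ↦ ((x - x₀ : ℝ) : ℂ)) 2 P :=
    (h.memLp_id.sub (memLp_const x₀)).ofReal
  exact (memLp_two_iff.1 h1).2

/-- The smoothed influence functions converge in `L²(P)`. -/
lemma exists_lintegral_sq_smoothInfluence_sub_le (h : IncrementLaw P φ x₀ Δ k ε C)
    (hG : FourierSplit G a b C₁) (hH : KernelTransform H C₂) :
    ∃ A : ℝ≥0∞, A ≠ ∞ ∧ ∀ η : ℝ, 0 < η → η ≤ 1 →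
      ∫⁻ x, ‖smoothInfluence G φ H k x₀ Δ η x - limitInfluence G φ k x₀ Δ x‖ₑ ^ 2 ∂P ≤
        A * ENNReal.ofReal (η ^ ε) ^ 2 := by
  have := h.prob
  obtain ⟨A, hA, hAb⟩ := exists_lintegral_sq_b_le h hG hH
  have hε1 : ε ≤ 1 := by linarith [h.ε_le]
  have ia : Integrable fun u ↦ (1 + |u|) ^ ε * ‖a u * (φ (-u))⁻¹‖ := by
    simpa only [norm_mul] using integrable_rpow_mul_a h hG
  have ik := integrable_rpow_mul_symbolKappa h hG
  let A₁ : ℝ := 2 * C₂ * ∫ u, (1 + |u|) ^ ε * ‖a u * (φ (-u))⁻¹‖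
  let A₃ : ℝ := 2 * C₂ * ∫ u, (1 + |u|) ^ ε * ‖symbolKappa G φ k u‖
  have hC₂ := hH.one_le
  have hA₁ : 0 ≤ A₁ := mul_nonneg (by linarith) (integral_nonneg fun u ↦ by positivity)
  have hA₃ : 0 ≤ A₃ := mul_nonneg (by linarith) (integral_nonneg fun u ↦ by positivity)
  let S : ℝ≥0∞ := ∫⁻ x, ‖((x - x₀ : ℝ) : ℂ)‖ₑ ^ 2 ∂P
  have hS : S ≠ ∞ := (lintegral_sq_sub_lt_top h).ne
  refine ⟨2 * (2 * (ENNReal.ofReal A₁ ^ 2 * S) + 2 * A) + 2 * ENNReal.ofReal (Δ * A₃) ^ 2,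
    by finiteness, fun η hη hη1 ↦ ?_⟩
  -- E₁ and E₃ are uniformly O(η^ε), their symbols being integrable against (1 + |u|)^ε. E₂ is small
  -- only in the mean square norm of `exists_lintegral_sq_b_le`.
  let E₁ : ℝ → ℂ := invFt (fun u ↦ a u * (φ (-u))⁻¹ * (H (η * -u) - 1))
  let E₂ : ℝ → ℂ := invFtL2 (fun u ↦ b u * (φ (-u))⁻¹ * (H (η * -u) - 1))
  let E₃ : ℝ → ℂ := invFt (fun u ↦ symbolKappa G φ k u * (H (η * -u) - 1))
  have ia' := integrable_mul_sub_one hH h.ε_pos hη hε1 (memLp_a_mul h hG).1 ia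
  have ik' := integrable_mul_sub_one hH h.ε_pos hη hε1 (memLp_symbolKappa h hG).1 ik
  have hE₁ : ∀ x, ‖E₁ x‖ ≤ A₁ * η ^ ε := norm_invFt_mul_sub_one_le hH hη h.ε_pos hε1 ia
  have hE₃ : ∀ x, ‖E₃ x‖ ≤ A₃ * η ^ ε := norm_invFt_mul_sub_one_le hH hη h.ε_pos hε1 ik
  have hE₃' : ∀ x, invFt (fun u ↦ symbolKappa G φ k u * H (η * -u)) x -
      invFt (symbolKappa G φ k) x = E₃ x := fun x ↦ by
    rw [← invFt_sub (hH.integrable_mul hη (memLp_symbolKappa h hG)) (integrable_symbolKappa h hG)]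
    refine invFt_congr (ae_of_all _ fun u ↦ ?_) x
    ring
  have hmE₁ : Measurable E₁ := (continuous_invFt ia').measurable
  have hmE₂ : Measurable E₂ := measurable_invFtL2 _
  have e : ∀ᵐ x ∂P, smoothInfluence G φ H k x₀ Δ η x - limitInfluence G φ k x₀ Δ x =
      Complex.I * (((x - x₀ : ℝ) : ℂ) * E₁ x + ((x - x₀ : ℝ) : ℂ) * E₂ x) +
      -(Complex.I * Δ * E₃ x) := by
    filter_upwards [ae_of_ae_volume h (ae_invFt_sub_eq h hG hH hη ia')] with x hx
    rw [smoothInfluence, limitInfluence, ← hE₃' x]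
    -- At the possible atom the factor x − x₀ removes the undetermined value of the Plancherel
    -- transform.
    by_cases hne : x = x₀
    · simp [hne]; ring
    · have := hx hne
      change _ = E₁ x + E₂ x at this
      push_cast
      linear_combination (Complex.I * (x - x₀)) * this
  calc _ = ∫⁻ x, ‖Complex.I * (((x - x₀ : ℝ) : ℂ) * E₁ x + ((x - x₀ : ℝ) : ℂ) * E₂ x) +
        -(Complex.I * Δ * E₃ x)‖ₑ ^ 2 ∂P := by
        refine lintegral_congr_ae ?_
        filter_upwards [e] with x hx
        rw [hx]
    _ ≤ 2 * ∫⁻ x, ‖Complex.I * (((x - x₀ : ℝ) : ℂ) * E₁ x + ((x - x₀ : ℝ) : ℂ) * E₂ x)‖ₑ ^ 2 ∂P +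
        2 * ∫⁻ x, ‖-(Complex.I * Δ * E₃ x)‖ₑ ^ 2 ∂P := by
        refine lintegral_sq_add_le _ _ (Measurable.aestronglyMeasurable ?_)
        fun_prop
    _ = 2 * ∫⁻ x, ‖((x - x₀ : ℝ) : ℂ) * E₁ x + ((x - x₀ : ℝ) : ℂ) * E₂ x‖ₑ ^ 2 ∂P +
        2 * ∫⁻ x, ‖-(Complex.I * Δ * E₃ x)‖ₑ ^ 2 ∂P := by
        congr 2
        refine lintegral_congr fun x ↦ ?_
        rw [enorm_mul, ← ofReal_norm Complex.I]
        simp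
    _ ≤ 2 * (2 * ∫⁻ x, ‖((x - x₀ : ℝ) : ℂ) * E₁ x‖ₑ ^ 2 ∂P +
        2 * ∫⁻ x, ‖((x - x₀ : ℝ) : ℂ) * E₂ x‖ₑ ^ 2 ∂P) +
        2 * ∫⁻ x, ‖-(Complex.I * Δ * E₃ x)‖ₑ ^ 2 ∂P := by
        gcongr
        refine lintegral_sq_add_le _ _ (Measurable.aestronglyMeasurable ?_)
        fun_prop
    _ ≤ 2 * (2 * (ENNReal.ofReal (A₁ * η ^ ε) ^ 2 * S) + 2 * (A * ENNReal.ofReal (η ^ ε) ^ 2)) +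
        2 * ENNReal.ofReal (Δ * A₃ * η ^ ε) ^ 2 := by
        gcongr
        · rw [← lintegral_const_mul' _ _ (by finiteness)]
          refine lintegral_mono fun x ↦ ?_
          simp only
          rw [enorm_mul, mul_pow, mul_comm]
          gcongr
          exact enorm_le_ofReal (hE₁ x)
        · exact hAb η hη hη1
        · calc _ ≤ ∫⁻ x, ENNReal.ofReal (Δ * A₃ * η ^ ε) ^ 2 ∂P := by
                gcongr with x
                refine enorm_le_ofReal ?_
                rw [norm_neg, norm_mul, norm_mul, Complex.norm_I, one_mul, Complex.norm_real,
                  Real.norm_of_nonneg h.Δ_pos.le, mul_assoc]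
                exact mul_le_mul_of_nonneg_left (hE₃ x) h.Δ_pos.le
            _ = _ := by simp
    _ = _ := by
        have := h.Δ_pos
        rw [ENNReal.ofReal_mul hA₁, ENNReal.ofReal_mul (by positivity : 0 ≤ Δ * A₃)]
        ring

lemma memLp_smoothInfluence (h : IncrementLaw P φ x₀ Δ k ε C)
    (hG : FourierSplit G a b C₁) (hH : KernelTransform H C₂) {η : ℝ} (hη : 0 < η) :
    MemLp (smoothInfluence G φ H k x₀ Δ η) 2 P := by
  have := h.prob
  have h1 : MemLp (fun x : ℝ ↦ ((x - x₀ : ℝ) : ℂ) *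
      invFt (fun u ↦ G u * (φ (-u))⁻¹ * H (η * -u)) x) 2 P := by
    have hx : MemLp (fun x : ℝ ↦ ((x - x₀ : ℝ) : ℂ)) 2 P := (h.memLp_id.sub (memLp_const x₀)).ofReal
    refine MemLp.of_le_mul (c := ∫ u, ‖G u * (φ (-u))⁻¹ * H (η * -u)‖) hx (hx.1.mul
      (continuous_invFt (hH.integrable_mul hη (memLp_symbol h hG))).aestronglyMeasurable)
      (ae_of_all _ fun x ↦ ?_)
    rw [norm_mul, mul_comm]
    gcongr
    exact norm_invFt_le _ _
  have h2 : MemLp (fun x : ℝ ↦ invFt (fun u ↦ symbolKappa G φ k u * H (η * -u)) x) 2 P :=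
    MemLp.of_bound (continuous_invFt (hH.integrable_mul hη (memLp_symbolKappa h
      hG))).aestronglyMeasurable _ (ae_of_all _ fun x ↦ norm_invFt_le _ _)
  refine (memLp_congr_ae (ae_of_all _ fun x ↦ ?_)).1
    ((h1.const_mul Complex.I).sub (h2.const_mul (Complex.I * Δ)))
  simp only [Pi.sub_apply, smoothInfluence]
  push_cast; ring

/-- The smoothed function with bandwidth 1 is in L²(P), its symbols being integrable, and the limit
is at finite distance from it. -/
lemma memLp_limitInfluence (h : IncrementLaw P φ x₀ Δ k ε C)
    (hG : FourierSplit G a b C₁) (hH : KernelTransform H C₂) :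
    MemLp (limitInfluence G φ k x₀ Δ) 2 P := by
  obtain ⟨A, hA, hle⟩ := exists_lintegral_sq_smoothInfluence_sub_le h hG hH
  have h1 := memLp_smoothInfluence h hG hH (η := 1) one_pos
  have h2 : MemLp (fun x ↦ smoothInfluence G φ H k x₀ Δ 1 x - limitInfluence G φ k x₀ Δ x) 2 P := by
    rw [memLp_two_iff]
    refine ⟨h1.1.sub (measurable_limitInfluence h hG).aestronglyMeasurable, ?_⟩
    exact (hle 1 one_pos le_rfl).trans_lt (by finiteness)
  refine (memLp_congr_ae (ae_of_all _ fun x ↦ ?_)).1 (h1.sub h2)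
  simp

/-! ### Centring and reality -/

/-- The integral equals φ'(−u) − i(x₀ + Δκ(−u))φ(−u), which vanishes by the differential equation
for φ. This is what centres the influence functions. -/
lemma charFun_neg_mul_integral (h : IncrementLaw P φ x₀ Δ k ε C) (u : ℝ) :
    ∫ x : ℝ, Complex.exp (-(Complex.I * u * x)) *
      (Complex.I * (x - x₀) - Complex.I * Δ * ft (fun x ↦ (k x : ℂ)) (-u)) ∂P = 0 := by
  have := h.prob
  have hP1 : Integrable (fun x : ℝ ↦ x) P := h.memLp_id.integrable (by norm_num)
  have h1 := (hasDerivAt_charFun hP1 (-u)).unique (h.charFun_eq ▸ h.hasDerivAt (-u))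
  rw [charFun_eq_integral] at h1
  have i1 : Integrable (fun x : ℝ ↦ Complex.exp (Complex.I * (-u : ℝ) * x)) P :=
    (integrable_const (1 : ℝ)).mono' (by fun_prop : Continuous _).aestronglyMeasurable
      (ae_of_all _ fun x ↦ (norm_exp_I_mul (-u) x).le)
  have i2 := (integrable_exp_I_mul_id hP1 (-u)).const_mul Complex.I
  have i3 := i1.const_mul (Complex.I * (x₀ + Δ * ft (fun x ↦ (k x : ℂ)) (-u)))
  have e : ∀ x : ℝ, Complex.exp (-(Complex.I * u * x)) *
      (Complex.I * (x - x₀) - Complex.I * Δ * ft (fun x ↦ (k x : ℂ)) (-u)) =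
      Complex.I * (Complex.exp (Complex.I * (-u : ℝ) * x) * x) -
      (Complex.I * (x₀ + Δ * ft (fun x ↦ (k x : ℂ)) (-u))) *
        Complex.exp (Complex.I * (-u : ℝ) * x) := fun x ↦ by
    have : -(Complex.I * u * x) = Complex.I * (-u : ℝ) * x := by push_cast; ring
    rw [this]; ring
  simp_rw [e]
  rw [integral_sub i2 i3, integral_const_mul, integral_const_mul, h1]
  ring

lemma smoothInfluence_eq_integral (h : IncrementLaw P φ x₀ Δ k ε C)
    (hG : FourierSplit G a b C₁) (hH : KernelTransform H C₂) {η : ℝ} (hη : 0 < η) (x : ℝ) :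
    smoothInfluence G φ H k x₀ Δ η x = (2 * (Real.pi : ℂ))⁻¹ * ∫ u : ℝ,
      G u * (φ (-u))⁻¹ * H (η * -u) * (Complex.exp (-(Complex.I * u * x)) *
      (Complex.I * (x - x₀) - Complex.I * Δ * ft (fun x ↦ (k x : ℂ)) (-u))) := by
  have i1 := (integrable_exp_neg_mul (hH.integrable_mul hη (memLp_symbol h hG)) x).const_mul
    (Complex.I * (x - x₀))
  have i2 := (integrable_exp_neg_mul (hH.integrable_mul hη (memLp_symbolKappa h hG)) x).const_mul
    (Complex.I * Δ)
  rw [smoothInfluence, invFt, invFt, mul_left_comm, mul_left_comm (Complex.I * (Δ : ℂ)), ← mul_sub,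
    ← integral_const_mul, ← integral_const_mul, ← integral_sub i1 i2]
  congr 1
  refine integral_congr_ae (ae_of_all _ fun u ↦ ?_)
  simp only [symbolKappa]
  ring

/-- The cut-off makes Fubini applicable, and the integral over `P` is zero at each frequency. -/
lemma integral_smoothInfluence (h : IncrementLaw P φ x₀ Δ k ε C)
    (hG : FourierSplit G a b C₁) (hH : KernelTransform H C₂) {η : ℝ} (hη : 0 < η) :
    ∫ x, smoothInfluence G φ H k x₀ Δ η x ∂P = 0 := by
  have := h.prob
  simp_rw [smoothInfluence_eq_integral h hG hH hη]
  have hP1 : Integrable (fun x : ℝ ↦ x) P := h.memLp_id.integrable (by norm_num)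
  have hN := hH.integrable_mul hη (memLp_symbol h hG)
  have hB : Integrable (fun x : ℝ ↦ |x| + |x₀| + Δ * C) P :=
    (hP1.abs.add (integrable_const _)).add (integrable_const _)
  have hint : Integrable (Function.uncurry fun (x u : ℝ) ↦
      G u * (φ (-u))⁻¹ * H (η * -u) * (Complex.exp (-(Complex.I * u * x)) *
      (Complex.I * (x - x₀) - Complex.I * Δ * ft (fun x ↦ (k x : ℂ)) (-u)))) (P.prod volume) := by
    refine (hB.mul_prod hN.norm).mono' ?_ (ae_of_all _ fun p ↦ ?_)
    · refine AEStronglyMeasurable.mul hN.1.comp_snd ?_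
      have hc : Continuous fun p : ℝ × ℝ ↦ ft (fun x ↦ (k x : ℂ)) (-p.2) :=
        (continuous_ft_neg h).comp continuous_snd
      exact (by fun_prop : Continuous fun p : ℝ × ℝ ↦ Complex.exp (-(Complex.I * p.2 * p.1)) *
        (Complex.I * (p.1 - x₀) - Complex.I * Δ * ft (fun x ↦ (k x : ℂ)) (-p.2))).aestronglyMeasurable
    · simp only [Function.uncurry]
      rw [norm_mul, mul_comm, norm_mul (Complex.exp _), norm_exp_neg_I_mul, one_mul]
      gcongr
      rw [mul_assoc, ← mul_sub, norm_mul, Complex.norm_I, one_mul]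
      refine (norm_sub_le _ _).trans ?_
      rw [← Complex.ofReal_sub, Complex.norm_real, norm_mul, Complex.norm_real,
        Real.norm_of_nonneg h.Δ_pos.le, Real.norm_eq_abs]
      have h1 := abs_sub p.1 x₀
      have h2 := h.norm_ft_le' (-p.2)
      have h3 := mul_le_mul_of_nonneg_left h2 h.Δ_pos.le
      linarith
  rw [integral_const_mul, integral_integral_swap hint]
  simp_rw [integral_const_mul, charFun_neg_mul_integral h]
  simp

/-- Conjugating the integral amounts to substituting −u for u. -/
lemma invFt_im_eq_zero {N : ℝ → ℂ} (hN : ∀ᵐ u, N (-u) = starRingEnd ℂ (N u)) (x : ℝ) :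
    (invFt N x).im = 0 := by
  rw [← Complex.conj_eq_iff_im, invFt, map_mul, ← integral_conj]
  congr 1
  · simp [map_ofNat]
  · rw [← integral_neg_eq_self]
    refine integral_congr_ae ?_
    have h2 : ∀ᵐ u, N (-(-u)) = starRingEnd ℂ (N (-u)) :=
      measurePreserving_neg_real.quasiMeasurePreserving.ae hN
    filter_upwards [h2] with u hu
    rw [map_mul, ← hu, neg_neg, ← Complex.exp_conj]
    congr 2
    simp

lemma ft_neg_of_real (f : ℝ → ℝ) (u : ℝ) :
    ft (fun x ↦ (f x : ℂ)) (-u) = starRingEnd ℂ (ft (fun x ↦ (f x : ℂ)) u) := by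
  rw [ft, ft, ← integral_conj]
  refine integral_congr_ae (ae_of_all _ fun x ↦ ?_)
  simp only
  rw [map_mul, ← Complex.exp_conj]
  simp

lemma IncrementLaw.apply_neg (h : IncrementLaw P φ x₀ Δ k ε C) (u : ℝ) :
    φ (-u) = starRingEnd ℂ (φ u) := by
  rw [h.charFun_eq, charFun_neg]

lemma smoothInfluence_re (h : IncrementLaw P φ x₀ Δ k ε C)
    (hGc : ∀ᵐ u, G (-u) = starRingEnd ℂ (G u)) (hHc : ∀ u, H (-u) = starRingEnd ℂ (H u))
    (η x : ℝ) : (smoothInfluence G φ H k x₀ Δ η x).re = 0 := by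
  have hHc' : ∀ u, H (η * - -u) = starRingEnd ℂ (H (η * -u)) := fun u ↦ by
    rw [← hHc]; congr 1; ring
  have h1 := invFt_im_eq_zero (N := fun u ↦ G u * (φ (-u))⁻¹ * H (η * -u)) (by
    filter_upwards [hGc] with u hu
    rw [map_mul, map_mul, map_inv₀, ← hu, h.apply_neg (-u), hHc']) x
  have h2 := invFt_im_eq_zero (N := fun u ↦ symbolKappa G φ k u * H (η * -u)) (by
    filter_upwards [hGc] with u hu
    rw [symbolKappa, symbolKappa, map_mul, map_mul, map_mul, map_inv₀, ← hu, h.apply_neg (-u), hHc',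
      ft_neg_of_real k (-u)]) x
  have e1 : ((x : ℂ) - x₀) = ((x - x₀ : ℝ) : ℂ) := by push_cast; rfl
  rw [smoothInfluence, e1, mul_assoc, mul_assoc, Complex.sub_re, Complex.I_mul_re, Complex.I_mul_re,
    Complex.im_ofReal_mul, Complex.im_ofReal_mul, h1, h2]
  simp

/-- The Fourier-Plancherel transform of a real function is Hermitian. -/
lemma ftL2_neg_of_real {f : ℝ → ℝ} (hf : MemLp (fun x ↦ (f x : ℂ)) 2) :
    ∀ᵐ u, ftL2 (fun x ↦ (f x : ℂ)) (-u) = starRingEnd ℂ (ftL2 (fun x ↦ (f x : ℂ)) u) := by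
  obtain ⟨F, hF1, hF2, hF⟩ := exists_approx_memLp_two hf
  -- Since f is real, taking real parts of the approximants preserves convergence, and their
  -- integral transforms are Hermitian at every point.
  let R : ℕ → ℝ → ℂ := fun n x ↦ ((F n x).re : ℂ)
  have hR1 : ∀ n, Integrable (R n) := fun n ↦ (hF1 n).re.ofReal
  have hR2 : ∀ n, MemLp (R n) 2 := fun n ↦ (hF2 n).re.ofReal
  have hR : Tendsto (fun n ↦ ∫⁻ x, ‖R n x - (f x : ℂ)‖ₑ ^ 2) atTop (𝓝 0) := by
    refine tendsto_of_tendsto_of_tendsto_of_le_of_le tendsto_const_nhds hF (fun n ↦ zero_le)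
      fun n ↦ lintegral_mono fun x ↦ ?_
    refine pow_le_pow_left' ?_ 2
    rw [← ofReal_norm, ← ofReal_norm]
    refine ENNReal.ofReal_le_ofReal ?_
    have : R n x - (f x : ℂ) = ((F n x - (f x : ℂ)).re : ℂ) := by simp [R]
    rw [this, Complex.norm_real, Real.norm_eq_abs]
    exact Complex.abs_re_le_norm _
  have l1 := tendsto_ftL2_of_tendsto hf hR2 hR
  have l2 := tendsto_comp_neg l1
  have hz : ∫⁻ u, ‖ftL2 (fun x ↦ (f x : ℂ)) (-u) -
      starRingEnd ℂ (ftL2 (fun x ↦ (f x : ℂ)) u)‖ₑ ^ 2 = 0 := by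
    have l3 := (ENNReal.Tendsto.const_mul l2 (Or.inr (by norm_num : (2 : ℝ≥0∞) ≠ ∞))).add
        (ENNReal.Tendsto.const_mul l1 (Or.inr (by norm_num : (2 : ℝ≥0∞) ≠ ∞)))
    simp only [mul_zero, add_zero] at l3
    refine le_antisymm (ge_of_tendsto' l3 fun n ↦ ?_) zero_le
    have e : ∀ᵐ u, ftL2 (R n) (-u) = starRingEnd ℂ (ftL2 (R n) u) := by
      have h2 : ∀ᵐ u, ftL2 (R n) (-u) = ft (R n) (-u) :=
        measurePreserving_neg_real.quasiMeasurePreserving.ae (ftL2_eq_ft (hR1 n) (hR2 n))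
      filter_upwards [h2, ftL2_eq_ft (hR1 n) (hR2 n)] with u hu1 hu2
      rw [hu1, hu2]
      exact ft_neg_of_real _ u
    have hm : AEStronglyMeasurable (fun u ↦ ftL2 (R n) (-u) - ftL2 (fun x ↦ (f x : ℂ)) (-u)) :=
      ((aestronglyMeasurable_ftL2 _).sub (aestronglyMeasurable_ftL2 _)).comp_quasiMeasurePreserving
        measurePreserving_neg_real.quasiMeasurePreserving
    have := lintegral_sq_add_le (fun u ↦ ftL2 (R n) (-u) - ftL2 (fun x ↦ (f x : ℂ)) (-u))
      (fun u ↦ starRingEnd ℂ (ftL2 (fun x ↦ (f x : ℂ)) u - ftL2 (R n) u)) hm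
    refine (le_of_eq ?_).trans (this.trans (le_of_eq ?_))
    · refine lintegral_congr_ae ?_
      filter_upwards [e] with u hu
      rw [hu, map_sub, sub_add_sub_comm, ← enorm_neg]
      congr 2
      ring
    · congr 2
      refine lintegral_congr fun u ↦ ?_
      rw [← ofReal_norm, RCLike.norm_conj, ofReal_norm, enorm_sub_rev]
  have hm : AEStronglyMeasurable (fun u ↦ ftL2 (fun x ↦ (f x : ℂ)) (-u) -
      starRingEnd ℂ (ftL2 (fun x ↦ (f x : ℂ)) u)) :=
    ((aestronglyMeasurable_ftL2 _).comp_quasiMeasurePreserving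
      measurePreserving_neg_real.quasiMeasurePreserving).sub
      (Complex.continuous_conj.comp_aestronglyMeasurable (aestronglyMeasurable_ftL2 _))
  filter_upwards [ae_eq_zero_of_lintegral_sq_eq_zero hm hz] with u hu
  exact sub_eq_zero.1 hu

end

end

end LevyCLT

namespace LevyCLT

noncomputable section

/-! ### Local means -/

lemma localMean_eq (f : ℝ → ℂ) (x : ℝ) {r : ℝ} (hr : 0 < r) :
    localMean f x r = (2 * r)⁻¹ • ∫ y in Set.Icc (x - r) (x + r), f y := by
  rw [localMean, setAverage_eq, Real.volume_real_Icc_of_le (by linarith)]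
  congr 2
  ring

lemma localMean_congr {f g : ℝ → ℂ} (h : f =ᵐ[volume] g) : localMean f = localMean g := by
  ext x r
  rw [localMean, localMean, setAverage_eq, setAverage_eq,
    integral_congr_ae (ae_restrict_of_ae h)]

lemma tendsto_localMean_of_continuous {c : ℝ → ℂ} (hc : Continuous c) (x : ℝ) :
    Tendsto (localMean c x) (𝓝[>] 0) (𝓝 (c x)) := by
  rw [Metric.tendsto_nhds]
  intro δ hδ
  obtain ⟨η, hη, hd⟩ := Metric.continuousAt_iff.1 hc.continuousAt (δ / 2) (half_pos hδ)
  filter_upwards [Ioo_mem_nhdsGT hη] with r hr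
  have hr0 := hr.1
  have e : localMean c x r - c x = (2 * r)⁻¹ • ∫ y in Set.Icc (x - r) (x + r), (c y - c x) := by
    rw [localMean_eq c x hr0, integral_sub hc.continuousOn.integrableOn_Icc (by simp), smul_sub,
      setIntegral_const, Real.volume_real_Icc_of_le (by linarith), smul_smul]
    have : (2 * r)⁻¹ * (x + r - (x - r)) = 1 := by field_simp; ring
    rw [this, one_smul]
  rw [dist_eq_norm, e, norm_smul, Real.norm_of_nonneg (by positivity)]
  have h1 := norm_setIntegral_le_of_norm_le_const (μ := volume) (s := Set.Icc (x - r) (x + r))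
    (f := fun y ↦ c y - c x) (C := δ / 2) (by simp) (fun y hy ↦ by
      rw [← dist_eq_norm]
      refine (hd ?_).le
      rw [Real.dist_eq, abs_lt]
      constructor <;> linarith [hy.1, hy.2, hr.2])
  rw [Real.volume_real_Icc_of_le (by linarith)] at h1
  calc _ ≤ (2 * r)⁻¹ * (δ / 2 * (x + r - (x - r))) := by gcongr
    _ = δ / 2 := by field_simp; ring
    _ < δ := half_lt_self hδ

lemma locallyIntegrable_sub_mul {F : ℝ → ℂ} (hF : LocallyIntegrable F) (x₀ : ℝ) :
    LocallyIntegrable fun x : ℝ ↦ Complex.I * (x - x₀) * F x := by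
  rw [locallyIntegrable_iff] at hF ⊢
  intro s hs
  exact (hF s hs).continuousOn_mul (by fun_prop) hs

/-- On [x₀ − r, x₀ + r] the factor |x − x₀| ≤ r cancels the normalization (2r)⁻¹ up to 1/2, and the
integral of |F| over a shrinking interval tends to 0. The point x₀ need not be a Lebesgue point of
F. -/
lemma tendsto_localMean_sub_mul {F : ℝ → ℂ} (hF : LocallyIntegrable F) (x₀ : ℝ) :
    Tendsto (localMean (fun x : ℝ ↦ Complex.I * (x - x₀) * F x) x₀) (𝓝[>] 0) (𝓝 0) := by
  have hFn : LocallyIntegrable fun y ↦ ‖F y‖ := fun x ↦ (hF x).norm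
  have hint : ∀ a b : ℝ, IntervalIntegrable (fun y ↦ ‖F y‖) volume a b := fun a b ↦
    (hFn.integrableOn_isCompact isCompact_uIcc).intervalIntegrable
  have hcont := intervalIntegral.continuous_primitive hint x₀
  have h1 : Tendsto (fun r : ℝ ↦ (1 / 2) * ((∫ y in x₀..(x₀ + r), ‖F y‖) -
      ∫ y in x₀..(x₀ - r), ‖F y‖)) (𝓝[>] 0) (𝓝 0) := by
    have : Continuous fun r : ℝ ↦ (1 / 2) * ((∫ y in x₀..(x₀ + r), ‖F y‖) -
      ∫ y in x₀..(x₀ - r), ‖F y‖) :=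
      continuous_const.mul ((hcont.comp (continuous_const.add continuous_id)).sub
        (hcont.comp (continuous_const.sub continuous_id)))
    have h2 := this.tendsto 0
    simp only [add_zero, sub_zero, sub_self, mul_zero] at h2
    exact h2.mono_left nhdsWithin_le_nhds
  refine squeeze_zero_norm' ?_ h1
  filter_upwards [self_mem_nhdsWithin] with r hr
  have hr0 : 0 < r := hr
  have hI : IntegrableOn (fun y ↦ ‖F y‖) (Set.Icc (x₀ - r) (x₀ + r)) :=
    hFn.integrableOn_isCompact isCompact_Icc
  rw [localMean_eq _ _ hr0, norm_smul, Real.norm_of_nonneg (by positivity),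
    intervalIntegral.integral_interval_sub_left (hint _ _) (hint _ _),
    intervalIntegral.integral_of_le (by linarith), ← integral_Icc_eq_integral_Ioc]
  calc _ ≤ (2 * r)⁻¹ * ∫ y in Set.Icc (x₀ - r) (x₀ + r), r * ‖F y‖ := by
        gcongr
        refine norm_integral_le_of_norm_le (hI.const_mul r) ?_
        filter_upwards [ae_restrict_mem measurableSet_Icc] with y hy
        rw [norm_mul, norm_mul, Complex.norm_I, one_mul, ← Complex.ofReal_sub, Complex.norm_real]
        gcongr
        rw [Real.norm_eq_abs, abs_le]
        constructor <;> linarith [hy.1, hy.2]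
    _ = _ := by rw [integral_const_mul]; field_simp

lemma ae_tendsto_localMean {f : ℝ → ℂ} (hf : LocallyIntegrable f) :
    ∀ᵐ x, Tendsto (localMean f x) (𝓝[>] 0) (𝓝 (f x)) := by
  filter_upwards [IsUnifLocDoublingMeasure.ae_tendsto_average (μ := volume) hf 1] with x hx
  have := hx (fun _ : ℝ ↦ x) (fun r : ℝ ↦ r) (l := 𝓝[>] 0) tendsto_id (by
    filter_upwards [self_mem_nhdsWithin] with r hr
    exact Metric.mem_closedBall_self (by rw [one_mul]; exact le_of_lt hr))
  simp only [Real.closedBall_eq_Icc] at this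
  exact this

/-! ### The influence function of the variance formula. -/

section

variable {P : Measure ℝ} {φ : ℝ → ℂ} {x₀ Δ : ℝ} {k : ℝ → ℝ} {ε C C₁ C₂ : ℝ} {a b H : ℝ → ℂ}
  {g : ℝ → ℝ}

/-- From (φ⁻¹)' = −i(x₀ + Δκ)φ⁻¹. The multiple of the first symbol combines with the factor ix to
i(x − x₀), which exhibits the zero at x₀. -/
lemma symbolTwo_eq (h : IncrementLaw P φ x₀ Δ k ε C) (g : ℝ → ℝ) :
    symbolTwo g φ = fun u ↦ -(Complex.I * x₀) * symbolOne g φ u -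
      Complex.I * Δ * symbolKappa (ftL2 fun x ↦ (g x : ℂ)) φ k u := by
  ext u
  rw [symbolTwo, (h.hasDerivAt_inv (-u)).deriv, symbolOne, symbolKappa]
  ring

lemma memLp_symbolOne (h : IncrementLaw P φ x₀ Δ k ε C)
    (hG : FourierSplit (ftL2 fun x ↦ (g x : ℂ)) a b C₁) : MemLp (symbolOne g φ) 2 :=
  memLp_symbol h hG

lemma memLp_symbolTwo (h : IncrementLaw P φ x₀ Δ k ε C)
    (hG : FourierSplit (ftL2 fun x ↦ (g x : ℂ)) a b C₁) : MemLp (symbolTwo g φ) 2 := by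
  rw [symbolTwo_eq h]
  exact ((memLp_symbolOne h hG).const_mul _).sub ((memLp_symbolKappa h hG).const_mul _)

lemma influence_ae_eq (h : IncrementLaw P φ x₀ Δ k ε C)
    (hG : FourierSplit (ftL2 fun x ↦ (g x : ℂ)) a b C₁) :
    influence g φ =ᵐ[volume] limitInfluence (ftL2 fun x ↦ (g x : ℂ)) φ k x₀ Δ := by
  have m1 := memLp_symbolOne h hG
  have mk := memLp_symbolKappa h hG
  filter_upwards [invFtL2_sub (m1.const_mul (-(Complex.I * x₀))) (mk.const_mul (Complex.I * Δ)),
    invFtL2_const_mul (-(Complex.I * x₀)) m1, invFtL2_const_mul (Complex.I * Δ) mk,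
    invFtL2_eq_invFt (integrable_symbolKappa h hG) mk] with x h1 h2 h3 h4
  have e : invFtL2 (fun u ↦ ftL2 (fun x ↦ (g x : ℂ)) u * (φ (-u))⁻¹) x =
    invFtL2 (symbolOne g φ) x := rfl
  rw [influence, symbolTwo_eq h, h1, h2, h3, h4, limitInfluence, e]
  ring

/-- Away from x₀ this is Lebesgue's differentiation theorem, transferred to `P` by
`ae_of_ae_volume`. At x₀ the term with the factor x − x₀ averages to 0 and the other term is
continuous. -/
lemma ae_tendsto_localMean_influence (h : IncrementLaw P φ x₀ Δ k ε C)
    (hG : FourierSplit (ftL2 fun x ↦ (g x : ℂ)) a b C₁) :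
    ∀ᵐ x ∂P, Tendsto (localMean (influence g φ) x) (𝓝[>] 0)
      (𝓝 (limitInfluence (ftL2 fun x ↦ (g x : ℂ)) φ k x₀ Δ x)) := by
  rw [localMean_congr (influence_ae_eq h hG)]
  set G := ftL2 fun x ↦ (g x : ℂ)
  have hF : LocallyIntegrable (invFtL2 fun u ↦ G u * (φ (-u))⁻¹) :=
    locallyIntegrable_of_memLp_two (memLp_invFtL2 (memLp_symbol h hG))
  have hc : Continuous fun x ↦ Complex.I * Δ * invFt (symbolKappa G φ k) x :=
    continuous_const.mul (continuous_invFt (integrable_symbolKappa h hG))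
  have hF' := locallyIntegrable_sub_mul hF x₀
  have h1 : ∀ᵐ x, Tendsto (localMean (limitInfluence G φ k x₀ Δ) x) (𝓝[>] 0)
      (𝓝 (limitInfluence G φ k x₀ Δ x)) :=
    ae_tendsto_localMean (hF'.sub hc.locallyIntegrable)
  filter_upwards [ae_of_ae_volume h h1] with x hx
  by_cases hne : x = x₀
  · subst hne
    have l1 := (tendsto_localMean_sub_mul hF x).sub (tendsto_localMean_of_continuous hc x)
    have e : limitInfluence G φ k x Δ x = 0 - Complex.I * Δ * invFt (symbolKappa G φ k) x := by
      rw [limitInfluence]; ring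
    rw [e]
    refine l1.congr fun r ↦ ?_
    rw [localMean, localMean, localMean, setAverage_eq, setAverage_eq, setAverage_eq, ← smul_sub,
      ← integral_sub (hF'.integrableOn_isCompact isCompact_Icc)
        (hc.continuousOn.integrableOn_Icc)]
    rfl
  · exact hx hne

lemma preciseRep_influence_ae_eq (h : IncrementLaw P φ x₀ Δ k ε C)
    (hG : FourierSplit (ftL2 fun x ↦ (g x : ℂ)) a b C₁) :
    preciseRep (influence g φ) =ᵐ[P] limitInfluence (ftL2 fun x ↦ (g x : ℂ)) φ k x₀ Δ := by
  filter_upwards [ae_tendsto_localMean_influence h hG] with x hx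
  exact hx.limUnder_eq

/-! ### The normalized influence function -/

variable {G : ℝ → ℂ}

/-- The limiting influence function divided by `iΔ`; it is real. -/
def score (G φ : ℝ → ℂ) (k : ℝ → ℝ) (x₀ Δ x : ℝ) : ℝ :=
  ((Complex.I * Δ)⁻¹ * limitInfluence G φ k x₀ Δ x).re

/-- The influence function with bandwidth `h`, divided by `iΔ`; it is real. -/
def smoothScore (G φ H : ℝ → ℂ) (k : ℝ → ℝ) (x₀ Δ h x : ℝ) : ℝ :=
  ((Complex.I * Δ)⁻¹ * smoothInfluence G φ H k x₀ Δ h x).re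

lemma measurable_score (h : IncrementLaw P φ x₀ Δ k ε C) (hG : FourierSplit G a b C₁) :
    Measurable (score G φ k x₀ Δ) :=
  Complex.measurable_re.comp ((measurable_limitInfluence h hG).const_mul _)

lemma continuous_smoothScore (h : IncrementLaw P φ x₀ Δ k ε C) (hG : FourierSplit G a b C₁)
    (hH : KernelTransform H C₂) {η : ℝ} (hη : 0 < η) :
    Continuous (smoothScore G φ H k x₀ Δ η) :=
  Complex.continuous_re.comp ((continuous_smoothInfluence h hG hH hη).const_mul _)

lemma memLp_score (h : IncrementLaw P φ x₀ Δ k ε C) (hG : FourierSplit G a b C₁)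
    (hH : KernelTransform H C₂) : MemLp (score G φ k x₀ Δ) 2 P :=
  ((memLp_limitInfluence h hG hH).const_mul _).re

lemma memLp_smoothScore (h : IncrementLaw P φ x₀ Δ k ε C) (hG : FourierSplit G a b C₁)
    (hH : KernelTransform H C₂) {η : ℝ} (hη : 0 < η) : MemLp (smoothScore G φ H k x₀ Δ η) 2 P :=
  ((memLp_smoothInfluence h hG hH hη).const_mul _).re

lemma integral_smoothScore (h : IncrementLaw P φ x₀ Δ k ε C) (hG : FourierSplit G a b C₁)
    (hH : KernelTransform H C₂) {η : ℝ} (hη : 0 < η) :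
    ∫ x, smoothScore G φ H k x₀ Δ η x ∂P = 0 := by
  have := h.prob
  have hi : Integrable (fun x ↦ (Complex.I * Δ)⁻¹ * smoothInfluence G φ H k x₀ Δ η x) P :=
    ((memLp_smoothInfluence h hG hH hη).const_mul _).integrable (by norm_num)
  have h1 := integral_re hi
  rw [integral_const_mul, integral_smoothInfluence h hG hH hη] at h1
  simpa [smoothScore] using h1

lemma exists_lintegral_sq_smoothScore_sub_le (h : IncrementLaw P φ x₀ Δ k ε C)
    (hG : FourierSplit G a b C₁) (hH : KernelTransform H C₂) :
    ∃ A : ℝ≥0∞, A ≠ ∞ ∧ ∀ η : ℝ, 0 < η → η ≤ 1 →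
      ∫⁻ x, ‖smoothScore G φ H k x₀ Δ η x - score G φ k x₀ Δ x‖ₑ ^ 2 ∂P ≤
        A * ENNReal.ofReal (η ^ ε) ^ 2 := by
  obtain ⟨A, hA, hle⟩ := exists_lintegral_sq_smoothInfluence_sub_le h hG hH
  refine ⟨‖(Complex.I * (Δ : ℂ))⁻¹‖ₑ ^ 2 * A, by finiteness, fun η hη hη1 ↦ ?_⟩
  rw [mul_assoc]
  refine le_trans ?_ (mul_le_mul' le_rfl (hle η hη hη1))
  rw [← lintegral_const_mul' _ _ (by finiteness)]
  refine lintegral_mono fun x ↦ ?_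
  simp only
  rw [← mul_pow, ← enorm_mul, mul_sub]
  refine pow_le_pow_left' ?_ 2
  rw [smoothScore, score, ← Complex.sub_re, ← ofReal_norm, ← ofReal_norm]
  exact ENNReal.ofReal_le_ofReal (Complex.abs_re_le_norm _)

lemma tendsto_lintegral_sq_of_le {F : ℝ → ℝ≥0∞} {A : ℝ≥0∞} (hA : A ≠ ∞) (hε : 0 < ε)
    (h : ∀ η : ℝ, 0 < η → η ≤ 1 → F η ≤ A * ENNReal.ofReal (η ^ ε) ^ 2) :
    Tendsto F (𝓝[>] 0) (𝓝 0) := by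
  have h1 : Tendsto (fun η : ℝ ↦ η ^ ε) (𝓝[>] 0) (𝓝 0) := by
    have := (Real.continuousAt_rpow_const 0 ε (Or.inr hε.le)).tendsto
    rw [Real.zero_rpow hε.ne'] at this
    exact this.mono_left nhdsWithin_le_nhds
  have h2 : Tendsto (fun η : ℝ ↦ A * ENNReal.ofReal (η ^ ε) ^ 2) (𝓝[>] 0) (𝓝 0) := by
    have := ENNReal.Tendsto.const_mul (ENNReal.Tendsto.pow (n := 2) (ENNReal.tendsto_ofReal h1)) (Or.inr hA)
    simpa using this
  refine tendsto_of_tendsto_of_tendsto_of_le_of_le' tendsto_const_nhds h2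
    (Eventually.of_forall fun _ ↦ zero_le) ?_
  filter_upwards [Ioc_mem_nhdsGT (zero_lt_one' ℝ)] with η hη
  exact h η hη.1 hη.2

/-- `P` has mass one, so L²(P) convergence of the centred smoothed scores carries the mean zero to
the limit. -/
lemma integral_score (h : IncrementLaw P φ x₀ Δ k ε C) (hG : FourierSplit G a b C₁)
    (hH : KernelTransform H C₂) : ∫ x, score G φ k x₀ Δ x ∂P = 0 := by
  have := h.prob
  obtain ⟨A, hA, hle⟩ := exists_lintegral_sq_smoothScore_sub_le h hG hH
  have h1 := tendsto_lintegral_sq_of_le hA h.ε_pos hle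
  have hs := (memLp_score h hG hH).integrable (q := 2) (by norm_num)
  have key : ∀ η : ℝ, 0 < η → ‖∫ x, score G φ k x₀ Δ x ∂P‖ₑ ^ 2 ≤
      ∫⁻ x, ‖smoothScore G φ H k x₀ Δ η x - score G φ k x₀ Δ x‖ₑ ^ 2 ∂P := fun η hη ↦ by
    have hi := (memLp_smoothScore h hG hH hη).integrable (q := 2) (by norm_num)
    have e : ‖∫ x, score G φ k x₀ Δ x ∂P‖ₑ =
        ‖∫ x, (smoothScore G φ H k x₀ Δ η x - score G φ k x₀ Δ x) ∂P‖ₑ := by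
      rw [integral_sub hi hs, integral_smoothScore h hG hH hη, zero_sub, enorm_neg]
    rw [e, ← eLpNorm_two_sq]
    refine pow_le_pow_left' ?_ 2
    refine (enorm_integral_le_lintegral_enorm _).trans ?_
    rw [← eLpNorm_one_eq_lintegral_enorm]
    exact eLpNorm_le_eLpNorm_of_exponent_le (by norm_num) (hi.sub hs).1
  have h2 : ‖∫ x, score G φ k x₀ Δ x ∂P‖ₑ ^ 2 ≤ 0 := by
    refine ge_of_tendsto h1 ?_
    filter_upwards [self_mem_nhdsWithin] with η hη
    exact key η hη
  simpa using h2

/-- The smoothed functions are purely imaginary and converge in L²(P). -/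
lemma limitInfluence_re_ae (h : IncrementLaw P φ x₀ Δ k ε C) (hG : FourierSplit G a b C₁)
    (hH : KernelTransform H C₂) (hGc : ∀ᵐ u, G (-u) = starRingEnd ℂ (G u))
    (hHc : ∀ u, H (-u) = starRingEnd ℂ (H u)) :
    ∀ᵐ x ∂P, (limitInfluence G φ k x₀ Δ x).re = 0 := by
  obtain ⟨A, hA, hle⟩ := exists_lintegral_sq_smoothInfluence_sub_le h hG hH
  have h1 := tendsto_lintegral_sq_of_le hA h.ε_pos hle
  refine ae_eq_zero_of_lintegral_sq_eq_zero
    (Complex.measurable_re.comp (measurable_limitInfluence h hG)).aestronglyMeasurable ?_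
  refine le_antisymm (ge_of_tendsto' h1 fun η ↦ lintegral_mono fun x ↦ ?_) zero_le
  refine pow_le_pow_left' ?_ 2
  have e : (limitInfluence G φ k x₀ Δ x).re =
      -(smoothInfluence G φ H k x₀ Δ η x - limitInfluence G φ k x₀ Δ x).re := by
    rw [Complex.sub_re, smoothInfluence_re h hGc hHc]; ring
  rw [e, enorm_neg, ← ofReal_norm, ← ofReal_norm]
  exact ENNReal.ofReal_le_ofReal (Complex.abs_re_le_norm _)

/-- Division by iΔ makes the purely imaginary limit real, so the complex square in the variance
formula is the square of a real number. -/
lemma integral_limitInfluence_sq (h : IncrementLaw P φ x₀ Δ k ε C) (hG : FourierSplit G a b C₁)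
    (hH : KernelTransform H C₂) (hGc : ∀ᵐ u, G (-u) = starRingEnd ℂ (G u))
    (hHc : ∀ u, H (-u) = starRingEnd ℂ (H u)) :
    ((Complex.I * Δ) ^ 2)⁻¹ * ∫ x, limitInfluence G φ k x₀ Δ x ^ 2 ∂P =
      ((∫ x, score G φ k x₀ Δ x ^ 2 ∂P : ℝ) : ℂ) := by
  rw [← integral_const_mul, ← integral_complex_ofReal]
  refine integral_congr_ae ?_
  filter_upwards [limitInfluence_re_ae h hG hH hGc hHc] with x hx
  have hΔ : (Δ : ℂ) ≠ 0 := by exact_mod_cast h.Δ_pos.ne'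
  have h0 : (Complex.I * (Δ : ℂ))⁻¹ = -(Complex.I * (Δ⁻¹ : ℝ)) := by
    rw [mul_inv, Complex.inv_I]; push_cast; ring
  have e : (score G φ k x₀ Δ x : ℂ) = (Complex.I * Δ)⁻¹ * limitInfluence G φ k x₀ Δ x := by
    apply Complex.ext
    · rw [Complex.ofReal_re, score]
    · rw [Complex.ofReal_im, h0, neg_mul, Complex.neg_im, mul_assoc, Complex.I_mul_im,
        Complex.re_ofReal_mul, hx]
      simp
  push_cast
  rw [e]
  simp only [mul_pow, mul_inv, inv_pow]

end

end

end LevyCLT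

namespace LevyCLT

noncomputable section

/-! ### Independent samples -/

/-- `X` is a sequence of independent random variables with law `P`. -/
structure IsSample {Ω : Type*} [MeasurableSpace Ω] (X : ℕ → Ω → ℝ) (μ : Measure Ω)
    (P : Measure ℝ) : Prop where
  measurable : ∀ k, Measurable (X k)
  indep : iIndepFun X μ
  map_eq : ∀ k, μ.map (X k) = P

section

variable {Ω : Type*} [MeasurableSpace Ω] {μ : Measure Ω}

lemma IsLevyProcess.isSample_increment {L : ℝ≥0 → Ω → ℝ} (hL : IsLevyProcess L μ) (Δ : ℝ≥0) :
    IsSample (increment L Δ) μ (μ.map (L Δ)) where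
  measurable k := (hL.measurable _).sub (hL.measurable _)
  indep := by
    have hmono : Monotone fun n : ℕ ↦ (n : ℝ≥0) * Δ := fun a b hab ↦ by
      simp only
      gcongr
    exact hL.indep.nat hmono
  map_eq k := by
    rw [← hL.stationary ((k : ℕ) * Δ) Δ]
    congr 1
    ext ω
    rw [increment]
    congr 2
    push_cast
    ring

namespace IsSample

variable {X : ℕ → Ω → ℝ} {P : Measure ℝ}

lemma isProbabilityMeasure [IsProbabilityMeasure μ] (hX : IsSample X μ P) : IsProbabilityMeasure P := by
  rw [← hX.map_eq 0]
  exact Measure.isProbabilityMeasure_map (hX.measurable 0).aemeasurable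

lemma identDistrib (hX : IsSample X μ P) (i j : ℕ) : IdentDistrib (X i) (X j) μ μ :=
  ⟨(hX.measurable i).aemeasurable, (hX.measurable j).aemeasurable, by
    rw [hX.map_eq, hX.map_eq]⟩

lemma integral_comp (hX : IsSample X μ P) (k : ℕ) {E : Type*} [NormedAddCommGroup E]
    [NormedSpace ℝ E] {f : ℝ → E} (hf : AEStronglyMeasurable f P) :
    ∫ ω, f (X k ω) ∂μ = ∫ x, f x ∂P := by
  have hf' : AEStronglyMeasurable f (μ.map (X k)) := by rwa [hX.map_eq k]
  rw [← integral_map (hX.measurable k).aemeasurable hf', hX.map_eq k]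

lemma memLp_comp (hX : IsSample X μ P) (k : ℕ) {f : ℝ → ℝ} (hf : MemLp f 2 P) :
    MemLp (fun ω ↦ f (X k ω)) 2 μ := by
  have h1 : MemLp f 2 (μ.map (X k)) := by rwa [hX.map_eq k]
  exact h1.comp_of_map (hX.measurable k).aemeasurable

/-- The variance of a sample mean. -/
lemma lintegral_sq_mean_sub_le [IsProbabilityMeasure μ] (hX : IsSample X μ P) {f : ℝ → ℝ} (hf : Measurable f)
    (hf2 : MemLp f 2 P) {n : ℕ} (hn : n ≠ 0) :
    ∫⁻ ω, ‖(n : ℝ)⁻¹ * ∑ k ∈ Finset.range n, f (X k ω) - ∫ x, f x ∂P‖ₑ ^ 2 ∂μ ≤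
      (n : ℝ≥0∞)⁻¹ * ∫⁻ x, ‖f x‖ₑ ^ 2 ∂P := by
  have hP := hX.isProbabilityMeasure
  have hn0 : (n : ℝ) ≠ 0 := by exact_mod_cast hn
  have hY : ∀ k, MemLp (fun ω ↦ f (X k ω)) 2 μ := fun k ↦ hX.memLp_comp k hf2
  have hS : MemLp (∑ k ∈ Finset.range n, fun ω ↦ f (X k ω)) 2 μ :=
    memLp_finsetSum' _ fun k _ ↦ hY k
  have hSfun : (∑ k ∈ Finset.range n, fun ω ↦ f (X k ω)) =
      fun ω ↦ ∑ k ∈ Finset.range n, f (X k ω) := by ext ω; simp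
  rw [hSfun] at hS
  have hmean : ∫ ω, (n : ℝ)⁻¹ * ∑ k ∈ Finset.range n, f (X k ω) ∂μ = ∫ x, f x ∂P := by
    rw [integral_const_mul, integral_finsetSum _ fun k _ ↦ (hY k).integrable (by norm_num)]
    simp_rw [hX.integral_comp _ hf2.1]
    simp [hn0]
  have hM : MemLp (fun ω ↦ (n : ℝ)⁻¹ * ∑ k ∈ Finset.range n, f (X k ω)) 2 μ := hS.const_mul _
  have e1 : ∫⁻ ω, ‖(n : ℝ)⁻¹ * ∑ k ∈ Finset.range n, f (X k ω) - ∫ x, f x ∂P‖ₑ ^ 2 ∂μ =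
      ENNReal.ofReal (Var[fun ω ↦ (n : ℝ)⁻¹ * ∑ k ∈ Finset.range n, f (X k ω); μ]) := by
    rw [hM.ofReal_variance_eq, evariance, hmean]
  have hindep : Set.Pairwise (Finset.range n : Set ℕ)
      fun i j ↦ IndepFun (fun ω ↦ f (X i ω)) (fun ω ↦ f (X j ω)) μ := fun i _ j _ hij ↦
    (hX.indep.indepFun hij).comp hf hf
  have e2 : Var[fun ω ↦ ∑ k ∈ Finset.range n, f (X k ω); μ] =
      ∑ k ∈ Finset.range n, Var[fun ω ↦ f (X k ω); μ] := by
    rw [← hSfun]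
    exact IndepFun.variance_sum (fun k _ ↦ hY k) hindep
  have e3 : ∀ k, Var[fun ω ↦ f (X k ω); μ] ≤ ∫ x, f x ^ 2 ∂P := fun k ↦ by
    refine (variance_le_expectation_sq (hY k).1).trans (le_of_eq ?_)
    exact hX.integral_comp k (f := fun x ↦ f x ^ 2) (hf2.1.pow 2)
  have e4 : ENNReal.ofReal (∫ x, f x ^ 2 ∂P) = ∫⁻ x, ‖f x‖ₑ ^ 2 ∂P := by
    rw [ofReal_integral_eq_lintegral_ofReal hf2.integrable_sq (ae_of_all _ fun x ↦ sq_nonneg _)]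
    refine lintegral_congr fun x ↦ ?_
    rw [← ofReal_norm, ← ENNReal.ofReal_pow (norm_nonneg _), Real.norm_eq_abs, sq_abs]
  have e5 : (n : ℝ≥0∞)⁻¹ = ENNReal.ofReal (n : ℝ)⁻¹ := by
    rw [ENNReal.ofReal_inv_of_pos (by positivity), ENNReal.ofReal_natCast]
  rw [e1, variance_const_mul, e2, ← e4, e5, ← ENNReal.ofReal_mul (by positivity)]
  refine ENNReal.ofReal_le_ofReal ?_
  calc _ ≤ ((n : ℝ)⁻¹) ^ 2 * ∑ k ∈ Finset.range n, ∫ x, f x ^ 2 ∂P := by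
        gcongr; exact e3 _
    _ = _ := by rw [Finset.sum_const, Finset.card_range, nsmul_eq_mul]; field_simp

lemma enorm_sq_eq (z : ℂ) : ‖z‖ₑ ^ 2 = ‖z.re‖ₑ ^ 2 + ‖z.im‖ₑ ^ 2 := by
  rw [← ofReal_norm, ← ofReal_norm, ← ofReal_norm, ← ENNReal.ofReal_pow (norm_nonneg _),
    ← ENNReal.ofReal_pow (norm_nonneg _), ← ENNReal.ofReal_pow (norm_nonneg _),
    ← ENNReal.ofReal_add (by positivity) (by positivity), Complex.sq_norm, Complex.normSq_apply,
    Real.norm_eq_abs, Real.norm_eq_abs, sq_abs, sq_abs, sq, sq]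

lemma lintegral_sq_mean_sub_le_complex [IsProbabilityMeasure μ] (hX : IsSample X μ P) {f : ℝ → ℂ} (hf : Measurable f)
    (hf2 : MemLp f 2 P) {n : ℕ} (hn : n ≠ 0) :
    ∫⁻ ω, ‖(n : ℂ)⁻¹ * ∑ k ∈ Finset.range n, f (X k ω) - ∫ x, f x ∂P‖ₑ ^ 2 ∂μ ≤
      (n : ℝ≥0∞)⁻¹ * ∫⁻ x, ‖f x‖ₑ ^ 2 ∂P := by
  have hP := hX.isProbabilityMeasure
  have hi : Integrable f P := hf2.integrable (by norm_num)
  have h1 := hX.lintegral_sq_mean_sub_le (Complex.measurable_re.comp hf) hf2.re hn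
  have h2 := hX.lintegral_sq_mean_sub_le (Complex.measurable_im.comp hf) hf2.im hn
  have hre : ∀ z : ℂ, ((n : ℂ)⁻¹ * z).re = (n : ℝ)⁻¹ * z.re := fun z ↦ by
    have : (n : ℂ)⁻¹ = (((n : ℝ)⁻¹ : ℝ) : ℂ) := by push_cast; rfl
    rw [this, Complex.re_ofReal_mul]
  have him : ∀ z : ℂ, ((n : ℂ)⁻¹ * z).im = (n : ℝ)⁻¹ * z.im := fun z ↦ by
    have : (n : ℂ)⁻¹ = (((n : ℝ)⁻¹ : ℝ) : ℂ) := by push_cast; rfl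
    rw [this, Complex.im_ofReal_mul]
  have ir : (∫ x, f x ∂P).re = ∫ x, (f x).re ∂P := (integral_re hi).symm
  have ii : (∫ x, f x ∂P).im = ∫ x, (f x).im ∂P := (integral_im hi).symm
  have e : ∫⁻ x, ‖f x‖ₑ ^ 2 ∂P = (∫⁻ x, ‖(f x).re‖ₑ ^ 2 ∂P) + ∫⁻ x, ‖(f x).im‖ₑ ^ 2 ∂P := by
    have hmre : Measurable fun x ↦ ‖(f x).re‖ₑ ^ 2 :=
      (Complex.measurable_re.comp hf).enorm.pow_const 2
    rw [← lintegral_add_left hmre]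
    exact lintegral_congr fun x ↦ enorm_sq_eq _
  have hm : Measurable fun ω ↦ ‖((n : ℂ)⁻¹ * ∑ k ∈ Finset.range n, f (X k ω) -
      ∫ x, f x ∂P).re‖ₑ ^ 2 := by
    refine (Complex.measurable_re.comp ?_).enorm.pow_const 2
    exact ((Finset.measurable_fun_sum _ fun k _ ↦ hf.comp (hX.measurable k)).const_mul _).sub_const _
  simp_rw [enorm_sq_eq]
  rw [lintegral_add_left hm, ← lintegral_congr fun x ↦ enorm_sq_eq (f x), e, mul_add]
  refine add_le_add ?_ ?_
  · simpa only [Complex.sub_re, hre, Complex.re_sum, ir, Function.comp_apply] using h1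
  · simpa only [Complex.sub_im, him, Complex.im_sum, ii, Function.comp_apply] using h2

end IsSample

end

/-! ### The empirical characteristic function -/

lemma empCharFun_eq (x : ℕ → ℝ) (n : ℕ) (u : ℝ) :
    empCharFun x n u = (n : ℂ)⁻¹ * ∑ k ∈ Finset.range n, Complex.exp (Complex.I * u * x k) := by
  rw [empCharFun, empMeasure, charFun_eq_integral, integral_smul_measure,
    integral_finsetSum_measure fun k _ ↦ integrable_dirac (by simp)]
  simp

/-- The derivative of the empirical characteristic function. -/
def empCharFunDeriv (x : ℕ → ℝ) (n : ℕ) (u : ℝ) : ℂ :=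
  (n : ℂ)⁻¹ * ∑ k ∈ Finset.range n, Complex.I * x k * Complex.exp (Complex.I * u * x k)

lemma hasDerivAt_empCharFun (x : ℕ → ℝ) (n : ℕ) (u : ℝ) :
    HasDerivAt (empCharFun x n) (empCharFunDeriv x n u) u := by
  have : empCharFun x n = fun u : ℝ ↦ (n : ℂ)⁻¹ * ∑ k ∈ Finset.range n,
    Complex.exp (Complex.I * u * x k) := funext fun u ↦ empCharFun_eq x n u
  rw [this]
  exact (HasDerivAt.fun_sum fun k _ ↦ hasDerivAt_exp_I (x k) u).const_mul _

lemma deriv_empCharFun (x : ℕ → ℝ) (n : ℕ) : deriv (empCharFun x n) = empCharFunDeriv x n :=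
  funext fun u ↦ (hasDerivAt_empCharFun x n u).deriv

lemma continuous_empCharFun (x : ℕ → ℝ) (n : ℕ) : Continuous (empCharFun x n) :=
  continuous_iff_continuousAt.2 fun u ↦ (hasDerivAt_empCharFun x n u).continuousAt

lemma continuous_empCharFunDeriv (x : ℕ → ℝ) (n : ℕ) : Continuous (empCharFunDeriv x n) := by
  unfold empCharFunDeriv
  fun_prop

lemma empCharFun_zero (x : ℕ → ℝ) {n : ℕ} (hn : n ≠ 0) : empCharFun x n 0 = 1 := by
  rw [empCharFun_eq]
  simp [hn]

lemma empCharFun_neg (x : ℕ → ℝ) (n : ℕ) (u : ℝ) :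
    empCharFun x n (-u) = starRingEnd ℂ (empCharFun x n u) := by
  rw [empCharFun, charFun_neg]; rfl

lemma empCharFunDeriv_neg (x : ℕ → ℝ) (n : ℕ) (u : ℝ) :
    empCharFunDeriv x n (-u) = -starRingEnd ℂ (empCharFunDeriv x n u) := by
  rw [empCharFunDeriv, empCharFunDeriv, map_mul, map_inv₀, map_natCast, map_sum, ← mul_neg,
    ← Finset.sum_neg_distrib]
  congr 1
  refine Finset.sum_congr rfl fun k _ ↦ ?_
  rw [map_mul, ← Complex.exp_conj, map_mul, map_mul, map_mul, Complex.conj_I, Complex.conj_ofReal,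
    Complex.conj_ofReal]
  push_cast
  simp only [mul_neg, neg_mul, neg_neg]

/-- The squared error of the empirical characteristic function and of its derivative. -/
def errSq (φ : ℝ → ℂ) (x : ℕ → ℝ) (n : ℕ) (u : ℝ) : ℝ :=
  ‖empCharFun x n u - φ u‖ ^ 2 + ‖empCharFunDeriv x n u - deriv φ u‖ ^ 2

lemma errSq_nonneg (φ : ℝ → ℂ) (x : ℕ → ℝ) (n : ℕ) (u : ℝ) : 0 ≤ errSq φ x n u := by
  unfold errSq; positivity

section

variable {Ω : Type*} [MeasurableSpace Ω] {μ : Measure Ω} {X : ℕ → Ω → ℝ} {P : Measure ℝ} {φ : ℝ → ℂ} {x₀ Δ : ℝ} {k : ℝ → ℝ} {ε C : ℝ}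

lemma IncrementLaw.deriv_eq (h : IncrementLaw P φ x₀ Δ k ε C) :
    deriv φ = fun u ↦ Complex.I * (x₀ + Δ * ft (fun x ↦ (k x : ℂ)) u) * φ u :=
  funext fun u ↦ (h.hasDerivAt u).deriv

lemma IncrementLaw.continuous_deriv (h : IncrementLaw P φ x₀ Δ k ε C) : Continuous (deriv φ) := by
  rw [h.deriv_eq]
  have := h.continuous_ft
  have := h.continuous
  fun_prop

lemma IncrementLaw.continuous_errSq (h : IncrementLaw P φ x₀ Δ k ε C) (x : ℕ → ℝ) (n : ℕ) :
    Continuous (errSq φ x n) := by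
  have h1 := continuous_empCharFun x n
  have h2 := continuous_empCharFunDeriv x n
  have h3 := h.continuous
  have h4 := h.continuous_deriv
  unfold errSq
  fun_prop

lemma measurable_empCharFun_uncurry (hX : ∀ k, Measurable (X k)) (n : ℕ) :
    Measurable fun p : Ω × ℝ ↦ empCharFun (fun k ↦ X k p.1) n p.2 := by
  simp_rw [empCharFun_eq]
  refine Measurable.const_mul (Finset.measurable_fun_sum _ fun k _ ↦ ?_) _
  have : Measurable fun p : Ω × ℝ ↦ X k p.1 := (hX k).comp measurable_fst
  fun_prop

lemma measurable_empCharFunDeriv_uncurry (hX : ∀ k, Measurable (X k)) (n : ℕ) :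
    Measurable fun p : Ω × ℝ ↦ empCharFunDeriv (fun k ↦ X k p.1) n p.2 := by
  unfold empCharFunDeriv
  refine Measurable.const_mul (Finset.measurable_fun_sum _ fun k _ ↦ ?_) _
  have : Measurable fun p : Ω × ℝ ↦ X k p.1 := (hX k).comp measurable_fst
  fun_prop

lemma measurable_errSq_uncurry (h : IncrementLaw P φ x₀ Δ k ε C) (hX : ∀ k, Measurable (X k))
    (n : ℕ) : Measurable fun p : Ω × ℝ ↦ errSq φ (fun k ↦ X k p.1) n p.2 := by
  have h1 := measurable_empCharFun_uncurry hX n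
  have h2 := measurable_empCharFunDeriv_uncurry hX n
  have h3 : Measurable fun p : Ω × ℝ ↦ φ p.2 := h.continuous.measurable.comp measurable_snd
  have h4 : Measurable fun p : Ω × ℝ ↦ deriv φ p.2 :=
    h.continuous_deriv.measurable.comp measurable_snd
  exact ((h1.sub h3).norm.pow_const 2).add ((h2.sub h4).norm.pow_const 2)

/-- The mean squared error is of order `1 / n`. -/
lemma exists_lintegral_errSq_le [IsProbabilityMeasure μ] (h : IncrementLaw P φ x₀ Δ k ε C) (hX : IsSample X μ P) :
    ∃ A : ℝ≥0∞, A ≠ ∞ ∧ ∀ (n : ℕ) (u : ℝ), n ≠ 0 →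
      ∫⁻ ω, ENNReal.ofReal (errSq φ (fun k ↦ X k ω) n u) ∂μ ≤ (n : ℝ≥0∞)⁻¹ * A := by
  have hP := h.prob
  have hP1 : Integrable (fun x : ℝ ↦ x) P := h.memLp_id.integrable (by norm_num)
  refine ⟨1 + ∫⁻ x : ℝ, ‖x‖ₑ ^ 2 ∂P, ?_, fun n u hn ↦ ?_⟩
  · have := (memLp_two_iff.1 h.memLp_id).2.ne
    finiteness
  have m1 : MemLp (fun x : ℝ ↦ Complex.exp (Complex.I * u * x)) 2 P :=
    MemLp.of_bound (by fun_prop : Continuous _).aestronglyMeasurable 1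
      (ae_of_all _ fun x ↦ (norm_exp_I_mul u x).le)
  have m2 : MemLp (fun x : ℝ ↦ Complex.I * x * Complex.exp (Complex.I * u * x)) 2 P := by
    refine MemLp.of_le h.memLp_id (by fun_prop : Continuous _).aestronglyMeasurable
      (ae_of_all _ fun x ↦ ?_)
    rw [norm_mul, norm_exp_I_mul, norm_mul, Complex.norm_I, Complex.norm_real]
    simp
  have b1 := hX.lintegral_sq_mean_sub_le_complex (by fun_prop) m1 hn
  have b2 := hX.lintegral_sq_mean_sub_le_complex (by fun_prop) m2 hn
  have i1 : ∫ x : ℝ, Complex.exp (Complex.I * u * x) ∂P = φ u := by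
    rw [h.charFun_eq, charFun_eq_integral]
  have i2 : ∫ x : ℝ, Complex.I * x * Complex.exp (Complex.I * u * x) ∂P = deriv φ u := by
    rw [h.charFun_eq, (hasDerivAt_charFun hP1 u).deriv, ← integral_const_mul]
    refine integral_congr_ae (ae_of_all _ fun x ↦ ?_)
    simp only
    ring
  rw [i1] at b1
  rw [i2] at b2
  have e : ∀ ω, ENNReal.ofReal (errSq φ (fun k ↦ X k ω) n u) =
      ‖(n : ℂ)⁻¹ * ∑ k ∈ Finset.range n, Complex.exp (Complex.I * u * X k ω) - φ u‖ₑ ^ 2 +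
      ‖(n : ℂ)⁻¹ * ∑ k ∈ Finset.range n, Complex.I * X k ω * Complex.exp (Complex.I * u * X k ω) -
        deriv φ u‖ₑ ^ 2 := fun ω ↦ by
    rw [errSq, ENNReal.ofReal_add (by positivity) (by positivity),
      ENNReal.ofReal_pow (norm_nonneg _), ENNReal.ofReal_pow (norm_nonneg _), ofReal_norm,
      ofReal_norm, empCharFun_eq, empCharFunDeriv]
  simp_rw [e]
  have hXm := hX.measurable
  rw [lintegral_add_left (by fun_prop), mul_add]
  refine add_le_add (b1.trans ?_) (b2.trans ?_)
  · gcongr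
    refine (lintegral_mono (g := fun _ ↦ 1) fun x ↦ ?_).trans (by simp)
    simp only
    rw [← ofReal_norm, norm_exp_I_mul]
    simp
  · gcongr with x
    rw [← ofReal_norm, norm_mul, norm_exp_I_mul, norm_mul, Complex.norm_I, Complex.norm_real,
      one_mul, mul_one, ofReal_norm]

/-- Weighted mean squared error. -/
lemma lintegral_weighted_errSq_le [IsProbabilityMeasure μ] (h : IncrementLaw P φ x₀ Δ k ε C)
    (hX : IsSample X μ P)
    {A : ℝ≥0∞} {n : ℕ}
    (hA : ∀ u, ∫⁻ ω, ENNReal.ofReal (errSq φ (fun k ↦ X k ω) n u) ∂μ ≤ (n : ℝ≥0∞)⁻¹ * A)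
    {w : ℝ → ℝ≥0∞} (hw : AEMeasurable w) :
    ∫⁻ ω, ∫⁻ u, w u * ENNReal.ofReal (errSq φ (fun k ↦ X k ω) n u) ∂volume ∂μ ≤
      (n : ℝ≥0∞)⁻¹ * A * ∫⁻ u, w u := by
  have hm := (measurable_errSq_uncurry h hX.measurable n).ennreal_ofReal
  have hj : AEMeasurable (Function.uncurry fun (ω : Ω) (u : ℝ) ↦
      w u * ENNReal.ofReal (errSq φ (fun k ↦ X k ω) n u)) (μ.prod volume) :=
    hw.comp_snd.mul hm.aemeasurable
  rw [lintegral_lintegral_swap hj, mul_comm, ← lintegral_mul_const'' _ hw]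
  refine lintegral_mono fun u ↦ ?_
  have hp : Measurable fun ω : Ω ↦ (ω, u) := by fun_prop
  have hmu : Measurable fun ω ↦ ENNReal.ofReal (errSq φ (fun k ↦ X k ω) n u) :=
    ((measurable_errSq_uncurry h hX.measurable n).comp hp).ennreal_ofReal
  rw [lintegral_const_mul _ hmu]
  exact mul_le_mul' le_rfl (hA u)

end

end

end LevyCLT

namespace LevyCLT

noncomputable section

/-! ### The ratio of the empirical and the true characteristic function -/

/-- A Sobolev inequality: f(u)² is the integral of 2ff' from 0 to u, and 2|ff'| ≤ |f|² + |f'|². It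
turns mean square bounds at single frequencies into a uniform bound, with no loss from the length of
the interval. -/
lemma sq_norm_le_setIntegral {f f' : ℝ → ℂ} (hf : ∀ u, HasDerivAt f (f' u) u)
    (hf' : Continuous f') (h0 : f 0 = 0) {M u : ℝ} (hu : |u| ≤ M) :
    ‖f u‖ ^ 2 ≤ ∫ v in Set.Icc (-M) M, (‖f v‖ ^ 2 + ‖f' v‖ ^ 2) := by
  have hc : Continuous f := continuous_iff_continuousAt.2 fun u ↦ (hf u).continuousAt
  have h1 : ∫ v in (0 : ℝ)..u, 2 * f v * f' v = f u ^ 2 := by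
    have := intervalIntegral.integral_eq_sub_of_hasDerivAt (a := 0) (b := u)
      (f := fun v ↦ f v ^ 2) (f' := fun v ↦ 2 * f v * f' v) (fun v _ ↦ by
        have := (hf v).fun_pow 2
        simpa using this)
      ((by fun_prop : Continuous fun v ↦ 2 * f v * f' v).intervalIntegrable _ _)
    rw [this, h0]; ring
  have hcont : Continuous fun v ↦ ‖f v‖ ^ 2 + ‖f' v‖ ^ 2 := by fun_prop
  rw [← norm_pow, ← h1]
  refine intervalIntegral.norm_integral_le_integral_norm_uIoc.trans ?_
  have hsub : Set.uIoc 0 u ⊆ Set.Icc (-M) M := by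
    intro v hv
    rw [Set.mem_uIoc] at hv
    rw [abs_le] at hu
    constructor <;> rcases hv with hv | hv <;> linarith [hv.1, hv.2]
  calc _ ≤ ∫ v in Set.uIoc 0 u, (‖f v‖ ^ 2 + ‖f' v‖ ^ 2) := by
        refine integral_mono_of_nonneg (ae_of_all _ fun v ↦ norm_nonneg _)
          (hcont.continuousOn.integrableOn_Icc.mono_set hsub) (ae_of_all _ fun v ↦ ?_)
        simp only [norm_mul, RCLike.norm_ofNat]
        linarith [sq_nonneg (‖f v‖ - ‖f' v‖)]
    _ ≤ _ := setIntegral_mono_set hcont.continuousOn.integrableOn_Icc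
        (ae_of_all _ fun v ↦ by positivity) hsub.eventuallyLE

/-- The relative error of the empirical characteristic function. -/
def relErr (φ : ℝ → ℂ) (x : ℕ → ℝ) (n : ℕ) (u : ℝ) : ℂ := empCharFun x n u * (φ u)⁻¹ - 1

/-- The derivative of the relative error. -/
def relErrDeriv (φ : ℝ → ℂ) (x : ℕ → ℝ) (n : ℕ) (x₀ Δ : ℝ) (k : ℝ → ℝ) (u : ℝ) : ℂ :=
  (empCharFunDeriv x n u - Complex.I * (x₀ + Δ * ft (fun x ↦ (k x : ℂ)) u) * empCharFun x n u) *
    (φ u)⁻¹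

section

variable {P : Measure ℝ} {φ : ℝ → ℂ} {x₀ Δ : ℝ} {k : ℝ → ℝ} {ε C C₁ C₂ : ℝ} {G a b H : ℝ → ℂ}
  {x : ℕ → ℝ} {n : ℕ}

lemma hasDerivAt_relErr (h : IncrementLaw P φ x₀ Δ k ε C) (x : ℕ → ℝ) (n : ℕ) (u : ℝ) :
    HasDerivAt (relErr φ x n) (relErrDeriv φ x n x₀ Δ k u) u := by
  have := ((hasDerivAt_empCharFun x n u).mul (h.hasDerivAt_inv u)).sub_const 1
  refine this.congr_deriv ?_
  rw [relErrDeriv]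
  ring

lemma continuous_relErrDeriv (h : IncrementLaw P φ x₀ Δ k ε C) (x : ℕ → ℝ) (n : ℕ) :
    Continuous (relErrDeriv φ x n x₀ Δ k) := by
  have h1 := continuous_empCharFun x n
  have h2 := continuous_empCharFunDeriv x n
  have h3 := h.continuous_inv
  have h4 := h.continuous_ft
  unfold relErrDeriv
  fun_prop

lemma relErr_zero (h : IncrementLaw P φ x₀ Δ k ε C) (x : ℕ → ℝ) (hn : n ≠ 0) :
    relErr φ x n 0 = 0 := by
  have := h.prob
  rw [relErr, empCharFun_zero x hn, h.charFun_eq, charFun_zero]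
  simp

lemma empCharFun_eq_mul (h : IncrementLaw P φ x₀ Δ k ε C) (x : ℕ → ℝ) (n : ℕ) (u : ℝ) :
    empCharFun x n u = φ u * (1 + relErr φ x n u) := by
  have := h.ne_zero u
  rw [relErr]; field_simp; ring

lemma empCharFunDeriv_eq (h : IncrementLaw P φ x₀ Δ k ε C) (x : ℕ → ℝ) (n : ℕ) (u : ℝ) :
    empCharFunDeriv x n u = φ u * (Complex.I * (x₀ + Δ * ft (fun x ↦ (k x : ℂ)) u) *
      (1 + relErr φ x n u) + relErrDeriv φ x n x₀ Δ k u) := by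
  have := h.ne_zero u
  rw [relErr, relErrDeriv]; field_simp; ring

/-- With the bounded function D = φ'/φ, the numerator of f' is (φ_n' − φ') − D(φ_n − φ). Hence f and
f' are both controlled by |φ|⁻¹ times the errors of φ_n and φ_n'. -/
lemma norm_relErr_sq_add_le (h : IncrementLaw P φ x₀ Δ k ε C) (x : ℕ → ℝ) (n : ℕ) (u : ℝ) :
    ‖relErr φ x n u‖ ^ 2 + ‖relErrDeriv φ x n x₀ Δ k u‖ ^ 2 ≤
      (2 + 2 * (|x₀| + Δ * C) ^ 2) * (‖(φ u)⁻¹‖ ^ 2 * errSq φ x n u) := by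
  have hD := h.norm_logDeriv_le u
  have e1 : relErr φ x n u = (empCharFun x n u - φ u) * (φ u)⁻¹ := by
    rw [relErr, sub_mul, mul_inv_cancel₀ (h.ne_zero u)]
  have e2 : relErrDeriv φ x n x₀ Δ k u = ((empCharFunDeriv x n u - deriv φ u) -
      Complex.I * (x₀ + Δ * ft (fun x ↦ (k x : ℂ)) u) * (empCharFun x n u - φ u)) * (φ u)⁻¹ := by
    rw [relErrDeriv, h.deriv_eq]; ring
  rw [e1, e2, errSq, norm_mul, norm_mul, mul_pow, mul_pow]
  set B := |x₀| + Δ * C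
  set d₀ := ‖empCharFun x n u - φ u‖
  set q := ‖(φ u)⁻¹‖
  have h1 : ‖(empCharFunDeriv x n u - deriv φ u) -
      Complex.I * (x₀ + Δ * ft (fun x ↦ (k x : ℂ)) u) * (empCharFun x n u - φ u)‖ ≤
      ‖empCharFunDeriv x n u - deriv φ u‖ + B * d₀ := by
    refine (norm_sub_le _ _).trans ?_
    rw [norm_mul]
    gcongr
  set d₁ := ‖empCharFunDeriv x n u - deriv φ u‖
  have hB : 0 ≤ B := (norm_nonneg _).trans hD
  calc _ ≤ d₀ ^ 2 * q ^ 2 + (d₁ + B * d₀) ^ 2 * q ^ 2 := by gcongr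
    _ ≤ d₀ ^ 2 * q ^ 2 + (2 * d₁ ^ 2 + 2 * B ^ 2 * d₀ ^ 2) * q ^ 2 := by
        gcongr
        nlinarith [sq_nonneg (d₁ - B * d₀)]
    _ ≤ _ := by
        have : 0 ≤ q ^ 2 * (d₀ ^ 2 + 2 * B ^ 2 * d₁ ^ 2) := by positivity
        nlinarith

/-- The event on which the empirical characteristic function is close to the true one. -/
def GoodSample (φ : ℝ → ℂ) (B : ℝ) (x : ℕ → ℝ) (n : ℕ) (η : ℝ) : Prop :=
  ∫ u in Set.Icc (-η⁻¹) η⁻¹, ‖(φ u)⁻¹‖ ^ 2 * errSq φ x n u ≤ (4 * (2 + 2 * B ^ 2))⁻¹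

/-- The threshold in `GoodSample` is chosen so that the Sobolev bound becomes |f|² ≤ 1/4. -/
lemma GoodSample.norm_relErr_le (h : IncrementLaw P φ x₀ Δ k ε C) (hn : n ≠ 0) {η : ℝ}
    (hx : GoodSample φ (|x₀| + Δ * C) x n η) {u : ℝ} (hu : |u| ≤ η⁻¹) : ‖relErr φ x n u‖ ≤ 1 / 2 := by
  have h1 := sq_norm_le_setIntegral (hasDerivAt_relErr h x n) (continuous_relErrDeriv h x n)
    (relErr_zero h x hn) hu
  have hc0 : Continuous fun u ↦ ‖(φ u)⁻¹‖ ^ 2 * errSq φ x n u :=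
    (h.continuous_inv.norm.pow 2).mul (h.continuous_errSq x n)
  have h2 : ∫ v in Set.Icc (-η⁻¹) η⁻¹, (‖relErr φ x n v‖ ^ 2 + ‖relErrDeriv φ x n x₀ Δ k v‖ ^ 2) ≤
      (2 + 2 * (|x₀| + Δ * C) ^ 2) * (4 * (2 + 2 * (|x₀| + Δ * C) ^ 2))⁻¹ := by
    refine le_trans ?_ (mul_le_mul_of_nonneg_left hx (by positivity))
    rw [← integral_const_mul]
    exact integral_mono_of_nonneg (ae_of_all _ fun v ↦ by positivity)
      ((hc0.const_mul _).continuousOn.integrableOn_Icc)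
      (ae_of_all _ fun v ↦ norm_relErr_sq_add_le h x n v)
  have h3 : (2 + 2 * (|x₀| + Δ * C) ^ 2) * (4 * (2 + 2 * (|x₀| + Δ * C) ^ 2))⁻¹ = 1 / 4 := by
    have : 0 < 2 + 2 * (|x₀| + Δ * C) ^ 2 := by positivity
    field_simp
  rw [h3] at h2
  nlinarith [norm_nonneg (relErr φ x n u)]

lemma GoodSample.one_add_relErr_ne_zero (h : IncrementLaw P φ x₀ Δ k ε C) (hn : n ≠ 0) {η : ℝ}
    (hx : GoodSample φ (|x₀| + Δ * C) x n η) {u : ℝ} (hu : |u| ≤ η⁻¹) : 1 + relErr φ x n u ≠ 0 := by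
  intro h0
  have h1 := hx.norm_relErr_le h hn hu
  have : relErr φ x n u = -1 := by linear_combination h0
  rw [this] at h1
  norm_num at h1

lemma GoodSample.empCharFun_ne_zero (h : IncrementLaw P φ x₀ Δ k ε C) (hn : n ≠ 0) {η : ℝ}
    (hx : GoodSample φ (|x₀| + Δ * C) x n η) {u : ℝ} (hu : |u| ≤ η⁻¹) : empCharFun x n u ≠ 0 := by
  rw [empCharFun_eq_mul h]
  exact mul_ne_zero (h.ne_zero u) (hx.one_add_relErr_ne_zero h hn hu)

/-! ### Linearization of the estimator -/

lemma integrable_memLp_of_continuousOn_Icc {N : ℝ → ℂ} {M : ℝ} (hN : Measurable N)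
    (hc : ContinuousOn N (Set.Icc (-M) M)) (h0 : ∀ u, M < |u| → N u = 0) :
    Integrable N ∧ MemLp N 2 := by
  obtain ⟨B, hB⟩ := isCompact_Icc.exists_bound_of_continuousOn hc
  have hle : ∀ u, ‖N u‖ ≤ B * ‖(Set.Icc (-M) M).indicator (fun _ ↦ (1 : ℝ)) u‖ := fun u ↦ by
    by_cases hu : u ∈ Set.Icc (-M) M
    · rw [Set.indicator_of_mem hu, norm_one, mul_one]
      exact hB u hu
    · rw [Set.indicator_of_notMem hu, h0, norm_zero]
      · simp
      · by_contra hcon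
        exact hu (abs_le.1 (not_lt.1 hcon))
  have m : ∀ p : ℝ≥0∞, MemLp N p := fun p ↦
    MemLp.of_le_mul (memLp_indicator_const p measurableSet_Icc 1 (Or.inr (by simp)))
      hN.aestronglyMeasurable (ae_of_all _ hle)
  exact ⟨memLp_one_iff_integrable.1 (m 1), m 2⟩

lemma integrable_smoothInfluence_integrand (h : IncrementLaw P φ x₀ Δ k ε C)
    (hG : FourierSplit G a b C₁) (hH : KernelTransform H C₂) {η : ℝ} (hη : 0 < η) (y : ℝ) :
    Integrable fun u : ℝ ↦ G u * (φ (-u))⁻¹ * H (η * -u) * (Complex.exp (-(Complex.I * u * y)) *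
      (Complex.I * (y - x₀) - Complex.I * Δ * ft (fun x ↦ (k x : ℂ)) (-u))) := by
  have i1 := (integrable_exp_neg_mul (hH.integrable_mul hη (memLp_symbol h hG)) y).const_mul
    (Complex.I * (y - x₀))
  have i2 := (integrable_exp_neg_mul (hH.integrable_mul hη (memLp_symbolKappa h hG)) y).const_mul
    (Complex.I * Δ)
  refine (i1.sub i2).congr (ae_of_all _ fun u ↦ ?_)
  simp only [symbolKappa, Pi.sub_apply]
  ring

/-- f' is linear in the empirical measure. Integrated against the test symbol, each summand becomes
the influence function at one observation. -/
lemma relErrDeriv_neg_eq (x : ℕ → ℝ) (n : ℕ) (u : ℝ) :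
    relErrDeriv φ x n x₀ Δ k (-u) = (n : ℂ)⁻¹ * ∑ j ∈ Finset.range n,
      (φ (-u))⁻¹ * (Complex.exp (-(Complex.I * u * x j)) *
        (Complex.I * (x j - x₀) - Complex.I * Δ * ft (fun x ↦ (k x : ℂ)) (-u))) := by
  rw [relErrDeriv, empCharFun_eq, empCharFunDeriv, mul_left_comm _ (n : ℂ)⁻¹, ← mul_sub,
    mul_assoc, Finset.mul_sum, ← Finset.sum_sub_distrib, Finset.sum_mul]
  congr 1
  refine Finset.sum_congr rfl fun j _ ↦ ?_
  have : Complex.I * (-u : ℝ) * x j = -(Complex.I * u * x j) := by push_cast; ring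
  rw [this]
  ring

lemma integral_mul_relErrDeriv (h : IncrementLaw P φ x₀ Δ k ε C)
    (hG : FourierSplit G a b C₁) (hH : KernelTransform H C₂) {η : ℝ} (hη : 0 < η) (x : ℕ → ℝ)
    (n : ℕ) : Integrable (fun u ↦ G u * H (η * -u) * relErrDeriv φ x n x₀ Δ k (-u)) ∧
    (2 * (Real.pi : ℂ))⁻¹ * ∫ u, G u * H (η * -u) * relErrDeriv φ x n x₀ Δ k (-u) =
      (n : ℂ)⁻¹ * ∑ j ∈ Finset.range n, smoothInfluence G φ H k x₀ Δ η (x j) := by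
  have e : (fun u ↦ G u * H (η * -u) * relErrDeriv φ x n x₀ Δ k (-u)) = fun u : ℝ ↦
      (n : ℂ)⁻¹ * ∑ j ∈ Finset.range n, G u * (φ (-u))⁻¹ * H (η * -u) *
        (Complex.exp (-(Complex.I * u * x j)) *
        (Complex.I * (x j - x₀) - Complex.I * Δ * ft (fun x ↦ (k x : ℂ)) (-u))) := by
    ext u
    rw [relErrDeriv_neg_eq, mul_left_comm, Finset.mul_sum]
    congr 1
    refine Finset.sum_congr rfl fun j _ ↦ ?_
    ring
  have hi := fun j ↦ integrable_smoothInfluence_integrand h hG hH hη (x j)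
  rw [e]
  refine ⟨(integrable_finsetSum _ fun j _ ↦ hi j).const_mul _, ?_⟩
  rw [integral_const_mul, integral_finsetSum _ fun j _ ↦ hi j, mul_left_comm, Finset.mul_sum]
  simp_rw [smoothInfluence_eq_integral h hG hH hη]

/-- The non-random part of the estimator with bandwidth `η`. -/
def centre (G H : ℝ → ℂ) (k : ℝ → ℝ) (x₀ Δ η : ℝ) : ℂ :=
  (Complex.I * Δ)⁻¹ * ((2 * (Real.pi : ℂ))⁻¹ *
    ∫ u, G u * H (η * -u) * (Complex.I * (x₀ + Δ * ft (fun x ↦ (k x : ℂ)) (-u))))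

/-- With f the relative error and D = φ'/φ, the identity φ_n'/φ_n = D + f' − ff'/(1 + f) is exact.
After Parseval, D gives the deterministic centre and f' the sample mean of influence functions; only
the quadratic term has to be bounded. -/
lemma enorm_estimator_sub_le (h : IncrementLaw P φ x₀ Δ k ε C) {g K : ℝ → ℝ}
    (hg : MemLp (fun x ↦ (g x : ℂ)) 2) (hG : FourierSplit (ftL2 fun x ↦ (g x : ℂ)) a b C₁)
    (hH : KernelTransform (ft fun x ↦ (K x : ℂ)) C₂) {η : ℝ} (hη : 0 < η) (hn : n ≠ 0)
    (hx : GoodSample φ (|x₀| + Δ * C) x n η) :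
    ‖estimator K Δ g x n η - (centre (ftL2 fun x ↦ (g x : ℂ)) (ft fun x ↦ (K x : ℂ)) k x₀ Δ η +
      (Complex.I * Δ)⁻¹ * ((n : ℂ)⁻¹ * ∑ j ∈ Finset.range n,
        smoothInfluence (ftL2 fun x ↦ (g x : ℂ)) φ (ft fun x ↦ (K x : ℂ)) k x₀ Δ η (x j)))‖ₑ ≤
      ‖(Complex.I * (Δ : ℂ))⁻¹‖ₑ * (ENNReal.ofReal (C₂ * (2 + 2 * (|x₀| + Δ * C) ^ 2)) *
        ∫⁻ u in Set.Icc (-η⁻¹) η⁻¹, ‖ftL2 (fun x ↦ (g x : ℂ)) (-u)‖ₑ * ‖(φ u)⁻¹‖ₑ ^ 2 *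
          ENNReal.ofReal (errSq φ x n u)) := by
  set G := ftL2 fun x ↦ (g x : ℂ) with hGdef
  set H := ft fun x ↦ (K x : ℂ) with hHdef
  have hC₂ := hH.one_le
  have hH0 : ∀ u, η⁻¹ < |u| → H (η * u) = 0 := fun u hu ↦ by
    refine hH.eq_zero _ ?_
    rw [abs_mul, abs_of_pos hη]
    rw [inv_lt_iff_one_lt_mul₀' hη] at hu
    exact hu
  let N : ℝ → ℂ := fun u ↦ empCharFunDeriv x n u / empCharFun x n u * H (η * u)
  have hNc := continuous_empCharFun x n
  have hNd := continuous_empCharFunDeriv x n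
  have hHc : Continuous fun u ↦ H (η * u) := hH.continuous.comp (by fun_prop)
  -- On the good event the quotient is continuous on the support of the cut-off, which places the
  -- integrand in L¹ and L² and makes Parseval applicable.
  obtain ⟨hN1, hN2⟩ : Integrable N ∧ MemLp N 2 := by
    refine integrable_memLp_of_continuousOn_Icc (M := η⁻¹)
      ((hNd.measurable.div hNc.measurable).mul hHc.measurable) ?_ fun u hu ↦ ?_
    · refine (ContinuousOn.div hNd.continuousOn hNc.continuousOn fun u hu ↦ ?_).mul hHc.continuousOn
      exact hx.empCharFun_ne_zero h hn (abs_le.2 hu)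
    · simp only [N, hH0 u hu, mul_zero]
  have hest : estimator K Δ g x n η =
      (Complex.I * Δ)⁻¹ * ((2 * (Real.pi : ℂ))⁻¹ * ∫ u, G u * N (-u)) := by
    rw [estimator, ← integral_mul_invFt hg hN1 hN2]
    congr 2
    ext y
    congr 2
    ext u
    rw [deriv_empCharFun, ft_scaledKernel K hη]
  let D : ℝ → ℂ := fun u ↦ Complex.I * (x₀ + Δ * ft (fun x ↦ (k x : ℂ)) (-u))
  let ρ : ℝ → ℂ := fun u ↦ -(G (-u) * H (η * u) * (relErrDeriv φ x n x₀ Δ k u *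
    relErr φ x n u / (1 + relErr φ x n u)))
  have hGm := memLp_ftL2 hg
  obtain ⟨i2, e2⟩ := integral_mul_relErrDeriv h hG hH hη x n
  have i1 : Integrable fun u ↦ G u * H (η * -u) * D u := by
    have hκ := continuous_ft_neg h
    refine (hH.integrable_mul hη hGm).mul_bdd (c := |x₀| + Δ * C)
      (by fun_prop : Continuous _).aestronglyMeasurable
      (ae_of_all _ fun u ↦ h.norm_logDeriv_le (-u))
  have i0 : Integrable fun u ↦ G u * N (-u) := MemLp.integrable_mul hGm (memLp_comp_neg hN2)
  have hpt : ∀ u, G u * N (-u) = G u * H (η * -u) * D u +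
      G u * H (η * -u) * relErrDeriv φ x n x₀ Δ k (-u) + ρ (-u) := fun u ↦ by
    simp only [N, ρ, D, neg_neg]
    -- Outside the band every term carries a vanishing cut-off, whatever value the quotient takes.
    by_cases hu : |u| ≤ η⁻¹
    · have h1 := hx.one_add_relErr_ne_zero h hn (u := -u) (by rwa [abs_neg])
      have h2 := h.ne_zero (-u)
      rw [empCharFunDeriv_eq h, empCharFun_eq_mul h]
      field_simp
      ring
    · rw [hH0 (-u) (by rw [abs_neg]; exact not_le.1 hu)]
      ring
  have i3 : Integrable fun u ↦ ρ (-u) := by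
    refine (i0.sub (i1.add i2)).congr (ae_of_all _ fun u ↦ ?_)
    simp only [Pi.sub_apply, Pi.add_apply, hpt u]
    ring
  have i12 : Integrable fun u ↦ G u * H (η * -u) * D u +
      G u * H (η * -u) * relErrDeriv φ x n x₀ Δ k (-u) := i1.add i2
  have hsplit : ∫ u, G u * N (-u) = (∫ u, G u * H (η * -u) * D u) +
      (∫ u, G u * H (η * -u) * relErrDeriv φ x n x₀ Δ k (-u)) + ∫ u, ρ u := by
    rw [← integral_neg_eq_self ρ, ← integral_add i1 i2, ← integral_add i12 i3]
    exact integral_congr_ae (ae_of_all _ hpt)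
  have hfin : estimator K Δ g x n η - (centre G H k x₀ Δ η + (Complex.I * Δ)⁻¹ * ((n : ℂ)⁻¹ *
      ∑ j ∈ Finset.range n, smoothInfluence G φ H k x₀ Δ η (x j))) =
      (Complex.I * Δ)⁻¹ * ((2 * (Real.pi : ℂ))⁻¹ * ∫ u, ρ u) := by
    rw [hest, hsplit, ← e2, centre]
    ring
  rw [hfin, enorm_mul, enorm_mul]
  refine mul_le_mul' le_rfl ?_
  have hpi : ‖(2 * (Real.pi : ℂ))⁻¹‖ₑ ≤ 1 := by
    rw [← ofReal_norm, norm_inv_two_pi]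
    exact ENNReal.ofReal_le_one.2 inv_two_pi_le_one
  calc _ ≤ 1 * ∫⁻ u, ‖ρ u‖ₑ := mul_le_mul' hpi (enorm_integral_le_lintegral_enorm _)
    _ = ∫⁻ u in Set.Icc (-η⁻¹) η⁻¹, ‖ρ u‖ₑ := by
        rw [one_mul, ← lintegral_indicator measurableSet_Icc]
        refine lintegral_congr fun u ↦ ?_
        by_cases hu : u ∈ Set.Icc (-η⁻¹) η⁻¹
        · rw [Set.indicator_of_mem hu]
        · rw [Set.indicator_of_notMem hu]
          have : η⁻¹ < |u| := by
            by_contra hcon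
            exact hu (abs_le.1 (not_lt.1 hcon))
          simp [ρ, hH0 u this]
    _ ≤ ∫⁻ u in Set.Icc (-η⁻¹) η⁻¹, ENNReal.ofReal (C₂ * (2 + 2 * (|x₀| + Δ * C) ^ 2)) *
        (‖G (-u)‖ₑ * ‖(φ u)⁻¹‖ₑ ^ 2 * ENNReal.ofReal (errSq φ x n u)) := by
        refine setLIntegral_mono' measurableSet_Icc fun u hu ↦ ?_
        have hu' := abs_le.2 hu
        rw [← ofReal_norm, ← ofReal_norm (G (-u)), ← ofReal_norm (φ u)⁻¹,
          ← ENNReal.ofReal_pow (norm_nonneg _), ← ENNReal.ofReal_mul (norm_nonneg _),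
          ← ENNReal.ofReal_mul (by positivity), ← ENNReal.ofReal_mul (by positivity)]
        refine ENNReal.ofReal_le_ofReal ?_
        have r1 := hx.norm_relErr_le h hn hu'
        have r2 : 1 / 2 ≤ ‖1 + relErr φ x n u‖ := by
          have := norm_sub_le (1 + relErr φ x n u) (relErr φ x n u)
          rw [add_sub_cancel_right, norm_one] at this
          linarith
        have r3 := norm_relErr_sq_add_le h x n u
        simp only [ρ, norm_neg, norm_mul, norm_div]
        set f := ‖relErr φ x n u‖
        set f' := ‖relErrDeriv φ x n x₀ Δ k u‖
        have hf : 0 ≤ f := norm_nonneg _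
        have hf' : 0 ≤ f' := norm_nonneg _
        -- As |1 + f| ≥ 1/2, the left side is at most 2|ff'|.
        have r4 : f' * f / ‖1 + relErr φ x n u‖ ≤ f ^ 2 + f' ^ 2 := by
          rw [div_le_iff₀ (by linarith)]
          nlinarith [sq_nonneg (f - f'), mul_nonneg hf hf', sq_nonneg f, sq_nonneg f',
            mul_le_mul_of_nonneg_left r2 (add_nonneg (sq_nonneg f) (sq_nonneg f'))]
        calc _ ≤ ‖G (-u)‖ * C₂ * (f ^ 2 + f' ^ 2) := by
              gcongr
              exact hH.norm_le _
          _ ≤ ‖G (-u)‖ * C₂ * ((2 + 2 * (|x₀| + Δ * C) ^ 2) * (‖(φ u)⁻¹‖ ^ 2 * errSq φ x n u)) := by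
              gcongr
          _ = _ := by ring
    _ = _ := lintegral_const_mul' _ _ (by finiteness)

end

end

end LevyCLT

namespace LevyCLT

noncomputable section

/-! ### Parseval's identity for real functions -/

lemma integral_sq_norm_ftL2 {f : ℝ → ℂ} (hf : MemLp f 2) :
    ∫ u, ‖ftL2 f u‖ ^ 2 = 2 * Real.pi * ∫ x, ‖f x‖ ^ 2 := by
  have key : ∀ {F : ℝ → ℂ}, MemLp F 2 → ∫ u, ‖F u‖ ^ 2 = (∫⁻ u, ‖F u‖ₑ ^ 2).toReal := fun {F} hF ↦ by
    rw [integral_eq_lintegral_of_nonneg_ae (ae_of_all _ fun u ↦ sq_nonneg _) (hF.1.norm.pow 2)]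
    congr 1
    refine lintegral_congr fun u ↦ ?_
    rw [ENNReal.ofReal_pow (norm_nonneg _), ofReal_norm]
  rw [key (memLp_ftL2 hf), key hf, lintegral_sq_ftL2 hf, ENNReal.toReal_mul,
    ENNReal.toReal_ofReal (by positivity)]

lemma integral_sq_norm_add {f k : ℝ → ℂ} (hf : MemLp f 2) (hk : MemLp k 2) :
    ∫ x, ‖f x + k x‖ ^ 2 = (∫ x, ‖f x‖ ^ 2) + (∫ x, ‖k x‖ ^ 2) +
      2 * (∫ x, f x * starRingEnd ℂ (k x)).re := by
  have hk' : MemLp (fun x ↦ starRingEnd ℂ (k x)) 2 := hk.star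
  have i1 : Integrable fun x ↦ ‖f x‖ ^ 2 := hf.integrable_norm_pow (by norm_num)
  have i2 : Integrable fun x ↦ ‖k x‖ ^ 2 := hk.integrable_norm_pow (by norm_num)
  have i3 : Integrable fun x ↦ f x * starRingEnd ℂ (k x) := MemLp.integrable_mul hf hk'
  have e : (∫ x, f x * starRingEnd ℂ (k x)).re = ∫ x, (f x * starRingEnd ℂ (k x)).re :=
    (integral_re i3).symm
  have i12 : Integrable fun x ↦ ‖f x‖ ^ 2 + ‖k x‖ ^ 2 := i1.add i2
  have i4 : Integrable fun x ↦ 2 * (f x * starRingEnd ℂ (k x)).re := i3.re.const_mul 2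
  rw [e, ← integral_const_mul, ← integral_add i1 i2, ← integral_add i12 i4]
  refine integral_congr_ae (ae_of_all _ fun x ↦ ?_)
  simp only [Complex.sq_norm, Complex.normSq_add]

/-- Parseval's identity for two real functions, one of which is integrable. -/
lemma re_integral_ftL2_mul_ft {f k : ℝ → ℝ} (hf : MemLp (fun x ↦ (f x : ℂ)) 2)
    (hk : MemLp (fun x ↦ (k x : ℂ)) 2) (hk1 : Integrable k) :
    (∫ u, ftL2 (fun x ↦ (f x : ℂ)) u * ft (fun x ↦ (k x : ℂ)) (-u)).re =
      2 * Real.pi * ∫ x, f x * k x := by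
  have hFk : ftL2 (fun x ↦ (k x : ℂ)) =ᵐ[volume] ft (fun x ↦ (k x : ℂ)) :=
    ftL2_eq_ft hk1.ofReal hk
  have e0 : ∫ u, ftL2 (fun x ↦ (f x : ℂ)) u * ft (fun x ↦ (k x : ℂ)) (-u) =
      ∫ u, ftL2 (fun x ↦ (f x : ℂ)) u * starRingEnd ℂ (ftL2 (fun x ↦ (k x : ℂ)) u) := by
    refine integral_congr_ae ?_
    filter_upwards [hFk] with u hu
    rw [hu, ft_neg_of_real]
  -- Polarization: Plancherel for the sum, compared with Plancherel for each function, leaves the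
  -- real part of the inner product.
  have h1 := integral_sq_norm_add (memLp_ftL2 hf) (memLp_ftL2 hk)
  have h2 := integral_sq_norm_add hf hk
  have h3 := integral_sq_norm_ftL2 (hf.add hk)
  have h4 : ∫ u, ‖ftL2 ((fun x ↦ (f x : ℂ)) + fun x ↦ (k x : ℂ)) u‖ ^ 2 =
      ∫ u, ‖ftL2 (fun x ↦ (f x : ℂ)) u + ftL2 (fun x ↦ (k x : ℂ)) u‖ ^ 2 := by
    refine integral_congr_ae ?_
    filter_upwards [ftL2_add hf hk] with u hu
    rw [← hu]; rfl
  have h5 : (∫ x, (f x : ℂ) * starRingEnd ℂ (k x : ℂ)).re = ∫ x, f x * k x := by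
    have : ∀ x, (f x : ℂ) * starRingEnd ℂ (k x : ℂ) = ((f x * k x : ℝ) : ℂ) := fun x ↦ by
      rw [Complex.conj_ofReal]; push_cast; rfl
    simp_rw [this]
    rw [integral_complex_ofReal, Complex.ofReal_re]
  rw [h4, h1, integral_sq_norm_ftL2 hf, integral_sq_norm_ftL2 hk] at h3
  simp only [Pi.add_apply] at h3
  rw [h2, h5] at h3
  rw [e0]
  linarith

/-! ### Smoothing bias -/

/-- Near 0 this is the Lipschitz condition. For |x| ≥ δ the bounded increment is at most (M + |g
0|)/δ times |x|. -/
lemma IsAdmissible.exists_abs_sub_le {g : ℝ → ℝ} (hg : IsAdmissible g) :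
    ∃ A : ℝ, 0 ≤ A ∧ ∀ᵐ x, |g x - g 0| ≤ A * |x| := by
  obtain ⟨c, U, hU, hc⟩ := hg.lipschitz_near_zero
  obtain ⟨δ, hδ, hball⟩ := Metric.mem_nhds_iff.1 hU
  let M : ℝ := (eLpNormEssSup g volume).toReal
  have hM : ∀ᵐ x, |g x| ≤ M := by
    have hfin : eLpNormEssSup g volume ≠ ∞ := by
      have := hg.bounded.2
      rw [eLpNorm_exponent_top] at this
      exact this.ne
    filter_upwards [ae_le_eLpNormEssSup (f := g) (μ := volume)] with x hx
    have := ENNReal.toReal_mono hfin hx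
    rwa [toReal_enorm, Real.norm_eq_abs] at this
  have hM0 : 0 ≤ M := ENNReal.toReal_nonneg
  refine ⟨c + (M + |g 0|) / δ, by positivity, ?_⟩
  filter_upwards [hM] with x hx
  have hA : 0 ≤ (M + |g 0|) / δ := by positivity
  by_cases hxδ : |x| < δ
  · have h1 := hc.dist_le_mul x (hball (by simpa [Real.dist_eq] using hxδ)) 0
      (hball (Metric.mem_ball_self hδ))
    rw [Real.dist_eq, Real.dist_eq, sub_zero] at h1
    nlinarith [abs_nonneg x]
  · have h1 := abs_sub (g x) (g 0)
    have h2 : M + |g 0| ≤ (M + |g 0|) / δ * |x| := by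
      rw [div_mul_eq_mul_div, le_div_iff₀ hδ]
      gcongr
      exact not_lt.1 hxδ
    have h3 : 0 ≤ (c : ℝ) * |x| := by positivity
    linarith [h1]

lemma integral_scaledKernel (K : ℝ → ℝ) {η : ℝ} (hη : 0 < η) :
    ∫ x, scaledKernel K η x = ∫ x, K x := by
  simp only [scaledKernel]
  rw [integral_const_mul, Measure.integral_comp_div, abs_of_pos hη, smul_eq_mul,
    inv_mul_cancel_left₀ hη.ne']

lemma IsKernel.integrable_scaledKernel {K : ℝ → ℝ} (hK : IsKernel K) {η : ℝ} (hη : 0 < η) :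
    Integrable (scaledKernel K η) :=
  (hK.integrable.comp_div hη.ne').const_mul _

lemma IsKernel.memLp_scaledKernel {K : ℝ → ℝ} (hK : IsKernel K) {η : ℝ} (hη : 0 < η) :
    MemLp (scaledKernel K η) 2 := by
  obtain ⟨B, hB⟩ := hK.abs_le
  have hi := hK.integrable_scaledKernel hη
  rw [memLp_two_iff_integrable_sq hi.1]
  refine (hi.norm.const_mul (η⁻¹ * B)).mono' (hi.1.pow 2) (ae_of_all _ fun x ↦ ?_)
  have h1 : ‖scaledKernel K η x‖ ≤ η⁻¹ * B := by
    rw [scaledKernel, norm_mul, Real.norm_of_nonneg (by positivity), Real.norm_eq_abs]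
    gcongr
    exact hB _
  rw [norm_pow, sq]
  gcongr

/-- The first absolute moment of the scaled kernel is η times that of `K`, and g(x) − g(0) = O(|x|).
-/
lemma IsAdmissible.exists_abs_integral_scaledKernel_sub_le {g K : ℝ → ℝ} (hg : IsAdmissible g)
    (hK : IsKernel K) :
    ∃ A : ℝ, 0 ≤ A ∧ ∀ η : ℝ, 0 < η → |(∫ x, g x * scaledKernel K η x) - g 0| ≤ A * η := by
  obtain ⟨A, hA, hle⟩ := hg.exists_abs_sub_le
  refine ⟨A * ∫ x, |x| * |K x|, mul_nonneg hA (integral_nonneg fun x ↦ by positivity),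
    fun η hη ↦ ?_⟩
  have hi := hK.integrable_scaledKernel hη
  have hi2 : Integrable fun x ↦ g x * scaledKernel K η x :=
    MemLp.integrable_mul hg.square_integrable (hK.memLp_scaledKernel hη)
  have e1 : (∫ x, g x * scaledKernel K η x) - g 0 = ∫ x, (g x - g 0) * scaledKernel K η x := by
    simp_rw [sub_mul]
    rw [integral_sub hi2 (hi.const_mul _), integral_const_mul, integral_scaledKernel K hη,
      hK.integral_eq_one, mul_one]
  have hsc : ∀ x, |x| * |scaledKernel K η x| = |x / η| * |K (x / η)| := fun x ↦ by
    rw [scaledKernel, abs_mul, abs_div, abs_inv, abs_of_pos hη]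
    ring
  have hi3 : Integrable fun x ↦ |x| * |scaledKernel K η x| := by
    simp_rw [hsc]
    exact hK.integrable_abs_mul.comp_div hη.ne'
  have e2 : ∫ x, |x| * |scaledKernel K η x| = η * ∫ x, |x| * |K x| := by
    simp_rw [hsc]
    rw [Measure.integral_comp_div (fun x ↦ |x| * |K x|), abs_of_pos hη, smul_eq_mul]
  rw [e1, ← Real.norm_eq_abs]
  calc _ ≤ ∫ x, A * (|x| * |scaledKernel K η x|) := by
        refine norm_integral_le_of_norm_le (hi3.const_mul A) ?_
        filter_upwards [hle] with x hx
        rw [norm_mul, Real.norm_eq_abs, Real.norm_eq_abs, ← mul_assoc]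
        gcongr
    _ = _ := by rw [integral_const_mul, e2]; ring

/-- The exact value records how integrability is lost as t → 0: the factor 1/t becomes log n at t =
1/log n. -/
lemma integral_one_add_abs_rpow {t : ℝ} (ht : 0 < t) :
    ∫ u : ℝ, (1 + |u|) ^ (-(1 + t)) = 2 / t := by
  rw [integral_comp_abs (f := fun u : ℝ ↦ (1 + u) ^ (-(1 + t)))]
  have h1 := integral_Ioi_of_hasDerivAt_of_nonneg' (a := (0 : ℝ)) (l := 0)
    (g := fun x : ℝ ↦ -(1 / t) * (1 + x) ^ (-t)) (g' := fun x ↦ (1 + x) ^ (-(1 + t)))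
    (fun x hx ↦ by
      have hp : (0 : ℝ) < 1 + x := by linarith [Set.mem_Ici.1 hx]
      have := (((hasDerivAt_id x).const_add 1).rpow_const (p := -t) (Or.inl hp.ne')).const_mul
        (-(1 / t))
      refine this.congr_deriv ?_
      have e : -t - 1 = -(1 + t) := by ring
      simp only [id, e]
      field_simp)
    (fun x hx ↦ by
      have : (0 : ℝ) < 1 + x := by linarith [Set.mem_Ioi.1 hx]
      positivity)
    (by
      have := ((tendsto_rpow_neg_atTop ht).comp
        (tendsto_atTop_add_const_left atTop (1 : ℝ) tendsto_id)).const_mul (-(1 / t))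
      simpa using this)
  rw [h1]
  simp
  ring

section

variable {P : Measure ℝ} {φ : ℝ → ℂ} {x₀ Δ γ : ℝ} {k : ℝ → ℝ} {ε C C₁ C₂ : ℝ} {G a b H : ℝ → ℂ}

lemma IncrementLaw.memLp_k (h : IncrementLaw P φ x₀ Δ k ε C) : MemLp k 2 := by
  rw [memLp_two_iff_integrable_sq h.integrable.1]
  refine (h.integrable.norm.const_mul C).mono' (h.integrable.1.pow 2) (ae_of_all _ fun x ↦ ?_)
  rw [norm_pow, sq]
  gcongr
  exact h.bound x

lemma IncrementLaw.memLp_ft_neg (h : IncrementLaw P φ x₀ Δ k ε C) :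
    MemLp (fun u ↦ ft (fun x ↦ (k x : ℂ)) (-u)) 2 := by
  refine MemLp.of_le_mul (c := C) memLp_one_add_abs_inv (continuous_ft_neg h).aestronglyMeasurable
    (ae_of_all _ fun u ↦ ?_)
  rw [Real.norm_of_nonneg (by positivity)]
  have := h.decay (-u)
  rwa [abs_neg] at this

/-- The product of b and κ is only O((1 + |u|)⁻²), against which the linear bound η(1 + |u|) on the
smoothing factor just fails to be integrable. The exponent 1 − t in place of 1 restores
integrability at the price 1/t. -/
lemma exists_norm_integral_sub_one_le (h : IncrementLaw P φ x₀ Δ k ε C)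
    (hG : FourierSplit G a b C₁) (hH : KernelTransform H C₂) :
    ∃ A : ℝ, 0 ≤ A ∧ ∀ η t : ℝ, 0 < η → 0 < t → t < 1 →
      ‖∫ u, G u * ft (fun x ↦ (k x : ℂ)) (-u) * (H (η * -u) - 1)‖ ≤ A * (η ^ (1 - t) / t) := by
  have ha : Integrable fun u ↦ ‖a u‖ := by
    refine (MemLp.integrable_mul hG.memLp_weight_a memLp_one_add_abs_inv).congr
      (ae_of_all _ fun u ↦ ?_)
    have : 0 < 1 + |u| := by positivity
    simp only [Pi.mul_apply]
    field_simp
  have hC₁ := hG.nonneg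
  have hC₂ := hH.one_le
  have hC := h.C_nonneg
  have hI : 0 ≤ ∫ u, ‖a u‖ := integral_nonneg fun u ↦ norm_nonneg _
  refine ⟨2 * C₂ * (C * (∫ u, ‖a u‖) + C * C₁ * 2), by positivity, fun η t hη ht ht1 ↦ ?_⟩
  have hb := integrable_one_add_abs_rpow (r := 1 + t) (by linarith)
  calc _ ≤ ∫ u, 2 * C₂ * η ^ (1 - t) * (C * ‖a u‖ + C * C₁ * (1 + |u|) ^ (-(1 + t))) := by
        refine norm_integral_le_of_norm_le (((ha.const_mul C).add
          (hb.const_mul (C * C₁))).const_mul _) ?_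
        filter_upwards [hG.ae_eq] with u hu
        have hp : 0 < 1 + |u| := by positivity
        have h1 := hH.norm_sub_one_le_rpow hη (by linarith : 0 < 1 - t) (by linarith) (-u)
        rw [abs_neg] at h1
        have h2 := h.decay (-u)
        rw [abs_neg] at h2
        have h3 := hG.norm_b_le u
        have e1 : (1 + |u|) ^ (1 - t) = (1 + |u|) * (1 + |u|) ^ (-t) := by
          rw [sub_eq_add_neg, Real.rpow_add hp, Real.rpow_one]
        have e2 : (1 + |u|) ^ (-(1 + t)) = (1 + |u|)⁻¹ * (1 + |u|) ^ (-t) := by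
          rw [neg_add, Real.rpow_add hp, Real.rpow_neg_one]
        have e3 : (1 + |u|) ^ (-t) ≤ 1 :=
          Real.rpow_le_one_of_one_le_of_nonpos (by linarith [abs_nonneg u]) (by linarith)
        have e4 : 0 ≤ (1 + |u|) ^ (-t) := by positivity
        rw [norm_mul, norm_mul, hu]
        calc _ ≤ (‖a u‖ + C₁ * (1 + |u|)⁻¹) * (C * (1 + |u|)⁻¹) *
              (2 * C₂ * (η ^ (1 - t) * (1 + |u|) ^ (1 - t))) := by
              gcongr
              exact (norm_add_le _ _).trans (by gcongr)
          _ = 2 * C₂ * η ^ (1 - t) * (C * (‖a u‖ * (1 + |u|) ^ (-t)) +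
              C * C₁ * (1 + |u|) ^ (-(1 + t))) := by
              rw [e1, e2]; field_simp
          _ ≤ _ := by
              gcongr
              exact mul_le_of_le_one_right (norm_nonneg _) e3
    _ = 2 * C₂ * η ^ (1 - t) * (C * (∫ u, ‖a u‖) + C * C₁ * (2 / t)) := by
        rw [integral_const_mul, integral_add (ha.const_mul C) (hb.const_mul _), integral_const_mul,
          integral_const_mul, integral_one_add_abs_rpow ht]
    _ ≤ 2 * C₂ * η ^ (1 - t) * (C * ((∫ u, ‖a u‖) / t) + C * C₁ * (2 / t)) := by
        gcongr
        rw [le_div_iff₀ ht]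
        exact mul_le_of_le_one_right hI ht1.le
    _ = _ := by ring

/-- The bias of the estimator. -/
lemma exists_abs_centre_sub_le (h : IncrementLaw P φ (Δ * γ) Δ k ε C) {g K : ℝ → ℝ}
    (hg : IsAdmissible g) (hK : IsKernel K) (hG : FourierSplit (ftL2 fun x ↦ (g x : ℂ)) a b C₁) :
    ∃ A : ℝ, 0 ≤ A ∧ ∀ η t : ℝ, 0 < η → η ≤ 1 → 0 < t → t < 1 →
      |(centre (ftL2 fun x ↦ (g x : ℂ)) (ft fun x ↦ (K x : ℂ)) k (Δ * γ) Δ η).re -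
        ((∫ x, g x * k x) + γ * g 0)| ≤ A * (η ^ (1 - t) / t) := by
  obtain ⟨C₂, hH⟩ := hK.exists_kernelTransform
  obtain ⟨A₁, hA₁, hle₁⟩ := exists_norm_integral_sub_one_le h hG hH
  obtain ⟨A₂, hA₂, hle₂⟩ := hg.exists_abs_integral_scaledKernel_sub_le hK
  refine ⟨|γ| * A₂ + A₁, by positivity, fun η t hη hη1 ht ht1 ↦ ?_⟩
  set G := ftL2 fun x ↦ (g x : ℂ) with hGdef
  set H := ft fun x ↦ (K x : ℂ) with hHdef
  have hgm : MemLp (fun x ↦ (g x : ℂ)) 2 := hg.square_integrable.ofReal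
  have hGm : MemLp G 2 := memLp_ftL2 hgm
  have hKm : MemLp (fun x ↦ (scaledKernel K η x : ℂ)) 2 := (hK.memLp_scaledKernel hη).ofReal
  have p1 := re_integral_ftL2_mul_ft hgm hKm (hK.integrable_scaledKernel hη)
  have p2 := re_integral_ftL2_mul_ft (k := k) hgm h.memLp_k.ofReal h.integrable
  simp_rw [ft_scaledKernel K hη] at p1
  rw [← hGdef] at p1 p2
  rw [← hHdef] at p1
  have i1 : Integrable fun u ↦ G u * H (η * -u) := hH.integrable_mul hη hGm
  have i2 : Integrable fun u ↦ G u * ft (fun x ↦ (k x : ℂ)) (-u) :=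
    MemLp.integrable_mul hGm h.memLp_ft_neg
  have i3 : Integrable fun u ↦ G u * ft (fun x ↦ (k x : ℂ)) (-u) * (H (η * -u) - 1) := by
    refine i2.mul_bdd (c := 2 * C₂) ((hH.continuous.comp (by fun_prop)).sub
      continuous_const).aestronglyMeasurable (ae_of_all _ fun u ↦ ?_)
    refine (hH.norm_sub_one_le _).trans ?_
    exact mul_le_of_le_one_right (by linarith [hH.one_le]) (min_le_left _ _)
  set J := ∫ u, G u * ft (fun x ↦ (k x : ℂ)) (-u) * (H (η * -u) - 1)
  have hΔ : (Δ : ℂ) ≠ 0 := by exact_mod_cast h.Δ_pos.ne'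
  have hc : centre G H k (Δ * γ) Δ η = ((2 * Real.pi)⁻¹ : ℝ) * (γ * (∫ u, G u * H (η * -u)) +
      (∫ u, G u * ft (fun x ↦ (k x : ℂ)) (-u)) + J) := by
    have i12 : Integrable fun u ↦ γ * (G u * H (η * -u)) + G u * ft (fun x ↦ (k x : ℂ)) (-u) :=
      (i1.const_mul _).add i2
    have e : ∫ u, G u * H (η * -u) * (Complex.I * ((Δ * γ : ℝ) + Δ * ft (fun x ↦ (k x : ℂ)) (-u))) =
        (Complex.I * Δ) * (γ * (∫ u, G u * H (η * -u)) +
        (∫ u, G u * ft (fun x ↦ (k x : ℂ)) (-u)) + J) := by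
      rw [← integral_const_mul, ← integral_add (i1.const_mul _) i2, ← integral_add i12 i3,
        ← integral_const_mul]
      refine integral_congr_ae (ae_of_all _ fun u ↦ ?_)
      simp only
      push_cast
      ring
    rw [centre, e]
    push_cast
    have := Complex.I_ne_zero
    field_simp
  -- Parseval identifies the drift part with γ∫ g K_η and the jump part with ∫ g k, up to the
  -- smoothing error J.
  have hre : (centre G H k (Δ * γ) Δ η).re - ((∫ x, g x * k x) + γ * g 0) =
      γ * ((∫ x, g x * scaledKernel K η x) - g 0) + (2 * Real.pi)⁻¹ * J.re := by
    rw [hc, Complex.re_ofReal_mul, Complex.add_re, Complex.add_re, Complex.re_ofReal_mul, p1, p2]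
    have := Real.pi_pos
    field_simp
    ring
  -- The O(η) error at 0 fits under the same bound because η ≤ 1 and t < 1.
  have hηt : η ≤ η ^ (1 - t) / t := by
    rw [le_div_iff₀ ht]
    calc η * t ≤ η * 1 := by gcongr
      _ = η := mul_one _
      _ ≤ _ := Real.self_le_rpow_of_le_one hη.le hη1 (by linarith)
  have hJ : |(2 * Real.pi)⁻¹ * J.re| ≤ A₁ * (η ^ (1 - t) / t) := by
    rw [abs_mul, abs_of_nonneg (by positivity)]
    calc _ ≤ 1 * |J.re| := by gcongr; exact inv_two_pi_le_one
      _ ≤ ‖J‖ := by rw [one_mul]; exact Complex.abs_re_le_norm _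
      _ ≤ _ := hle₁ η t hη ht ht1
  rw [hre]
  calc _ ≤ |γ * ((∫ x, g x * scaledKernel K η x) - g 0)| + |(2 * Real.pi)⁻¹ * J.re| := abs_add_le _ _
    _ ≤ |γ| * (A₂ * (η ^ (1 - t) / t)) + A₁ * (η ^ (1 - t) / t) := by
        refine add_le_add ?_ hJ
        rw [abs_mul]
        gcongr
        exact (hle₂ η hη).trans (by gcongr)
    _ = _ := by ring

end

end

end LevyCLT

namespace LevyCLT

noncomputable section

/-! ### The bandwidth -/

section

variable {h : ℕ → ℝ} {ρ : ℝ}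

lemma tendsto_log_natCast : Tendsto (fun n : ℕ ↦ Real.log n) atTop atTop :=
  Real.tendsto_log_atTop.comp tendsto_natCast_atTop_atTop

lemma tendsto_rpow_neg_mul_log_rpow {s : ℝ} (hs : 0 < s) (r : ℝ) :
    Tendsto (fun n : ℕ ↦ (n : ℝ) ^ (-s) * Real.log n ^ r) atTop (𝓝 0) := by
  have h1 := (isLittleO_log_rpow_rpow_atTop r hs).tendsto_div_nhds_zero.comp
    tendsto_natCast_atTop_atTop (α := ℕ)
  refine h1.congr fun n ↦ ?_
  simp only [Function.comp_apply]
  rw [Real.rpow_neg (by positivity), div_eq_mul_inv, mul_comm]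

lemma BandwidthRate.eventually_pos (hh : BandwidthRate h ρ) : ∀ᶠ n in atTop, 0 < h n := by
  obtain ⟨c, C, hc, hb⟩ := hh
  filter_upwards [hb, tendsto_log_natCast.eventually_gt_atTop 0, eventually_gt_atTop 0]
    with n hn hlog hn0
  have : (0 : ℝ) < n := by exact_mod_cast hn0
  exact lt_of_lt_of_le (by positivity) hn.1

lemma BandwidthRate.tendsto_zero (hh : BandwidthRate h ρ) : Tendsto h atTop (𝓝 0) := by
  have hpos := hh.eventually_pos
  obtain ⟨c, C, hc, hb⟩ := hh
  have h1 := (tendsto_rpow_neg_mul_log_rpow (s := 1 / 2) (by norm_num) (-ρ)).const_mul C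
  rw [mul_zero] at h1
  refine squeeze_zero' (hpos.mono fun n hn ↦ hn.le) ?_ h1
  filter_upwards [hb] with n hn
  exact hn.2

lemma BandwidthRate.tendsto_nhdsGT (hh : BandwidthRate h ρ) : Tendsto h atTop (𝓝[>] 0) :=
  tendsto_nhdsWithin_iff.2 ⟨hh.tendsto_zero, hh.eventually_pos⟩

/-- As h⁻¹ is at most of order n^{1/2}(log n)^ρ, the product is O(n^{−ε/2}(log n)^{ρ(1−ε)}). The ε
gained in condition (c) beats the logarithm. -/
lemma BandwidthRate.tendsto_growth (hh : BandwidthRate h ρ) (hρ : 0 ≤ ρ) {ε : ℝ} (hε : 0 < ε)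
    (hε1 : ε ≤ 1) :
    Tendsto (fun n : ℕ ↦ (n : ℝ) ^ (-(1 / 2) : ℝ) * (1 + (h n)⁻¹) ^ (1 - ε)) atTop (𝓝 0) := by
  have hpos := hh.eventually_pos
  obtain ⟨c, C, hc, hb⟩ := hh
  have h1 := (tendsto_rpow_neg_mul_log_rpow (s := ε / 2) (by positivity)
    (ρ * (1 - ε))).const_mul ((1 + c⁻¹) ^ (1 - ε))
  rw [mul_zero] at h1
  refine squeeze_zero' (hpos.mono fun n hn ↦ by positivity) ?_ h1
  filter_upwards [hb, hpos, tendsto_log_natCast.eventually_ge_atTop 1, eventually_gt_atTop 0]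
    with n hn hn0 hlog hn1
  have hnpos : (0 : ℝ) < n := by exact_mod_cast hn1
  have hn1' : (1 : ℝ) ≤ n := by exact_mod_cast hn1
  have hl : 0 < Real.log n := by linarith
  have e1 : (c * ((n : ℝ) ^ (-(1 / 2) : ℝ) * Real.log n ^ (-ρ)))⁻¹ =
      c⁻¹ * ((n : ℝ) ^ (1 / 2 : ℝ) * Real.log n ^ ρ) := by
    rw [Real.rpow_neg hnpos.le, Real.rpow_neg hl.le, mul_inv, mul_inv, inv_inv, inv_inv]
  have h2 : (h n)⁻¹ ≤ c⁻¹ * ((n : ℝ) ^ (1 / 2 : ℝ) * Real.log n ^ ρ) := by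
    rw [← e1]
    exact inv_anti₀ (by positivity) hn.1
  have h3 : 1 ≤ (n : ℝ) ^ (1 / 2 : ℝ) * Real.log n ^ ρ :=
    one_le_mul_of_one_le_of_one_le (Real.one_le_rpow hn1' (by norm_num))
      (Real.one_le_rpow hlog hρ)
  have h4 : 1 + (h n)⁻¹ ≤ (1 + c⁻¹) * ((n : ℝ) ^ (1 / 2 : ℝ) * Real.log n ^ ρ) := by
    rw [add_mul, one_mul]; linarith
  calc _ ≤ (n : ℝ) ^ (-(1 / 2) : ℝ) *
        ((1 + c⁻¹) * ((n : ℝ) ^ (1 / 2 : ℝ) * Real.log n ^ ρ)) ^ (1 - ε) := by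
        gcongr
    _ = (1 + c⁻¹) ^ (1 - ε) * (((n : ℝ) ^ (-(1 / 2) : ℝ) * (n : ℝ) ^ ((1 / 2 : ℝ) * (1 - ε))) *
        Real.log n ^ (ρ * (1 - ε))) := by
        rw [Real.mul_rpow (by positivity) (by positivity), Real.mul_rpow (by positivity)
          (by positivity), ← Real.rpow_mul hnpos.le, ← Real.rpow_mul hl.le]
        ring
    _ = _ := by
        rw [← Real.rpow_add hnpos]
        congr 3
        ring_nf

/-- With t = 1/log n the change of exponent costs only a constant, since n^{1/log n} = e. What
remains is of order √n h log n, that is (log n)^{1−ρ}, which is where ρ > 1 is needed. -/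
lemma BandwidthRate.tendsto_bias (hh : BandwidthRate h ρ) (hρ : 1 < ρ) :
    Tendsto (fun n : ℕ ↦ √(n : ℝ) * (h n ^ (1 - (Real.log n)⁻¹) / (Real.log n)⁻¹)) atTop (𝓝 0) := by
  have hpos := hh.eventually_pos
  obtain ⟨c, C, hc, hb⟩ := hh
  have h1 : Tendsto (fun n : ℕ ↦ max 1 C * Real.exp (1 / 2 + ρ) * Real.log n ^ (-(ρ - 1))) atTop
      (𝓝 0) := by
    have := ((tendsto_rpow_neg_atTop (by linarith : 0 < ρ - 1)).comp
      tendsto_log_natCast).const_mul (max 1 C * Real.exp (1 / 2 + ρ))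
    simpa using this
  refine squeeze_zero' ?_ ?_ h1
  · filter_upwards [hpos, tendsto_log_natCast.eventually_ge_atTop 1] with n hn hlog
    positivity
  filter_upwards [hb, hpos, tendsto_log_natCast.eventually_ge_atTop 1, eventually_gt_atTop 0]
    with n hn hn0 hlog hn1
  have hnpos : (0 : ℝ) < n := by exact_mod_cast hn1
  set l := Real.log n with hl
  have hl0 : 0 < l := by linarith
  have ht0 : 0 ≤ 1 - l⁻¹ := by
    have := inv_le_one_of_one_le₀ hlog
    linarith
  have hexp : (n : ℝ) = Real.exp l := (Real.exp_log hnpos).symm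
  have hlog2 : Real.log l ≤ l := (Real.log_le_self hl0.le)
  set r := (n : ℝ) ^ (-(1 / 2) : ℝ) * l ^ (-ρ) with hr
  have er : r = Real.exp (-(l / 2) - ρ * Real.log l) := by
    rw [hr, Real.rpow_def_of_pos hnpos, Real.rpow_def_of_pos hl0, ← hl, ← Real.exp_add]
    congr 1; ring
  have hr0 : 0 < r := by rw [er]; positivity
  have hM : 1 ≤ max 1 C := le_max_left _ _
  have h2 : h n ^ (1 - l⁻¹) ≤ max 1 C * r ^ (1 - l⁻¹) := by
    calc _ ≤ (max 1 C * r) ^ (1 - l⁻¹) := by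
          refine Real.rpow_le_rpow hn0.le (hn.2.trans ?_) ht0
          gcongr
          exact le_max_right _ _
      _ = (max 1 C) ^ (1 - l⁻¹) * r ^ (1 - l⁻¹) := Real.mul_rpow (by positivity) hr0.le
      _ ≤ (max 1 C) ^ (1 : ℝ) * r ^ (1 - l⁻¹) := by
          gcongr
          have := inv_pos.2 hl0
          linarith
      _ = _ := by rw [Real.rpow_one]
  have h3 : √(n : ℝ) * r ^ (1 - l⁻¹) ≤ Real.exp (1 / 2 + ρ) * l ^ (-ρ) := by
    rw [er, ← Real.exp_mul, Real.sqrt_eq_rpow, Real.rpow_def_of_pos hnpos, ← hl,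
      Real.rpow_def_of_pos hl0, ← Real.exp_add, ← Real.exp_add]
    refine Real.exp_le_exp.2 ?_
    have e : l * (1 / 2) + (-(l / 2) - ρ * Real.log l) * (1 - l⁻¹) =
        1 / 2 + ρ * (Real.log l * l⁻¹) + Real.log l * -ρ := by
      field_simp; ring
    rw [e]
    have h4 : Real.log l * l⁻¹ ≤ 1 := by
      rw [← div_eq_mul_inv, div_le_one hl0]; exact hlog2
    nlinarith
  calc _ = (√(n : ℝ) * h n ^ (1 - l⁻¹)) * l := by rw [div_inv_eq_mul]; ring
    _ ≤ (√(n : ℝ) * (max 1 C * r ^ (1 - l⁻¹))) * l := by gcongr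
    _ = max 1 C * (√(n : ℝ) * r ^ (1 - l⁻¹)) * l := by ring
    _ ≤ max 1 C * (Real.exp (1 / 2 + ρ) * l ^ (-ρ)) * l := by gcongr
    _ = max 1 C * Real.exp (1 / 2 + ρ) * (l ^ (-ρ) * l ^ (1 : ℝ)) := by rw [Real.rpow_one]; ring
    _ = _ := by
        rw [← Real.rpow_add hl0]
        congr 2
        ring

end

/-! ### Growth of the weights -/

section

variable {P : Measure ℝ} {φ : ℝ → ℂ} {x₀ Δ : ℝ} {k : ℝ → ℝ} {ε C C₁ : ℝ} {G a b : ℝ → ℂ}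

open IncrementLaw

lemma sq_norm_inv_eq (φ : ℝ → ℂ) (ε u : ℝ) :
    ‖(φ u)⁻¹‖ ^ 2 = (1 + |u|) ^ (2 * (1 - ε)) * weight φ ε u ^ 2 := by
  have hp : 0 < 1 + |u| := by positivity
  have e := rpow_mul_weight_neg φ ε (-u)
  rw [neg_neg, abs_neg] at e
  rw [← e, mul_pow, ← Real.rpow_natCast, ← Real.rpow_mul hp.le]
  congr 2
  push_cast
  ring

/-- On |u| ≤ M, |φ⁻¹|² is at most (1 + M)^{2(1−ε)} times the integrable squared weight. -/
lemma exists_setLIntegral_sq_norm_inv_le (h : IncrementLaw P φ x₀ Δ k ε C) :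
    ∃ W : ℝ≥0∞, W ≠ ∞ ∧ ∀ M : ℝ, 0 ≤ M →
      ∫⁻ u in Set.Icc (-M) M, ‖(φ u)⁻¹‖ₑ ^ 2 ≤ W * ENNReal.ofReal ((1 + M) ^ (1 - ε)) ^ 2 := by
  have hε := h.ε_le
  refine ⟨∫⁻ u, ENNReal.ofReal (weight φ ε u ^ 2), ?_, fun M hM ↦ ?_⟩
  · exact (h.integrable_weight_sq.lintegral_lt_top).ne
  rw [← lintegral_mul_const' _ _ (by finiteness)]
  refine (setLIntegral_mono' (g := fun u ↦ ENNReal.ofReal (weight φ ε u ^ 2) *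
    ENNReal.ofReal ((1 + M) ^ (1 - ε)) ^ 2) measurableSet_Icc fun u hu ↦ ?_).trans
    (setLIntegral_le_lintegral _ _)
  have hu' : |u| ≤ M := abs_le.2 hu
  have hp : 0 < 1 + |u| := by positivity
  rw [← ofReal_norm, ← ENNReal.ofReal_pow (norm_nonneg _), ← ENNReal.ofReal_pow (by positivity),
    ← ENNReal.ofReal_mul (by positivity), sq_norm_inv_eq φ ε u, mul_comm (weight φ ε u ^ 2)]
  refine ENNReal.ofReal_le_ofReal ?_
  gcongr
  rw [← Real.rpow_natCast, ← Real.rpow_mul (by positivity), mul_comm (2 : ℝ)]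
  push_cast
  exact Real.rpow_le_rpow hp.le (by linarith) (by nlinarith)

/-- The decay of G halves the exponent of M. Against b a factor 1 + |u| cancels, against a the
product of (1 + |u|)|a| and the weight is integrable, and what is left is (1 + |u|)^{1−2ε} ≤ (1 +
M)^{1−ε}. -/
lemma exists_setLIntegral_mul_sq_norm_inv_le (h : IncrementLaw P φ x₀ Δ k ε C)
    (hG : FourierSplit G a b C₁) :
    ∃ W : ℝ≥0∞, W ≠ ∞ ∧ ∀ M : ℝ, 0 ≤ M →
      ∫⁻ u in Set.Icc (-M) M, ‖G (-u)‖ₑ * ‖(φ u)⁻¹‖ₑ ^ 2 ≤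
        W * ENNReal.ofReal ((1 + M) ^ (1 - ε)) := by
  have hε := h.ε_le
  have hε0 := h.ε_pos
  obtain ⟨B, hB⟩ := h.exists_weight_le
  have hB0 : 0 ≤ B := (weight_nonneg φ ε 0).trans (hB 0)
  have hC₁ := hG.nonneg
  let J : ℝ → ℝ := fun u ↦ C₁ * weight φ ε u ^ 2 + B * ((1 + |-u|) * ‖a (-u)‖ * weight φ ε u)
  have hJ : Integrable J := by
    refine (h.integrable_weight_sq.const_mul C₁).add (Integrable.const_mul ?_ B)
    have := hG.memLp_weight_a.comp_measurePreserving measurePreserving_neg_real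
    exact MemLp.integrable_mul this h.memLp_weight
  refine ⟨∫⁻ u, ENNReal.ofReal (J u), hJ.lintegral_lt_top.ne, fun M hM ↦ ?_⟩
  rw [← lintegral_mul_const' _ _ (by finiteness)]
  refine le_trans ?_ (setLIntegral_le_lintegral (Set.Icc (-M) M) _)
  refine lintegral_mono_ae ?_
  have hae : ∀ᵐ u, G (-u) = a (-u) + b (-u) :=
    measurePreserving_neg_real.quasiMeasurePreserving.ae hG.ae_eq
  filter_upwards [ae_restrict_mem measurableSet_Icc, ae_restrict_of_ae hae] with u hu hGu
  have hu' : |u| ≤ M := abs_le.2 hu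
  have hp : 0 < 1 + |u| := by positivity
  have hw := weight_nonneg φ ε u
  have hb := hG.norm_b_le (-u)
  rw [abs_neg] at hb
  rw [← ofReal_norm, ← ofReal_norm, ← ENNReal.ofReal_pow (norm_nonneg _),
    ← ENNReal.ofReal_mul (norm_nonneg _), ← ENNReal.ofReal_mul (by positivity)]
  refine ENNReal.ofReal_le_ofReal ?_
  have e1 : (1 + |u|) ^ (2 * (1 - ε)) = (1 + |u|) * (1 + |u|) ^ (1 - 2 * ε) := by
    have : 2 * (1 - ε) = 1 + (1 - 2 * ε) := by ring
    rw [this, Real.rpow_add hp, Real.rpow_one]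
  have e2 : (1 + |u|) ^ (1 - 2 * ε) ≤ (1 + M) ^ (1 - ε) := by
    calc _ ≤ (1 + M) ^ (1 - 2 * ε) := Real.rpow_le_rpow hp.le (by linarith) (by linarith)
      _ ≤ _ := Real.rpow_le_rpow_of_exponent_le (by linarith) (by linarith)
  rw [sq_norm_inv_eq φ ε u, e1, hGu]
  calc _ ≤ (‖a (-u)‖ + C₁ * (1 + |u|)⁻¹) *
        ((1 + |u|) * (1 + |u|) ^ (1 - 2 * ε) * weight φ ε u ^ 2) := by
        gcongr
        exact (norm_add_le _ _).trans (by gcongr)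
    _ = (C₁ * weight φ ε u ^ 2 + weight φ ε u * ((1 + |-u|) * ‖a (-u)‖ * weight φ ε u)) *
        (1 + |u|) ^ (1 - 2 * ε) := by
        rw [abs_neg]; field_simp; ring
    _ ≤ _ := by
        simp only [J]
        gcongr
        exact hB u

end

end

end LevyCLT

namespace LevyCLT

noncomputable section

/-! ### Measurability and reality of the estimator -/

lemma measurable_ft {f : ℝ → ℂ} (hf : Measurable f) : Measurable (ft f) := by
  have : StronglyMeasurable fun p : ℝ × ℝ ↦ Complex.exp (Complex.I * p.1 * p.2) * f p.2 := by
    have : Measurable fun p : ℝ × ℝ ↦ f p.2 := hf.comp measurable_snd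
    exact Measurable.stronglyMeasurable (by fun_prop)
  exact this.integral_prod_right'.measurable

lemma measurable_integral_mul_invFt {Ω : Type*} [MeasurableSpace Ω] {N : Ω → ℝ → ℂ}
    (hN : Measurable fun p : Ω × ℝ ↦ N p.1 p.2) {g : ℝ → ℝ} (hg : Measurable g) :
    Measurable fun ω ↦ ∫ x : ℝ, (g x : ℂ) * invFt (N ω) x := by
  have hI : Measurable fun p : Ω × ℝ ↦ invFt (N p.1) p.2 := by
    have hp : Measurable fun q : (Ω × ℝ) × ℝ ↦ (q.1.1, q.2) := by fun_prop
    have h0 : Measurable fun q : (Ω × ℝ) × ℝ ↦ N q.1.1 q.2 := hN.comp hp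
    have h1 : StronglyMeasurable fun q : (Ω × ℝ) × ℝ ↦
        Complex.exp (-(Complex.I * q.2 * q.1.2)) * N q.1.1 q.2 :=
      Measurable.stronglyMeasurable (Measurable.mul (by fun_prop) h0)
    exact (h1.integral_prod_right').measurable.const_mul _
  have hg' : Measurable fun p : Ω × ℝ ↦ (g p.2 : ℂ) :=
    Complex.measurable_ofReal.comp (hg.comp measurable_snd)
  exact (hg'.mul hI).stronglyMeasurable.integral_prod_right'.measurable

lemma aemeasurable_estimator {Ω : Type*} [MeasurableSpace Ω] {μ : Measure Ω} {X : ℕ → Ω → ℝ}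
    (hX : ∀ k, Measurable (X k)) {g K : ℝ → ℝ} (hg : AEStronglyMeasurable g) (hK : Measurable K)
    (Δ : ℝ) (n : ℕ) (η : ℝ) : AEMeasurable (fun ω ↦ estimator K Δ g (fun k ↦ X k ω) n η) μ := by
  have hS : Measurable fun y ↦ (scaledKernel K η y : ℂ) := by
    unfold scaledKernel
    fun_prop
  have hN : Measurable fun p : Ω × ℝ ↦ deriv (empCharFun (fun k ↦ X k p.1) n) p.2 /
      empCharFun (fun k ↦ X k p.1) n p.2 * ft (fun y ↦ (scaledKernel K η y : ℂ)) p.2 := by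
    simp only [deriv_empCharFun]
    exact ((measurable_empCharFunDeriv_uncurry hX n).div (measurable_empCharFun_uncurry hX n)).mul
      ((measurable_ft hS).comp measurable_snd)
  have h1 := measurable_integral_mul_invFt (N := fun ω u ↦ deriv (empCharFun (fun k ↦ X k ω) n) u /
    empCharFun (fun k ↦ X k ω) n u * ft (fun y ↦ (scaledKernel K η y : ℂ)) u) hN
    hg.stronglyMeasurable_mk.measurable
  refine ((h1.const_mul (Complex.I * Δ)⁻¹).aemeasurable).congr (ae_of_all _ fun ω ↦ ?_)
  simp only
  rw [estimator]
  congr 1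
  refine integral_congr_ae ?_
  filter_upwards [hg.ae_eq_mk] with x hx
  rw [hx]

/-- φ_n and FK are Hermitian and φ_n' is anti-Hermitian, so the inner transform is purely imaginary
and the prefactor makes the estimator real. This covers every sample: quotients by zero and
integrals that fail to exist are read as 0, in accordance with conjugation. -/
lemma estimator_im (K : ℝ → ℝ) (Δ : ℝ) (g : ℝ → ℝ) (x : ℕ → ℝ) (n : ℕ) (η : ℝ) :
    (estimator K Δ g x n η).im = 0 := by
  let N : ℝ → ℂ := fun u ↦ deriv (empCharFun x n) u / empCharFun x n u *
    ft (fun y ↦ (scaledKernel K η y : ℂ)) u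
  have hN : ∀ u, Complex.I * N (-u) = starRingEnd ℂ (Complex.I * N u) := fun u ↦ by
    simp only [N, deriv_empCharFun]
    rw [empCharFun_neg, empCharFunDeriv_neg, ft_neg_of_real, map_mul, map_mul, map_div₀,
      Complex.conj_I]
    ring
  have h1 : ∀ y, (invFt N y).re = 0 := fun y ↦ by
    have h2 := invFt_im_eq_zero (N := fun u ↦ Complex.I * N u) (ae_of_all _ hN) y
    have h3 : invFt (fun u ↦ Complex.I * N u) y = Complex.I * invFt N y := by
      rw [invFt, invFt]
      simp_rw [mul_left_comm _ Complex.I]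
      rw [integral_const_mul]
      ring
    rwa [h3, Complex.I_mul_im] at h2
  have h2 : ∀ y, (g y : ℂ) * invFt N y = Complex.I * ((g y * (invFt N y).im : ℝ) : ℂ) := fun y ↦ by
    have : invFt N y = Complex.I * ((invFt N y).im : ℂ) := by
      apply Complex.ext <;> simp [h1 y]
    rw [this]
    simp
    ring
  have h3 : estimator K Δ g x n η = (Complex.I * Δ)⁻¹ * ∫ y : ℝ, (g y : ℂ) * invFt N y := rfl
  rw [h3]
  simp_rw [h2]
  rw [integral_const_mul, integral_complex_ofReal, mul_inv]
  have e : Complex.I⁻¹ * (Δ : ℂ)⁻¹ * (Complex.I * ((∫ y, g y * (invFt N y).im : ℝ) : ℂ)) =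
      ((Δ⁻¹ * ∫ y, g y * (invFt N y).im : ℝ) : ℂ) := by
    have := Complex.I_ne_zero
    push_cast
    field_simp
  rw [e, Complex.ofReal_im]

/-! ### Probability bounds -/

/-- Weighted squared error of the empirical characteristic function over `[-M, M]`. -/
def weightedErr (w : ℝ → ℝ≥0∞) (φ : ℝ → ℂ) (x : ℕ → ℝ) (n : ℕ) (M : ℝ) : ℝ≥0∞ :=
  ∫⁻ u in Set.Icc (-M) M, w u * ENNReal.ofReal (errSq φ x n u)

lemma inv_natCast_eq_ofReal_sq {n : ℕ} (hn : n ≠ 0) :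
    (n : ℝ≥0∞)⁻¹ = ENNReal.ofReal ((n : ℝ) ^ (-(1 / 2) : ℝ)) ^ 2 := by
  have hn' : (0 : ℝ) < n := by positivity
  rw [← ENNReal.ofReal_pow (by positivity), ← Real.rpow_natCast, ← Real.rpow_mul hn'.le,
    ← ENNReal.ofReal_natCast, ← ENNReal.ofReal_inv_of_pos hn']
  norm_num
  rw [Real.rpow_neg_one]

lemma ofReal_sqrt_mul_inv_natCast {n : ℕ} (hn : n ≠ 0) :
    ENNReal.ofReal √(n : ℝ) * (n : ℝ≥0∞)⁻¹ = ENNReal.ofReal ((n : ℝ) ^ (-(1 / 2) : ℝ)) := by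
  have hn' : (0 : ℝ) < n := by positivity
  rw [← ENNReal.ofReal_natCast, ← ENNReal.ofReal_inv_of_pos hn', ← ENNReal.ofReal_mul (by positivity),
    Real.sqrt_eq_rpow, ← Real.rpow_neg_one, ← Real.rpow_add hn']
  norm_num

section

variable {Ω : Type*} [MeasurableSpace Ω] {μ : Measure Ω} {X : ℕ → Ω → ℝ} {P : Measure ℝ} {φ : ℝ → ℂ} {x₀ Δ γ : ℝ} {k : ℝ → ℝ} {ε C C₁ C₂ ρ : ℝ}
  {G a b H : ℝ → ℂ} {g K : ℝ → ℝ} {η : ℕ → ℝ}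

lemma aemeasurable_weightedErr [SFinite μ] (h : IncrementLaw P φ x₀ Δ k ε C)
    (hX : IsSample X μ P)
    {w : ℝ → ℝ≥0∞} (hw : AEMeasurable w) (n : ℕ) (M : ℝ) :
    AEMeasurable (fun ω ↦ weightedErr w φ (fun k ↦ X k ω) n M) μ := by
  have hj : AEMeasurable (fun p : Ω × ℝ ↦ w p.2 *
      ENNReal.ofReal (errSq φ (fun k ↦ X k p.1) n p.2))
      (μ.prod (volume.restrict (Set.Icc (-M) M))) :=
    hw.restrict.comp_snd.mul (measurable_errSq_uncurry h hX.measurable n).ennreal_ofReal.aemeasurable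
  exact hj.lintegral_prod_right'

lemma lintegral_weightedErr_le [IsProbabilityMeasure μ] (h : IncrementLaw P φ x₀ Δ k ε C) (hX : IsSample X μ P)
    {A : ℝ≥0∞} {n : ℕ}
    (hA : ∀ u, ∫⁻ ω, ENNReal.ofReal (errSq φ (fun k ↦ X k ω) n u) ∂μ ≤ (n : ℝ≥0∞)⁻¹ * A)
    {w : ℝ → ℝ≥0∞} (hw : AEMeasurable w) (M : ℝ) :
    ∫⁻ ω, weightedErr w φ (fun k ↦ X k ω) n M ∂μ ≤
      (n : ℝ≥0∞)⁻¹ * A * ∫⁻ u in Set.Icc (-M) M, w u := by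
  have h1 := lintegral_weighted_errSq_le h hX hA (hw.indicator (measurableSet_Icc (a := -M) (b := M)))
  rw [lintegral_indicator measurableSet_Icc] at h1
  refine (le_of_eq (lintegral_congr fun ω ↦ ?_)).trans h1
  rw [weightedErr, ← lintegral_indicator measurableSet_Icc]
  refine lintegral_congr fun u ↦ ?_
  by_cases hu : u ∈ Set.Icc (-M) M
  · rw [Set.indicator_of_mem hu, Set.indicator_of_mem hu]
  · rw [Set.indicator_of_notMem hu, Set.indicator_of_notMem hu, zero_mul]

lemma aemeasurable_sq_enorm_inv (h : IncrementLaw P φ x₀ Δ k ε C) :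
    AEMeasurable fun u ↦ ‖(φ u)⁻¹‖ₑ ^ 2 :=
  (h.continuous_inv.measurable.enorm.pow_const 2).aemeasurable

/-- The mean is O(n⁻¹(1 + h⁻¹)^{2(1−ε)}), the square of the quantity in
`BandwidthRate.tendsto_growth`. -/
lemma tendsto_lintegral_weightedErr [IsProbabilityMeasure μ] (h : IncrementLaw P φ x₀ Δ k ε C) (hX : IsSample X μ P)
    (hη : BandwidthRate η ρ) (hρ : 1 < ρ) :
    Tendsto (fun n ↦ ∫⁻ ω, weightedErr (fun u ↦ ‖(φ u)⁻¹‖ₑ ^ 2) φ (fun k ↦ X k ω) n (η n)⁻¹ ∂μ)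
      atTop (𝓝 0) := by
  obtain ⟨A, hA, hAle⟩ := exists_lintegral_errSq_le h hX
  obtain ⟨W, hW, hWle⟩ := exists_setLIntegral_sq_norm_inv_le h
  have hg := hη.tendsto_growth (by linarith) h.ε_pos (by linarith [h.ε_le])
  have h1 := ENNReal.Tendsto.const_mul (a := A * W) (ENNReal.Tendsto.pow (n := 2)
    (ENNReal.tendsto_ofReal hg)) (Or.inr (by finiteness))
  simp only [ENNReal.ofReal_zero, ne_eq, OfNat.ofNat_ne_zero, not_false_eq_true, zero_pow,
    mul_zero] at h1
  refine tendsto_of_tendsto_of_tendsto_of_le_of_le' tendsto_const_nhds h1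
    (Eventually.of_forall fun _ ↦ zero_le) ?_
  filter_upwards [hη.eventually_pos, eventually_ne_atTop 0] with n hn hn0
  have h2 := lintegral_weightedErr_le h hX (fun u ↦ hAle n u hn0) (aemeasurable_sq_enorm_inv h)
    (η n)⁻¹
  refine h2.trans ((mul_le_mul' le_rfl (hWle _ (by positivity))).trans (le_of_eq ?_))
  rw [inv_natCast_eq_ofReal_sq hn0, ENNReal.ofReal_mul (by positivity)]
  ring

/-- Markov's inequality for the weighted error, whose mean tends to 0. -/
lemma tendsto_measure_not_goodSample [IsProbabilityMeasure μ] (h : IncrementLaw P φ x₀ Δ k ε C) (hX : IsSample X μ P)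
    (hη : BandwidthRate η ρ) (hρ : 1 < ρ) (B : ℝ) :
    Tendsto (fun n ↦ μ {ω | ¬ GoodSample φ B (fun k ↦ X k ω) n (η n)}) atTop (𝓝 0) := by
  set c : ℝ := (4 * (2 + 2 * B ^ 2))⁻¹ with hc
  have hc0 : 0 < c := by positivity
  have hcE : ENNReal.ofReal c ≠ 0 := by simpa using hc0
  have h1 := ENNReal.Tendsto.const_mul (a := (ENNReal.ofReal c)⁻¹)
    (tendsto_lintegral_weightedErr h hX hη hρ) (Or.inr (by finiteness))
  rw [mul_zero] at h1
  refine tendsto_of_tendsto_of_tendsto_of_le_of_le tendsto_const_nhds h1 (fun _ ↦ zero_le) fun n ↦ ?_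
  have hm := mul_meas_ge_le_lintegral₀ (aemeasurable_weightedErr h hX
    (aemeasurable_sq_enorm_inv h) n (η n)⁻¹) (ENNReal.ofReal c)
  simp only
  rw [mul_comm, ← div_eq_mul_inv, ENNReal.le_div_iff_mul_le (Or.inl hcE) (Or.inl (by finiteness)),
    mul_comm]
  refine le_trans (mul_le_mul' le_rfl (measure_mono fun ω hω ↦ ?_)) hm
  have hω' : c < ∫ u in Set.Icc (-(η n)⁻¹) (η n)⁻¹, ‖(φ u)⁻¹‖ ^ 2 * errSq φ (fun k ↦ X k ω) n u :=
    not_le.1 hω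
  have hcont : Continuous fun u ↦ ‖(φ u)⁻¹‖ ^ 2 * errSq φ (fun k ↦ X k ω) n u :=
    (h.continuous_inv.norm.pow 2).mul (h.continuous_errSq _ n)
  have e := ofReal_integral_eq_lintegral_ofReal
    (hcont.continuousOn.integrableOn_Icc (a := -(η n)⁻¹) (b := (η n)⁻¹) (μ := volume))
    (ae_of_all _ fun u ↦ mul_nonneg (sq_nonneg _) (errSq_nonneg _ _ _ _))
  change ENNReal.ofReal c ≤ weightedErr _ _ _ _ _
  refine (ENNReal.ofReal_le_ofReal hω'.le).trans (le_of_eq (e.trans ?_))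
  rw [weightedErr]
  refine lintegral_congr fun u ↦ ?_
  rw [ENNReal.ofReal_mul (by positivity), ENNReal.ofReal_pow (norm_nonneg _), ofReal_norm]

/-- Markov's inequality: the mean is of order at most √n n⁻¹(1 + h⁻¹)^{1−ε}. The exponent 2(1 − ε)
available without the decay of G would not suffice here. -/
lemma tendsto_measure_remainder [IsProbabilityMeasure μ] (h : IncrementLaw P φ x₀ Δ k ε C) (hX : IsSample X μ P)
    (hG : FourierSplit G a b C₁) (hGm : AEStronglyMeasurable G)
    (hη : BandwidthRate η ρ) (hρ : 1 < ρ) {c : ℝ≥0∞} (hc : c ≠ ∞) {δ : ℝ≥0∞} (hδ : δ ≠ 0)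
    (hδ' : δ ≠ ∞) :
    Tendsto (fun n : ℕ ↦ μ {ω | δ ≤ ENNReal.ofReal √(n : ℝ) * (c * weightedErr
      (fun u ↦ ‖G (-u)‖ₑ * ‖(φ u)⁻¹‖ₑ ^ 2) φ (fun k ↦ X k ω) n (η n)⁻¹)}) atTop (𝓝 0) := by
  obtain ⟨A, hA, hAle⟩ := exists_lintegral_errSq_le h hX
  obtain ⟨W, hW, hWle⟩ := exists_setLIntegral_mul_sq_norm_inv_le h hG
  have hg := hη.tendsto_growth (by linarith) h.ε_pos (by linarith [h.ε_le])
  have h1 := ENNReal.Tendsto.const_mul (a := δ⁻¹ * (c * A * W))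
    (ENNReal.tendsto_ofReal hg) (Or.inr (by finiteness))
  simp only [ENNReal.ofReal_zero, mul_zero] at h1
  have hw : AEMeasurable fun u ↦ ‖G (-u)‖ₑ * ‖(φ u)⁻¹‖ₑ ^ 2 :=
    (hGm.comp_quasiMeasurePreserving
      measurePreserving_neg_real.quasiMeasurePreserving).enorm.mul (aemeasurable_sq_enorm_inv h)
  refine tendsto_of_tendsto_of_tendsto_of_le_of_le' tendsto_const_nhds h1
    (Eventually.of_forall fun _ ↦ zero_le) ?_
  filter_upwards [hη.eventually_pos, eventually_ne_atTop 0] with n hn hn0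
  have hIm := aemeasurable_weightedErr h hX hw n (η n)⁻¹
  have hm := mul_meas_ge_le_lintegral₀ ((hIm.const_mul c).const_mul (ENNReal.ofReal √(n : ℝ))) δ
  have h2 := lintegral_weightedErr_le h hX (fun u ↦ hAle n u hn0) hw (η n)⁻¹
  rw [lintegral_const_mul' _ _ (by finiteness), lintegral_const_mul' _ _ hc] at hm
  have h3 : ENNReal.ofReal √(n : ℝ) * (c * ∫⁻ ω, weightedErr
      (fun u ↦ ‖G (-u)‖ₑ * ‖(φ u)⁻¹‖ₑ ^ 2) φ (fun k ↦ X k ω) n (η n)⁻¹ ∂μ) ≤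
      c * A * W * ENNReal.ofReal ((n : ℝ) ^ (-(1 / 2) : ℝ) * (1 + (η n)⁻¹) ^ (1 - ε)) := by
    calc _ ≤ ENNReal.ofReal √(n : ℝ) * (c * ((n : ℝ≥0∞)⁻¹ * A *
          (W * ENNReal.ofReal ((1 + (η n)⁻¹) ^ (1 - ε))))) := by
          gcongr
          exact h2.trans (mul_le_mul' le_rfl (hWle _ (by positivity)))
      _ = c * A * W * ((ENNReal.ofReal √(n : ℝ) * (n : ℝ≥0∞)⁻¹) *
          ENNReal.ofReal ((1 + (η n)⁻¹) ^ (1 - ε))) := by ring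
      _ = _ := by rw [ofReal_sqrt_mul_inv_natCast hn0, ENNReal.ofReal_mul (by positivity)]
  have h4 := hm.trans h3
  rw [mul_assoc, mul_comm δ⁻¹, ← div_eq_mul_inv, ENNReal.le_div_iff_mul_le (Or.inl hδ) (Or.inl hδ'),
    mul_comm]
  exact h4

/-- Chebyshev's inequality: the summands are independent and centred, so the second moment of the
normalized sum is at most that of one summand, the squared L²(P) distance of the scores. -/
lemma tendsto_measure_smoothing [IsProbabilityMeasure μ] (h : IncrementLaw P φ x₀ Δ k ε C) (hX : IsSample X μ P)
    (hG : FourierSplit G a b C₁) (hH : KernelTransform H C₂) (hη : BandwidthRate η ρ) {δ : ℝ≥0∞}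
    (hδ : δ ≠ 0) (hδ' : δ ≠ ∞) :
    Tendsto (fun n : ℕ ↦ μ {ω | δ ≤ ‖√(n : ℝ) * ((n : ℝ)⁻¹ * ∑ j ∈ Finset.range n,
      (smoothScore G φ H k x₀ Δ (η n) (X j ω) - score G φ k x₀ Δ (X j ω)))‖ₑ}) atTop (𝓝 0) := by
  have := h.prob
  obtain ⟨A, hA, hle⟩ := exists_lintegral_sq_smoothScore_sub_le h hG hH
  have h1 := ENNReal.Tendsto.const_mul (a := (δ ^ 2)⁻¹)
    ((tendsto_lintegral_sq_of_le hA h.ε_pos hle).comp hη.tendsto_nhdsGT)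
    (Or.inr (by simpa using hδ))
  rw [mul_zero] at h1
  refine tendsto_of_tendsto_of_tendsto_of_le_of_le' tendsto_const_nhds h1
    (Eventually.of_forall fun _ ↦ zero_le) ?_
  filter_upwards [hη.eventually_pos, eventually_ne_atTop 0] with n hn hn0
  have hn' : (0 : ℝ) < n := by positivity
  let f : ℝ → ℝ := fun x ↦ smoothScore G φ H k x₀ Δ (η n) x - score G φ k x₀ Δ x
  have hs := memLp_smoothScore h hG hH hn
  have hsc := memLp_score h hG hH
  have hf2 : MemLp f 2 P := hs.sub hsc
  have hfm : Measurable f :=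
    (continuous_smoothScore h hG hH hn).measurable.sub (measurable_score h hG)
  have hf0 : ∫ x, f x ∂P = 0 := by
    simp only [f]
    rw [integral_sub (hs.integrable (by norm_num)) (hsc.integrable (by norm_num)),
      integral_smoothScore h hG hH hn, integral_score h hG hH, sub_zero]
  have h2 := hX.lintegral_sq_mean_sub_le hfm hf2 hn0
  rw [hf0] at h2
  simp only [sub_zero] at h2
  have hXm := hX.measurable
  have hmeas : AEMeasurable (fun ω ↦ ‖√(n : ℝ) * ((n : ℝ)⁻¹ * ∑ j ∈ Finset.range n,
      f (X j ω))‖ₑ ^ 2) μ := by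
    refine Measurable.aemeasurable (Measurable.pow_const (Measurable.enorm ?_) 2)
    exact ((Finset.measurable_fun_sum _ fun j _ ↦ hfm.comp (hXm j)).const_mul _).const_mul _
  have hm := mul_meas_ge_le_lintegral₀ hmeas (δ ^ 2)
  have hE : ∫⁻ ω, ‖√(n : ℝ) * ((n : ℝ)⁻¹ * ∑ j ∈ Finset.range n, f (X j ω))‖ₑ ^ 2 ∂μ ≤
      ∫⁻ x, ‖f x‖ₑ ^ 2 ∂P := by
    simp_rw [enorm_mul √(n : ℝ), mul_pow]
    rw [lintegral_const_mul' _ _ (by finiteness)]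
    calc _ ≤ ‖√(n : ℝ)‖ₑ ^ 2 * ((n : ℝ≥0∞)⁻¹ * ∫⁻ x, ‖f x‖ₑ ^ 2 ∂P) := mul_le_mul' le_rfl h2
      _ = _ := by
        have e : ‖√(n : ℝ)‖ₑ ^ 2 = n := by
          rw [← ofReal_norm, ← ENNReal.ofReal_pow (norm_nonneg _), Real.norm_of_nonneg
            (Real.sqrt_nonneg _), Real.sq_sqrt hn'.le, ENNReal.ofReal_natCast]
        rw [e, ← mul_assoc, ENNReal.mul_inv_cancel (by exact_mod_cast hn0) (by simp), one_mul]
  have hset : {ω | δ ≤ ‖√(n : ℝ) * ((n : ℝ)⁻¹ * ∑ j ∈ Finset.range n, f (X j ω))‖ₑ} ⊆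
      {ω | δ ^ 2 ≤ ‖√(n : ℝ) * ((n : ℝ)⁻¹ * ∑ j ∈ Finset.range n, f (X j ω))‖ₑ ^ 2} :=
    fun ω (hω : δ ≤ _) ↦ (pow_le_pow_left' hω 2 : δ ^ 2 ≤ _)
  have h5 := (mul_le_mul' le_rfl (measure_mono hset)).trans (hm.trans hE)
  rw [mul_comm (δ ^ 2)⁻¹, ← div_eq_mul_inv, ENNReal.le_div_iff_mul_le
    (Or.inl (pow_ne_zero 2 hδ)) (Or.inl (by finiteness)), mul_comm]
  exact h5

end

end

end LevyCLT

namespace LevyCLT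

noncomputable section

/-! ### Asymptotic normality -/

section

variable {Ω : Type*} [MeasurableSpace Ω] {μ : Measure Ω} [IsProbabilityMeasure μ]
  {X : ℕ → Ω → ℝ} {P : Measure ℝ} {φ : ℝ → ℂ} {Δ γ : ℝ} {k : ℝ → ℝ} {ε C C₁ ρ : ℝ}
  {a b : ℝ → ℂ} {g K : ℝ → ℝ} {η : ℕ → ℝ}

lemma re_inv_mul_mean_smoothInfluence (G φ H : ℝ → ℂ) (k : ℝ → ℝ) (x₀ Δ η : ℝ) (x : ℕ → ℝ) (n : ℕ) :
    ((Complex.I * Δ)⁻¹ * ((n : ℂ)⁻¹ * ∑ j ∈ Finset.range n,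
      smoothInfluence G φ H k x₀ Δ η (x j))).re =
      (n : ℝ)⁻¹ * ∑ j ∈ Finset.range n, smoothScore G φ H k x₀ Δ η (x j) := by
  have : (n : ℂ)⁻¹ = (((n : ℝ)⁻¹ : ℝ) : ℂ) := by push_cast; rfl
  rw [mul_left_comm, Finset.mul_sum, this, Complex.re_ofReal_mul, Complex.re_sum]
  rfl

/-- The normalized estimation error is asymptotically equivalent to a normalized sum of scores. -/
lemma tendstoInMeasure_estimator_sub (h : IncrementLaw P φ (Δ * γ) Δ k ε C) (hX : IsSample X μ P)
    (hg : IsAdmissible g) (hK : IsKernel K) (hG : FourierSplit (ftL2 fun x ↦ (g x : ℂ)) a b C₁)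
    (hη : BandwidthRate η ρ) (hρ : 1 < ρ) :
    TendstoInMeasure μ (fun (n : ℕ) (ω : Ω) ↦
      √(n : ℝ) * ((estimator K Δ g (fun k ↦ X k ω) n (η n)).re - ((∫ x, g x * k x) + γ * g 0)) -
      (√(n : ℝ))⁻¹ * ∑ j ∈ Finset.range n,
        score (ftL2 fun x ↦ (g x : ℂ)) φ k (Δ * γ) Δ (X j ω)) atTop 0 := by
  obtain ⟨C₂, hH⟩ := hK.exists_kernelTransform
  obtain ⟨A, hA, hbias⟩ := exists_abs_centre_sub_le h hg hK hG
  have hgm : MemLp (fun x ↦ (g x : ℂ)) 2 := hg.square_integrable.ofReal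
  set G := ftL2 fun x ↦ (g x : ℂ) with hGdef
  set H := ft fun x ↦ (K x : ℂ) with hHdef
  set B := |Δ * γ| + Δ * C with hB
  set c : ℝ≥0∞ := ‖(Complex.I * (Δ : ℂ))⁻¹‖ₑ * ENNReal.ofReal (C₂ * (2 + 2 * B ^ 2)) with hc
  rw [tendstoInMeasure_iff_norm]
  intro δ hδ
  -- Bias, quadratic remainder and smoothing of the scores are each allotted δ/3.
  have hδ3 : 0 < δ / 3 := by positivity
  have hE : ENNReal.ofReal (δ / 3) ≠ 0 := by simpa using hδ3
  have t1 := tendsto_measure_not_goodSample h hX hη hρ B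
  have t2 := tendsto_measure_remainder h hX hG (memLp_ftL2 hgm).1 hη hρ (c := c) (by finiteness)
    hE ENNReal.ofReal_ne_top
  have t3 := tendsto_measure_smoothing h hX hG hH hη hE ENNReal.ofReal_ne_top
  have t := (t1.add t2).add t3
  simp only [add_zero] at t
  have tb : ∀ᶠ n : ℕ in atTop, √(n : ℝ) * |(centre G H k (Δ * γ) Δ (η n)).re -
      ((∫ x, g x * k x) + γ * g 0)| < δ / 3 := by
    have l1 := (hη.tendsto_bias hρ).const_mul A
    rw [mul_zero] at l1
    filter_upwards [l1.eventually_lt_const hδ3, hη.eventually_pos,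
      hη.tendsto_zero.eventually_le_const zero_lt_one,
      tendsto_log_natCast.eventually_gt_atTop 1] with n h1 h2 h3 h4
    refine lt_of_le_of_lt ?_ h1
    -- The free exponent is chosen as t = 1/log n.
    have h5 := hbias (η n) (Real.log n)⁻¹ h2 h3 (by positivity) (inv_lt_one_of_one_lt₀ h4)
    calc _ ≤ √(n : ℝ) * (A * (η n ^ (1 - (Real.log n)⁻¹) / (Real.log n)⁻¹)) := by gcongr
      _ = _ := by ring
  refine tendsto_of_tendsto_of_tendsto_of_le_of_le' tendsto_const_nhds t
    (Eventually.of_forall fun _ ↦ zero_le) ?_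
  filter_upwards [tb, hη.eventually_pos, eventually_ne_atTop 0] with n hbn hn hn0
  refine (measure_mono fun ω hω ↦ ?_).trans ((measure_union_le _ _).trans
    (add_le_add (measure_union_le _ _) le_rfl))
  -- Off the three exceptional events, each contribution stays below δ/3.
  by_contra hcon
  simp only [Set.mem_union, Set.mem_ofPred_eq, not_or, not_not, not_le] at hcon
  obtain ⟨⟨hgood, hR⟩, hV⟩ := hcon
  have hest := enorm_estimator_sub_le h hgm hG hH hn hn0 hgood
  rw [← mul_assoc ‖(Complex.I * (Δ : ℂ))⁻¹‖ₑ] at hest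
  set E := estimator K Δ g (fun k ↦ X k ω) n (η n) - (centre G H k (Δ * γ) Δ (η n) +
    (Complex.I * Δ)⁻¹ * ((n : ℂ)⁻¹ * ∑ j ∈ Finset.range n,
      smoothInfluence G φ H k (Δ * γ) Δ (η n) (X j ω))) with hEdef
  have hRE : |√(n : ℝ) * E.re| < δ / 3 := by
    rw [abs_mul, abs_of_nonneg (Real.sqrt_nonneg _)]
    refine lt_of_le_of_lt (mul_le_mul_of_nonneg_left (Complex.abs_re_le_norm E)
      (Real.sqrt_nonneg _)) ?_
    rw [← ENNReal.ofReal_lt_ofReal_iff hδ3, ENNReal.ofReal_mul (Real.sqrt_nonneg _), ofReal_norm]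
    exact lt_of_le_of_lt (mul_le_mul' le_rfl hest) hR
  set V := √(n : ℝ) * ((n : ℝ)⁻¹ * ∑ j ∈ Finset.range n, (smoothScore G φ H k (Δ * γ) Δ (η n) (X j ω) -
    score G φ k (Δ * γ) Δ (X j ω))) with hVdef
  have hV' : |V| < δ / 3 := by
    rw [← ofReal_norm, ENNReal.ofReal_lt_ofReal_iff hδ3, Real.norm_eq_abs] at hV
    exact hV
  have hre : (estimator K Δ g (fun k ↦ X k ω) n (η n)).re =
      (centre G H k (Δ * γ) Δ (η n)).re + (n : ℝ)⁻¹ * (∑ j ∈ Finset.range n,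
        smoothScore G φ H k (Δ * γ) Δ (η n) (X j ω)) + E.re := by
    rw [hEdef, Complex.sub_re, Complex.add_re, re_inv_mul_mean_smoothInfluence]
    ring
  have hsqrt : (√(n : ℝ))⁻¹ = √(n : ℝ) * (n : ℝ)⁻¹ := by
    have hn' : (0 : ℝ) < n := by positivity
    have h1 := Real.mul_self_sqrt hn'.le
    have h2 : √(n : ℝ) ≠ 0 := (Real.sqrt_pos.2 hn').ne'
    rw [← h1, Real.sqrt_mul_self (Real.sqrt_nonneg _)]
    field_simp
  have hdiff : √(n : ℝ) * ((estimator K Δ g (fun k ↦ X k ω) n (η n)).re -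
      ((∫ x, g x * k x) + γ * g 0)) - (√(n : ℝ))⁻¹ * ∑ j ∈ Finset.range n,
        score G φ k (Δ * γ) Δ (X j ω) =
      √(n : ℝ) * ((centre G H k (Δ * γ) Δ (η n)).re - ((∫ x, g x * k x) + γ * g 0)) + V +
        √(n : ℝ) * E.re := by
    rw [hre, hsqrt, hVdef, Finset.sum_sub_distrib]
    ring
  have hω' : δ ≤ ‖√(n : ℝ) * ((estimator K Δ g (fun k ↦ X k ω) n (η n)).re -
      ((∫ x, g x * k x) + γ * g 0)) - (√(n : ℝ))⁻¹ * ∑ j ∈ Finset.range n,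
        score G φ k (Δ * γ) Δ (X j ω) - 0‖ := hω
  rw [sub_zero, hdiff] at hω'
  have h1 := norm_add₃_le (a := √(n : ℝ) * ((centre G H k (Δ * γ) Δ (η n)).re -
    ((∫ x, g x * k x) + γ * g 0))) (b := V) (c := √(n : ℝ) * E.re)
  rw [norm_mul, Real.norm_of_nonneg (Real.sqrt_nonneg _)] at h1
  simp only [Real.norm_eq_abs] at h1 hω'
  linarith

/-- The central limit theorem for the scores. -/
lemma tendstoInDistribution_sum_score {x₀ C₂ : ℝ} {G H : ℝ → ℂ} (h : IncrementLaw P φ x₀ Δ k ε C)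
    (hX : IsSample X μ P) (hG : FourierSplit G a b C₁) (hH : KernelTransform H C₂) :
    TendstoInDistribution (fun (n : ℕ) (ω : Ω) ↦ (√(n : ℝ))⁻¹ * ∑ j ∈ Finset.range n,
        score G φ k x₀ Δ (X j ω)) atTop (id : ℝ → ℝ) (fun _ ↦ μ)
      (gaussianReal 0 (∫ x, score G φ k x₀ Δ x ^ 2 ∂P).toNNReal) := by
  have hm := measurable_score h hG
  have h2 := memLp_score h hG hH
  have hmean : ∫ ω, score G φ k x₀ Δ (X 0 ω) ∂μ = 0 := by
    rw [hX.integral_comp 0 h2.1, integral_score h hG hH]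
  have hL := hX.memLp_comp 0 h2
  have hvar : Var[fun ω ↦ score G φ k x₀ Δ (X 0 ω); μ] = ∫ x, score G φ k x₀ Δ x ^ 2 ∂P := by
    rw [variance_of_integral_eq_zero hL.1.aemeasurable hmean]
    exact hX.integral_comp 0 (f := fun x ↦ score G φ k x₀ Δ x ^ 2) (h2.1.pow 2)
  have hlaw : HasLaw (id : ℝ → ℝ) (gaussianReal 0
      Var[fun ω ↦ score G φ k x₀ Δ (X 0 ω); μ].toNNReal)
      (gaussianReal 0 (∫ x, score G φ k x₀ Δ x ^ 2 ∂P).toNNReal) := by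
    rw [hvar]; exact HasLaw.id
  have := tendstoInDistribution_inv_sqrt_mul_sum_sub (X := fun j ω ↦ score G φ k x₀ Δ (X j ω))
    hlaw hL (hX.indep.comp (fun _ ↦ score G φ k x₀ Δ) fun _ ↦ hm)
    fun i ↦ (hX.identDistrib i 0).comp hm
  simpa only [hmean, mul_zero, sub_zero] using this

end

end

end LevyCLT

theorem mainTheorem4 {Ω : Type*} [MeasurableSpace Ω] (μ : Measure Ω) [IsProbabilityMeasure μ]
    -- the Lévy process with drift `γ` and Lévy measure `ν`, observed at distance `Δ`
    (L : ℝ≥0 → Ω → ℝ) (γ : ℝ) (ν : Measure ℝ) (hL : LevyCLT.IsFVLevyProcess L μ γ ν)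
    (Δ : ℝ≥0) (hΔ : 0 < Δ)
    -- law and characteristic function of the increments
    (P : Measure ℝ) (hP : P = μ.map (L Δ)) (φ : ℝ → ℂ) (hφ : φ = charFun P)
    (hA : LevyCLT.LevyAssumption ν φ)
    (K : ℝ → ℝ) (hK : LevyCLT.IsKernel K)
    (h : ℕ → ℝ) (ρ : ℝ) (hρ : 1 < ρ) (hh : LevyCLT.BandwidthRate h ρ)
    (g : ℝ → ℝ) (hg : LevyCLT.IsAdmissible g) :
    -- the estimator is well defined with probability tending to one
    Tendsto (fun n : ℕ ↦ μ {ω | ∃ u : ℝ, |u| ≤ (h n)⁻¹ ∧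
      LevyCLT.empCharFun (fun k ↦ LevyCLT.increment L Δ k ω) n u = 0}) atTop (𝓝 0) ∧
    -- the estimator is real
    (∀ n ω, (LevyCLT.estimator K Δ g (fun k ↦ LevyCLT.increment L Δ k ω) n (h n)).im = 0) ∧
    -- the functions whose inverse Fourier transforms enter the variance are square integrable,
    -- and the integrand is well defined in `L²(P)`
    MemLp (LevyCLT.symbolOne g φ) 2 volume ∧
    MemLp (LevyCLT.symbolTwo g φ) 2 volume ∧
    (∀ᵐ x ∂P, ∃ l : ℂ, Tendsto (LevyCLT.localMean (LevyCLT.influence g φ) x) (𝓝[>] 0) (𝓝 l)) ∧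
    MemLp (LevyCLT.preciseRep (LevyCLT.influence g φ)) 2 P ∧
    -- asymptotic normality with the stated finite variance
    ∃ σsq : ℝ≥0,
      ((σsq : ℝ) : ℂ) = ((Complex.I * (Δ : ℝ)) ^ 2)⁻¹ *
        ∫ x, (LevyCLT.preciseRep (LevyCLT.influence g φ) x) ^ 2 ∂P ∧
      TendstoInDistribution
        (fun (n : ℕ) (ω : Ω) ↦ √(n : ℝ) *
          ((LevyCLT.estimator K Δ g (fun k ↦ LevyCLT.increment L Δ k ω) n (h n)).re -
            ((∫ x, g x * x ∂ν) + γ * g 0)))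
        atTop (id : ℝ → ℝ) (fun _ ↦ μ) (gaussianReal 0 σsq) := by
  obtain ⟨k, ε, C, hI, hk⟩ := hL.exists_incrementLaw hΔ hP hφ hA
  have hX : LevyCLT.IsSample (LevyCLT.increment L Δ) μ P := hP ▸ hL.levy.isSample_increment Δ
  obtain ⟨a, b, C₁, hG⟩ := hg.exists_fourierSplit
  obtain ⟨C₂, hH⟩ := hK.exists_kernelTransform
  have hGc := LevyCLT.ftL2_neg_of_real (f := g) hg.square_integrable.ofReal
  have hHc := LevyCLT.ft_neg_of_real K
  have hrep := LevyCLT.preciseRep_influence_ae_eq hI hG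
  refine ⟨?_, fun n ω ↦ LevyCLT.estimator_im _ _ _ _ _ _, LevyCLT.memLp_symbolOne hI hG,
    LevyCLT.memLp_symbolTwo hI hG, ?_, (memLp_congr_ae hrep).2
      (LevyCLT.memLp_limitInfluence hI hG hH),
    (∫ x, LevyCLT.score (LevyCLT.ftL2 fun x ↦ (g x : ℂ)) φ k (Δ * γ) Δ x ^ 2 ∂P).toNNReal, ?_, ?_⟩
  -- On the good event |f| ≤ 1/2 on the whole band, which excludes a zero of φ_n = φ(1 + f).
  · refine tendsto_of_tendsto_of_tendsto_of_le_of_le' tendsto_const_nhds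
      (LevyCLT.tendsto_measure_not_goodSample hI hX hh hρ (|(Δ : ℝ) * γ| + Δ * C))
      (Eventually.of_forall fun _ ↦ zero_le) ?_
    filter_upwards [eventually_ne_atTop 0] with n hn
    refine measure_mono fun ω hω hgood ↦ ?_
    obtain ⟨u, hu, h0⟩ := hω
    exact hgood.empCharFun_ne_zero hI hn hu h0
  · filter_upwards [LevyCLT.ae_tendsto_localMean_influence hI hG] with x hx
    exact ⟨_, hx⟩
  · rw [Real.coe_toNNReal _ (integral_nonneg fun x ↦ sq_nonneg _),
      ← LevyCLT.integral_limitInfluence_sq hI hG hH hGc hHc]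
    congr 1
    refine integral_congr_ae ?_
    filter_upwards [hrep] with x hx
    rw [hx]
  -- Slutsky's theorem: the normalized error differs from the normalized sum of scores by a term
  -- tending to 0 in measure.
  · refine tendstoInDistribution_of_tendstoInMeasure_sub _ _
      (LevyCLT.tendstoInDistribution_sum_score hI hX hG hH) ?_ fun n ↦ ?_
    · rw [hk g hg.bounded]
      exact LevyCLT.tendstoInMeasure_estimator_sub hI hX hg hK hG hh hρ
    · exact ((Complex.measurable_re.comp_aemeasurable (LevyCLT.aemeasurable_estimator hX.measurable
        hg.bounded.1 hK.differentiable.continuous.measurable Δ n (h n))).sub_const _).const_mul _
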